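/- An instance $\mathcal I$ of matchings under preferences consists of a finite bipartite graph $(W\cup F,E)$, whose vertices (workers $W$ and firms $F$) are called agents, and, for every agent $x$, a strict linear order $\succ_x^{\mathcal I}$ on the set of neighbors of $x$. A matching is a set $M\subseteq E$ of pairwise disjoint edges. An agent prefers a matching $M$ over a matching $M'$ if it is matched in $M$ and unmatched in $M'$, or if it is matched in both and ranks its partner in $M$ above its partner in $M'$. Let $\Delta^{\mathcal I}(M,M')$ be the number of agents that prefer $M$ over $M'$ minus the number of agents that prefer $M'$ over $M$. A matching $M$ is popular for $\mathcal I$ if $\Delta^{\mathcal I}(M,M')\ge 0$ for every matching $M'$. It is dominant for $\mathcal I$ if it is popular and $\Delta^{\mathcal I}(M,M')>0$ for every matching $M'$ with $|M'|>|M|$. For two instances $\mathcal I_A,\mathcal I_B$ on the same agents, a robust popular (respectively, robust dominant) matching is a matching that is popular (respectively, dominant) both for $\mathcal I_A$ and for $\mathcal I_B$. **Theorem.** Consider as inputs the pairs $(\mathcal I_A,\mathcal I_B)$ of instances on the same agents, given by their preference lists, that have the same underlying graph and differ in the preference order of at most one agent. 1. There is a polynomial-time algorithm that, given such a pair, outputs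 a robust popular matching or reports correctly that none exists. 2. There is a polynomial-time algorithm that, given such a pair, outputs a robust dominant matching or reports correctly that none exists. In particular, the existence of a robust popular matching, and that of a robust dominant matching, can be decided in polynomial time for such pairs. -/

import Mathlib

/-! ## Matchings under preferences -/

/-- An instance of matchings under preferences with set of workers `W` and set of firms `F`.
Every agent has a preference order, given as the duplicate-free list of the agent's neighbours,
from most to least preferred.  Worker `w` and firm `f` are joined by an edge of the bipartite
graph iff each of them occurs in the list of the other. -/
structure MatP (W F : Type*) where
  worker : W → List F
  firm : F → List W
  worker_nodup : ∀ w, (worker w).Nodup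
  firm_nodup : ∀ f, (firm f).Nodup
  mem_worker_iff : ∀ w f, f ∈ worker w ↔ w ∈ firm f

/-- `y` is ranked strictly above `z` in the preference order `l`. -/
def RankedAbove {α : Type*} [DecidableEq α] (l : List α) (y z : α) : Prop :=
  y ∈ l ∧ z ∈ l ∧ l.idxOf y < l.idxOf z

namespace MatP

variable {W F : Type*}

/-- The edge relation of the bipartite graph of the instance. -/
def Edge (I : MatP W F) (w : W) (f : F) : Prop := f ∈ I.worker w

/-- A matching: a set of edges of the graph that are pairwise disjoint. -/
def IsMatching (I : MatP W F) (M : Finset (W × F)) : Prop :=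
  (∀ e ∈ M, I.Edge e.1 e.2) ∧
    ∀ e ∈ M, ∀ e' ∈ M, e ≠ e' → e.1 ≠ e'.1 ∧ e.2 ≠ e'.2

variable [DecidableEq W] [DecidableEq F]

/-- Worker `w` prefers `M` over `M'`: `w` is matched in `M`, and either `w` is unmatched in `M'`
or the partner in `M` is ranked above the partner in `M'`. -/
def WorkerPrefers (I : MatP W F) (w : W) (M M' : Finset (W × F)) : Prop :=
  ∃ f, (w, f) ∈ M ∧
    ((∀ f', (w, f') ∉ M') ∨ ∃ f', (w, f') ∈ M' ∧ RankedAbove (I.worker w) f f')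

/-- Firm `f` prefers `M` over `M'`. -/
def FirmPrefers (I : MatP W F) (f : F) (M M' : Finset (W × F)) : Prop :=
  ∃ w, (w, f) ∈ M ∧
    ((∀ w', (w', f) ∉ M') ∨ ∃ w', (w', f) ∈ M' ∧ RankedAbove (I.firm f) w w')

/-- Agent `x` (a worker or a firm) prefers `M` over `M'`. -/
def Prefers (I : MatP W F) (x : W ⊕ F) (M M' : Finset (W × F)) : Prop :=
  match x with
  | Sum.inl w => I.WorkerPrefers w M M'
  | Sum.inr f => I.FirmPrefers f M M'

open Classical in
/-- The vote of agent `x` between `M` and `M'`. -/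
noncomputable def vote (I : MatP W F) (x : W ⊕ F) (M M' : Finset (W × F)) : ℤ :=
  if I.Prefers x M M' then 1 else if I.Prefers x M' M then -1 else 0

variable [Fintype W] [Fintype F]

/-- The popularity margin between `M` and `M'`: the sum of the votes of all agents. -/
noncomputable def margin (I : MatP W F) (M M' : Finset (W × F)) : ℤ :=
  ∑ x : W ⊕ F, I.vote x M M'

/-- A popular matching does not lose a majority vote against any matching. -/
def IsPopular (I : MatP W F) (M : Finset (W × F)) : Prop :=
  I.IsMatching M ∧ ∀ M', I.IsMatching M' → 0 ≤ I.margin M M'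

/-- A dominant matching is popular and wins against every matching of larger size. -/
def IsDominant (I : MatP W F) (M : Finset (W × F)) : Prop :=
  I.IsPopular M ∧ ∀ M', I.IsMatching M' → M.card < M'.card → 0 < I.margin M M'

/-- A robust popular matching with respect to `A` and `B`. -/
def IsRobustPopular (A B : MatP W F) (M : Finset (W × F)) : Prop :=
  A.IsPopular M ∧ B.IsPopular M

/-- A robust dominant matching with respect to `A` and `B`. -/
def IsRobustDominant (A B : MatP W F) (M : Finset (W × F)) : Prop :=
  A.IsDominant M ∧ B.IsDominant M

end MatP

/-- Agent `x` has different preference orders in `A` and `B`. -/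
def MatP.DifferAt {W F : Type*} (A B : MatP W F) (x : W ⊕ F) : Prop :=
  match x with
  | Sum.inl w => A.worker w ≠ B.worker w
  | Sum.inr f => A.firm f ≠ B.firm f

/-- A pair of instances on the same `n` workers and `m` firms. -/
structure InstancePair where
  n : ℕ
  m : ℕ
  A : MatP (Fin n) (Fin m)
  B : MatP (Fin n) (Fin m)

namespace InstancePair

/-- The two instances have the same underlying graph and differ in the preference order of at
most one agent. -/
def OneAgentPerturbed (P : InstancePair) : Prop :=
  (∀ w f, P.A.Edge w f ↔ P.B.Edge w f) ∧ {x | P.A.DifferAt P.B x}.Subsingleton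

/-- A preference list, preceded by its length. -/
def encodeList {k : ℕ} (l : List (Fin k)) : List ℕ :=
  l.length :: l.map (fun y => (y : ℕ))

/-- All preference lists of an instance, those of the workers first. -/
def encodeInstance {n m : ℕ} (I : MatP (Fin n) (Fin m)) : List ℕ :=
  (List.finRange n).flatMap (fun w => encodeList (I.worker w)) ++
    (List.finRange m).flatMap (fun f => encodeList (I.firm f))

/-- The input word of an instance pair: the numbers of workers and firms, then the preference
lists of `A`, then those of `B`.  No entry exceeds the length of the word. -/
def encode (P : InstancePair) : List ℕ :=
  P.n :: P.m :: (encodeInstance P.A ++ encodeInstance P.B)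

/-- The output word `out` is a correct answer to the problem of finding a set of worker-firm pairs
with the property `Good`: it is `[0]` if there is none, and otherwise `1` followed by the pairs
of one such set, listed in any order. -/
def IsAnswer (P : InstancePair) (Good : Finset (Fin P.n × Fin P.m) → Prop) (out : List ℕ) :
    Prop :=
  ((¬ ∃ M, Good M) ∧ out = [0]) ∨
    ∃ l : List (Fin P.n × Fin P.m), l.Nodup ∧ Good l.toFinset ∧
      out = 1 :: l.flatMap (fun e => [(e.1 : ℕ), (e.2 : ℕ)])

end InstancePair

/-! ## Random access machines

Programs for a random access machine in structured form, with uniform cost.  The machine has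
registers and arrays with entries in `ℕ`, of which each program uses finitely many; arrays are
accessed at computed indices.  The only arithmetic operations are addition and truncated
subtraction, so the numbers in a computation of `t` steps have `O(t)` bits more than those in the
input, and polynomial time on this machine is polynomial time on a Turing machine. -/

namespace RAM

/-- The contents of the registers and of the arrays. -/
structure Store where
  reg : ℕ → ℕ
  arr : ℕ → ℕ → ℕ

/-- Arithmetic expressions; `read a i` is the entry of array `a` at the index `i`. -/
inductive Expr where
  | const (c : ℕ)
  | reg (x : ℕ)
  | read (a : ℕ) (i : Expr)
  | add (e₁ e₂ : Expr)
  | sub (e₁ e₂ : Expr)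

/-- The value of an expression. -/
def Expr.eval (s : Store) : Expr → ℕ
  | .const c => c
  | .reg x => s.reg x
  | .read a i => s.arr a (i.eval s)
  | .add e₁ e₂ => e₁.eval s + e₂.eval s
  | .sub e₁ e₂ => e₁.eval s - e₂.eval s

/-- The number of operations that the evaluation of an expression takes. -/
def Expr.cost : Expr → ℕ
  | .const _ => 1
  | .reg _ => 1
  | .read _ i => i.cost + 1
  | .add e₁ e₂ => e₁.cost + e₂.cost + 1
  | .sub e₁ e₂ => e₁.cost + e₂.cost + 1

/-- Programs.  A test `e` succeeds iff the value of `e` is not zero. -/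
inductive Prog where
  | skip
  | assign (x : ℕ) (e : Expr)
  | write (a : ℕ) (i e : Expr)
  | seq (p q : Prog)
  | ite (e : Expr) (p q : Prog)
  | loop (e : Expr) (p : Prog)

/-- `Exec p s t s'`: started with the store `s`, the program `p` halts after exactly `t` steps
with the store `s'`. -/
inductive Exec : Prog → Store → ℕ → Store → Prop where
  | skip (s : Store) : Exec .skip s 1 s
  | assign (x : ℕ) (e : Expr) (s : Store) :
      Exec (.assign x e) s (e.cost + 1) { s with reg := Function.update s.reg x (e.eval s) }
  | write (a : ℕ) (i e : Expr) (s : Store) :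
      Exec (.write a i e) s (i.cost + e.cost + 1)
        { s with
          arr := Function.update s.arr a (Function.update (s.arr a) (i.eval s) (e.eval s)) }
  | seq {p q : Prog} {s s' s'' : Store} {t t' : ℕ} :
      Exec p s t s' → Exec q s' t' s'' → Exec (.seq p q) s (t + t') s''
  | ite_true {e : Expr} {p q : Prog} {s s' : Store} {t : ℕ} :
      e.eval s ≠ 0 → Exec p s t s' → Exec (.ite e p q) s (e.cost + 1 + t) s'
  | ite_false {e : Expr} {p q : Prog} {s s' : Store} {t : ℕ} :
      e.eval s = 0 → Exec q s t s' → Exec (.ite e p q) s (e.cost + 1 + t) s'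
  | loop_done {e : Expr} {p : Prog} {s : Store} :
      e.eval s = 0 → Exec (.loop e p) s (e.cost + 1) s
  | loop_step {e : Expr} {p : Prog} {s s' s'' : Store} {t t' : ℕ} :
      e.eval s ≠ 0 → Exec p s t s' → Exec (.loop e p) s' t' s'' →
        Exec (.loop e p) s (e.cost + 1 + t + t') s''

/-- The machine is deterministic. -/
theorem Exec.deterministic {p : Prog} {s s₁ s₂ : Store} {t₁ t₂ : ℕ}
    (h₁ : Exec p s t₁ s₁) (h₂ : Exec p s t₂ s₂) : t₁ = t₂ ∧ s₁ = s₂ := by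
  induction h₁ generalizing t₂ s₂ with
  | skip => cases h₂; exact ⟨rfl, rfl⟩
  | assign => cases h₂; exact ⟨rfl, rfl⟩
  | write => cases h₂; exact ⟨rfl, rfl⟩
  | seq _ _ ih ih' =>
    cases h₂ with
    | seq g g' =>
      obtain ⟨rfl, rfl⟩ := ih g
      obtain ⟨rfl, rfl⟩ := ih' g'
      exact ⟨rfl, rfl⟩
  | ite_true he _ ih =>
    cases h₂ with
    | ite_true _ g => obtain ⟨rfl, rfl⟩ := ih g; exact ⟨rfl, rfl⟩
    | ite_false ge _ => exact absurd ge he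
  | ite_false he _ ih =>
    cases h₂ with
    | ite_true ge _ => exact absurd he ge
    | ite_false _ g => obtain ⟨rfl, rfl⟩ := ih g; exact ⟨rfl, rfl⟩
  | loop_done he =>
    cases h₂ with
    | loop_done => exact ⟨rfl, rfl⟩
    | loop_step ge _ _ => exact absurd he ge
  | loop_step he _ _ ih ih' =>
    cases h₂ with
    | loop_done ge => exact absurd ge he
    | loop_step _ g g' =>
      obtain ⟨rfl, rfl⟩ := ih g
      obtain ⟨rfl, rfl⟩ := ih' g'
      exact ⟨rfl, rfl⟩

/-- The initial store on an input word: register `0` holds its length, array `0` holds its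
entries, and everything else is `0`. -/
def Store.input (l : List ℕ) : Store where
  reg x := if x = 0 then l.length else 0
  arr a i := if a = 0 then l.getD i 0 else 0

/-- The output word of a store: the first entries of array `0`, their number being in
register `0`. -/
def Store.output (s : Store) : List ℕ :=
  (List.range (s.reg 0)).map (s.arr 0)

/-- The problem whose inputs are the `a : α` with `dom a`, encoded as words by `enc`, and whose
correct outputs on `a` are the words `out` with `sol a out`, can be solved in polynomial time:
some program outputs a correct answer on each input, within a number of steps that is at most a
fixed polynomial of the length of the input word. -/
def PolyTimeSolvable {α : Type*} (enc : α → List ℕ) (dom : α → Prop)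
    (sol : α → List ℕ → Prop) : Prop :=
  ∃ (p : Prog) (q : Polynomial ℕ), ∀ a, dom a →
    ∃ (t : ℕ) (s : Store), Exec p (Store.input (enc a)) t s ∧
      t ≤ q.eval (enc a).length ∧ sol a s.output

end RAM

/-! Margins as weights. Against a matching M, let an end of an edge gain 2, 1 or 0 according to
whether it likes the edge more than, as much as, or less than its partner in M, and 1 if M leaves it
unmatched. Then the margin of M over N is 2|M| minus the total gain of the edges of N
(`MatP.margin_eq`). So M is popular iff it has maximum weight for its own gains, and linear
programming duality (`exists_dual`) turns popularity into a certificate: values of the agents.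

Reduction to one instance. Let (a, b) be an edge of M such that all agents other than a and b have
the same list in both instances. In the hybrid for (a, b), the lists of a and b are rearranged so
that exactly those agents stand above the partner in (a, b) that do so in A or in B. Gains in the
hybrid dominate those in A and in B. Conversely, a competitor N has at most one edge at the
differing agent, so its gains in the hybrid are all those of A or all those of B. Hence M is popular
(dominant) for the hybrid iff it is for A and for B (`Pref.IsHybrid.isPop`, `Pref.IsHybrid.isPop_of`
and their analogues for dominance). If the differing agent is unmatched in M, its order has no
influence on gains, and A itself serves as the hybrid.

Prescribed edges in one instance. Let workers offer contracts at two levels, all firms at level 0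
before any at level 1, while firms prefer level 1. The stable matchings of this market are exactly
the dominant matchings (`Pref.LStable.isDom`, `Pref.IsDom.exists_lstable`); ordinary stable
matchings, with one level, are popular. Every edge of a popular matching lies in a stable matching
of one of the two kinds (`Pref.IsPop.exists_lstable`): if the dual value vanishes at the edge, all
such edges extend to a one-level stable matching; otherwise all edges with nonzero value extend to a
two-level one. To find a stable matching through a prescribed contract, the contracts that are worse
for its firm are deleted. Deferred acceptance is optimal for workers, hence worst for firms, and the
firms with a contract do not depend on the stable matching (`Market.Stable.exists_key_le`). So the
firm ends at the prescribed contract if any stable matching contains it (`Pref.run_trunc_eq`).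

Algorithm. The candidates are triples (v, a, b): v = 0 stands for one level, v = 1 and v = 2 for two
levels with the target contract at level 0 and 1; a ≥ n means that there is no target. The last case
is complete because agents unmatched in a popular (dominant) matching are unmatched in every
one-level (two-level) stable matching (`MatP.unmatched_of_isPop`, `MatP.unmatched_of_isDom`). Robust
popularity uses all v, robust dominance only v ≥ 1.

Running time. The algorithm is written as functions of the input word, and `RAM.C`, the class of
functions computed by a program in polynomial time, is closed under the constructions used: bounded
sums, quantifiers and searches, recursion, and iteration on tables. All loops run the same
polynomial number of times, `RAM.loopBound`. -/

/-! ## Potentials and optimal dual solutions -/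

/-- The total weight of the arcs of a path, given as the list of its vertices. -/
def pathWeight {N : Type*} (d : N → N → ℤ) : List N → ℤ
  | [] => 0
  | [_] => 0
  | x :: y :: l => d x y + pathWeight d (y :: l)

theorem pathWeight_append {N : Type*} (d : N → N → ℤ) (u : N) (s : List N) :
    ∀ p : List N, pathWeight d (p ++ u :: s) = pathWeight d (p ++ [u]) + pathWeight d (u :: s)
  | [] => by simp [pathWeight]
  | [x] => by simp [pathWeight]
  | x :: y :: l => by
    have := pathWeight_append d u s (y :: l)
    simp only [List.cons_append, pathWeight] at this ⊢
    linarith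

/-- A simple path can be closed to a cyclic permutation. -/
theorem exists_perm_of_path {N : Type*} [Fintype N] [DecidableEq N] {R : N → N → Prop}
    {d : N → N → ℤ} (hR : ∀ u, R u u) (h0 : ∀ u, d u u = 0) :
    ∀ (l : List N) (x : N), (x :: l).Nodup → (x :: l).IsChain R →
      ∃ τ : Equiv.Perm N, (∀ u, u ∉ x :: l → τ u = u) ∧
        τ ((x :: l).getLast (List.cons_ne_nil _ _)) = x ∧
        (∀ u, u ≠ (x :: l).getLast (List.cons_ne_nil _ _) → R u (τ u)) ∧
        ∑ u ∈ Finset.univ.erase ((x :: l).getLast (List.cons_ne_nil _ _)), d u (τ u) =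
          pathWeight d (x :: l)
  | [], x, _, _ => ⟨1, by simp, by simp, fun u _ => hR u, by simp [h0, pathWeight]⟩
  | y :: l, x, hn, hc => by
    rw [List.nodup_cons] at hn
    rw [List.isChain_cons_cons] at hc
    obtain ⟨τ, h1, h2, h3, h4⟩ := exists_perm_of_path hR h0 l y hn.2 hc.2
    have hlast : (x :: y :: l).getLast (List.cons_ne_nil _ _) =
        (y :: l).getLast (List.cons_ne_nil _ _) := by simp
    rw [hlast]
    set z := (y :: l).getLast (List.cons_ne_nil _ _) with hz
    have hzm : z ∈ y :: l := List.getLast_mem _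
    have hxz : x ≠ z := fun h => hn.1 (h ▸ hzm)
    have hτx : τ x = x := h1 x hn.1
    have hsame : ∀ u, u ≠ z → u ≠ x → Equiv.swap x y (τ u) = τ u := by
      intro u hu hux
      apply Equiv.swap_apply_of_ne_of_ne
      · rw [← hτx]; exact fun h => hux (τ.injective h)
      · rw [← h2]; exact fun h => hu (τ.injective h)
    -- The cycle on `y :: l` sends its last vertex `z` to `y`; composing with the swap inserts `x`
    -- between `z` and `y`. The closing arc from `z` is left out of the claims on arcs and weights.
    refine ⟨τ.trans (Equiv.swap x y), ?_, ?_, ?_, ?_⟩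
    · intro u hu
      simp only [List.mem_cons, not_or] at hu
      have hm : u ∉ y :: l := by simp [hu]
      simp only [Equiv.trans_apply]
      rw [h1 u hm, Equiv.swap_apply_of_ne_of_ne hu.1 hu.2.1]
    · simp [h2]
    · intro u hu
      simp only [Equiv.trans_apply]
      by_cases hux : u = x
      · subst hux; rw [hτx, Equiv.swap_apply_left]; exact hc.1
      · rw [hsame u hu hux]; exact h3 u hu
    · have hxm : x ∈ Finset.univ.erase z := by simp [hxz]
      simp only [Equiv.trans_apply, pathWeight]
      rw [← h4, ← Finset.add_sum_erase _ _ hxm, ← Finset.add_sum_erase _ _ hxm, hτx,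
        Equiv.swap_apply_left, h0, zero_add]
      congr 1
      refine Finset.sum_congr rfl fun u hu => ?_
      simp only [Finset.mem_erase] at hu
      rw [hsame u hu.2.1 hu.1]

/-- If no permutation along the arcs has positive weight, then there is a potential. -/
theorem exists_potential {N : Type*} [Fintype N] [DecidableEq N] {R : N → N → Prop}
    {d : N → N → ℤ} (hR : ∀ u, R u u) (h0 : ∀ u, d u u = 0)
    (h : ∀ τ : Equiv.Perm N, (∀ u, R u (τ u)) → ∑ u, d u (τ u) ≤ 0) :
    ∃ π : N → ℤ, ∀ u v, R u v → d u v + π v ≤ π u := by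
  have key : ∀ u, ∃ l : List N, ((u :: l).Nodup ∧ (u :: l).IsChain R) ∧
      ∀ l', ((u :: l').Nodup ∧ (u :: l').IsChain R) →
        pathWeight d (u :: l') ≤ pathWeight d (u :: l) := by
    intro u
    have hfin : {l : List N | (u :: l).Nodup ∧ (u :: l).IsChain R}.Finite := by
      have : {l : List N | l.Nodup}.Finite := (List.finite_length_le N (Fintype.card N)).subset fun l hl =>
        hl.length_le_card
      exact this.subset fun l hl => (List.nodup_cons.1 hl.1).2
    obtain ⟨l, hl, hmax⟩ := Set.exists_max_image _ (fun l => pathWeight d (u :: l)) hfin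
      ⟨[], by simp⟩
    exact ⟨l, hl, hmax⟩
  choose l hl hmax using key
  -- The potential of `u` is the largest weight of a simple path that starts at `u`.
  refine ⟨fun u => pathWeight d (u :: l u), fun u v huv => ?_⟩
  -- If the best path from `v` avoids `u`, the arc extends it to a path from `u`. Otherwise its part
  -- up to `u` and the arc from `u` to `v` form a cycle, of weight at most 0, and its rest is a path
  -- from `u`.
  by_cases hu : u ∈ v :: l v
  · obtain ⟨p, s, hps⟩ := List.append_of_mem hu
    have hnd := (hl v).1
    have hch := (hl v).2
    have e1 : v :: l v = (p ++ [u]) ++ s := by simp [hps]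
    have hsuf : u :: s <:+ v :: l v := ⟨p, hps.symm⟩
    have hpre : p ++ [u] <+: v :: l v := ⟨s, e1.symm⟩
    have hle := hmax u s ⟨hnd.sublist hsuf.sublist, hch.suffix hsuf⟩
    have hw : pathWeight d (v :: l v) = pathWeight d (p ++ [u]) + pathWeight d (u :: s) := by
      rw [hps, pathWeight_append]
    obtain ⟨t, ht⟩ : ∃ t, p ++ [u] = v :: t := by
      cases p with
      | nil => simp at hps; exact ⟨[], by simp [hps.1]⟩
      | cons a p => simp at hps; exact ⟨p ++ [u], by simp [hps.1]⟩
    have hlast : (v :: t).getLast (List.cons_ne_nil _ _) = u := by simp [← ht]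
    obtain ⟨τ, -, h2, h3, h4⟩ := exists_perm_of_path hR h0 t v
      (ht ▸ hnd.sublist hpre.sublist) (ht ▸ hch.prefix hpre)
    rw [hlast] at h2 h3 h4
    have := h τ fun x => by
      by_cases hx : x = u
      · rw [hx, h2]; exact huv
      · exact h3 x hx
    rw [← Finset.add_sum_erase _ _ (Finset.mem_univ u), h2, h4, ← ht] at this
    linarith
  · exact hmax u (v :: l v)
      ⟨List.nodup_cons.2 ⟨hu, (hl v).1⟩, List.isChain_cons_cons.2 ⟨huv, (hl v).2⟩⟩

/-- A set of pairwise disjoint edges of the bipartite graph with edge relation `E`. -/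
def IsMatchingOf {W F : Type*} (E : W → F → Prop) (M : Finset (W × F)) : Prop :=
  (∀ e ∈ M, E e.1 e.2) ∧ ∀ e ∈ M, ∀ e' ∈ M, e ≠ e' → e.1 ≠ e'.1 ∧ e.2 ≠ e'.2

namespace IsMatchingOf

variable {W F : Type*} {E : W → F → Prop} {M : Finset (W × F)}

theorem edge (hM : IsMatchingOf E M) {w : W} {f : F} (h : (w, f) ∈ M) : E w f := hM.1 _ h

theorem firm_unique (hM : IsMatchingOf E M) {w : W} {f f' : F} (h : (w, f) ∈ M)
    (h' : (w, f') ∈ M) : f = f' := by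
  by_contra hne
  exact (hM.2 _ h _ h' (by simp [hne])).1 rfl

theorem worker_unique (hM : IsMatchingOf E M) {w w' : W} {f : F} (h : (w, f) ∈ M)
    (h' : (w', f) ∈ M) : w = w' := by
  by_contra hne
  exact (hM.2 _ h _ h' (by simp [hne])).2 rfl

theorem of_unique (hE : ∀ w f, (w, f) ∈ M → E w f)
    (h1 : ∀ w f f', (w, f) ∈ M → (w, f') ∈ M → f = f')
    (h2 : ∀ w w' f, (w, f) ∈ M → (w', f) ∈ M → w = w') : IsMatchingOf E M := by
  refine ⟨fun e he => hE _ _ he, ?_⟩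
  rintro ⟨w, f⟩ h ⟨w', f'⟩ h' hne
  constructor
  · rintro rfl; exact hne (by rw [h1 _ _ _ h h'])
  · rintro rfl; exact hne (by rw [h2 _ _ _ h h'])

end IsMatchingOf

/-! ### Linear programming duality for bipartite matchings -/

section Dual

variable {W F : Type*}

/-- The weight of an arc between agents: that of the edge, and `0` for a loop. -/
def arcWeight (c : W → F → ℤ) : W ⊕ F → W ⊕ F → ℤ
  | .inl w, .inr f => c w f
  | .inr f, .inl w => c w f
  | _, _ => 0

/-- The arcs between agents: loops, and both orientations of the edges. -/
def IsArc (E : W → F → Prop) : W ⊕ F → W ⊕ F → Prop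
  | .inl w, .inr f => E w f
  | .inr f, .inl w => E w f
  | .inl w, .inl w' => w = w'
  | .inr f, .inr f' => f = f'

open Classical in
/-- The partner of an agent in a matching, and the agent itself if it is unmatched. -/
noncomputable def partner (M : Finset (W × F)) : W ⊕ F → W ⊕ F
  | .inl w => if h : ∃ f, (w, f) ∈ M then .inr h.choose else .inl w
  | .inr f => if h : ∃ w, (w, f) ∈ M then .inl h.choose else .inr f

variable {E : W → F → Prop} {M : Finset (W × F)}

theorem partner_inl (hM : IsMatchingOf E M) {w : W} {f : F} (h : (w, f) ∈ M) :
    partner M (.inl w) = .inr f := by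
  have hex : ∃ f, (w, f) ∈ M := ⟨f, h⟩
  simp only [partner, hex, dite_true]
  rw [hM.firm_unique hex.choose_spec h]

theorem partner_inr (hM : IsMatchingOf E M) {w : W} {f : F} (h : (w, f) ∈ M) :
    partner M (.inr f) = .inl w := by
  have hex : ∃ w, (w, f) ∈ M := ⟨w, h⟩
  simp only [partner, hex, dite_true]
  rw [hM.worker_unique hex.choose_spec h]

theorem partner_involutive (hM : IsMatchingOf E M) : Function.Involutive (partner M) := by
  rintro (w | f)
  · by_cases h : ∃ f, (w, f) ∈ M
    · obtain ⟨f, h⟩ := h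
      rw [partner_inl hM h, partner_inr hM h]
    · simp [partner, h]
  · by_cases h : ∃ w, (w, f) ∈ M
    · obtain ⟨w, h⟩ := h
      rw [partner_inr hM h, partner_inl hM h]
    · simp [partner, h]

theorem isArc_partner (hM : IsMatchingOf E M) (u : W ⊕ F) : IsArc E u (partner M u) := by
  rcases u with w | f
  · by_cases h : ∃ f, (w, f) ∈ M
    · obtain ⟨f, h⟩ := h
      rw [partner_inl hM h]; exact hM.1 _ h
    · simp [partner, h, IsArc]
  · by_cases h : ∃ w, (w, f) ∈ M
    · obtain ⟨w, h⟩ := h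
      rw [partner_inr hM h]; exact hM.1 _ h
    · simp [partner, h, IsArc]

variable [Fintype W] [Fintype F]

open Classical in
/-- A permutation along arcs is the union of two matchings. -/
theorem sum_arcWeight (c : W → F → ℤ) (σ : W ⊕ F → W ⊕ F) :
    ∑ u, arcWeight c u (σ u) =
      ∑ e : W × F with σ (.inl e.1) = .inr e.2, c e.1 e.2 +
        ∑ e : W × F with σ (.inr e.2) = .inl e.1, c e.1 e.2 := by
  rw [Fintype.sum_sum_type, Finset.sum_filter, Finset.sum_filter, Fintype.sum_prod_type,
    Fintype.sum_prod_type_right]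
  congr 1
  · refine Finset.sum_congr rfl fun w _ => ?_
    rcases h : σ (.inl w) with w' | f <;> simp [h, arcWeight]
  · refine Finset.sum_congr rfl fun f _ => ?_
    rcases h : σ (.inr f) with w | f' <;> simp [h, arcWeight]

-- Functionality of σ makes edges disjoint at one side, injectivity at the other.
open Classical in
theorem isMatchingOf_perm {σ : Equiv.Perm (W ⊕ F)} (hσ : ∀ u, IsArc E u (σ u)) :
    IsMatchingOf E (Finset.univ.filter fun e : W × F => σ (.inl e.1) = .inr e.2) ∧
      IsMatchingOf E (Finset.univ.filter fun e : W × F => σ (.inr e.2) = .inl e.1) := by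
  constructor <;> apply IsMatchingOf.of_unique <;>
    simp only [Finset.mem_filter, Finset.mem_univ, true_and]
  · intro w f h; simpa [h, IsArc] using hσ (.inl w)
  · intro w f f' h h'; rw [h] at h'; exact Sum.inr_injective h'
  · intro w w' f h h'; exact Sum.inl_injective (σ.injective (h.trans h'.symm))
  · intro w f h; simpa [h, IsArc] using hσ (.inr f)
  · intro w f f' h h'; exact Sum.inr_injective (σ.injective (h.trans h'.symm))
  · intro w f f' h h'; rw [h] at h'; exact Sum.inl_injective h'

open Classical in
/-- A matching of maximum weight has an optimal dual solution (here with doubled values). -/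
theorem exists_dual (c : W → F → ℤ) (hM : IsMatchingOf E M)
    (hmax : ∀ M', IsMatchingOf E M' → ∑ e ∈ M', c e.1 e.2 ≤ ∑ e ∈ M, c e.1 e.2) :
    ∃ (β : W → ℤ) (γ : F → ℤ), (∀ w f, E w f → 2 * c w f ≤ β w + γ f) ∧
      (∀ w f, (w, f) ∈ M → β w + γ f = 2 * c w f) ∧ (∀ w, 0 ≤ β w) ∧ (∀ f, 0 ≤ γ f) ∧
      (∀ w, (∀ f, (w, f) ∉ M) → β w = 0) ∧ (∀ f, (∀ w, (w, f) ∉ M) → γ f = 0) := by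
  have hinv := partner_involutive hM
  have hsumM : ∑ u, arcWeight c u (partner M u) =
      ∑ e ∈ M, c e.1 e.2 + ∑ e ∈ M, c e.1 e.2 := by
    rw [sum_arcWeight]
    congr 2 <;> ext ⟨w, f⟩ <;> simp only [Finset.mem_filter, Finset.mem_univ, true_and]
    · refine ⟨fun h => ?_, partner_inl hM⟩
      by_cases hex : ∃ f, (w, f) ∈ M
      · obtain ⟨f', h'⟩ := hex
        rw [partner_inl hM h'] at h
        rwa [← Sum.inr_injective h]
      · simp [partner, hex] at h
    · refine ⟨fun h => ?_, partner_inr hM⟩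
      by_cases hex : ∃ w, (w, f) ∈ M
      · obtain ⟨f', h'⟩ := hex
        rw [partner_inr hM h'] at h
        rwa [← Sum.inl_injective h]
      · simp [partner, hex] at h
  obtain ⟨π, hπ⟩ := exists_potential
    (R := fun u v => IsArc E u (partner M v))
    (d := fun u v => arcWeight c u (partner M v) - arcWeight c v (partner M v))
    (isArc_partner hM) (fun u => sub_self _) (by
      intro τ hτ
      set σ : Equiv.Perm (W ⊕ F) := τ.trans hinv.toPerm with hσ
      have hσu : ∀ u, σ u = partner M (τ u) := fun u => rfl
      have h12 := isMatchingOf_perm (σ := σ) (E := E) hτ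
      rw [Finset.sum_sub_distrib,
        Equiv.sum_comp τ (fun v => arcWeight c v (partner M v)), hsumM]
      have := sum_arcWeight c σ
      simp only [hσu] at this h12
      rw [this]
      have a1 := hmax _ h12.1
      have a2 := hmax _ h12.2
      linarith)
  have hρ : ∀ u y, IsArc E u y →
      arcWeight c u y + (π (partner M y) - arcWeight c (partner M y) y) ≤ π u := by
    intro u y h
    have := hπ u (partner M y) (by rwa [hinv y])
    rw [hinv y] at this
    linarith
  set ρ : W ⊕ F → ℤ := fun y => π (partner M y) - arcWeight c (partner M y) y with hρdef
  -- Each agent has a row value `π` and a column value `-ρ`, and the two orientations of an edge are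
  -- added; this is where the factor 2 comes from. Loops give nonnegativity, and loops used by
  -- `partner M` give 0 at unmatched agents.
  refine ⟨fun w => π (.inl w) - ρ (.inl w), fun f => π (.inr f) - ρ (.inr f), ?_, ?_, ?_, ?_,
    ?_, ?_⟩
  · intro w f h
    have h1 := hρ (.inl w) (.inr f) h
    have h2 := hρ (.inr f) (.inl w) h
    simp only [arcWeight, hρdef] at h1 h2 ⊢
    linarith
  · intro w f h
    simp only [hρdef, partner_inl hM h, partner_inr hM h, arcWeight]
    ring
  · intro w
    have := hρ (.inl w) (.inl w) rfl
    simp only [arcWeight, hρdef] at this ⊢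
    linarith
  · intro f
    have := hρ (.inr f) (.inr f) rfl
    simp only [arcWeight, hρdef] at this ⊢
    linarith
  · intro w h
    simp [hρdef, partner, h, arcWeight]
  · intro f h
    simp [hρdef, partner, h, arcWeight]

end Dual

/-! ## Deferred acceptance with contracts -/

/-- A market in which every worker goes through a list of contracts: `Pr w q f` says that the
contract of `w` at position `q` is with firm `f`.  A firm prefers contracts with small keys. -/
structure Market (W F : Type*) where
  Pr : W → ℕ → F → Prop
  key : W → ℕ → F → ℕ
  K : ℕ
  uniq : ∀ {w q f f'}, Pr w q f → Pr w q f' → f = f'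
  lt_K : ∀ {w q f}, Pr w q f → q < K
  key_inj : ∀ {w w' q q' f}, Pr w q f → Pr w' q' f → key w q f = key w' q' f → w = w' ∧ q = q'

namespace Market

variable {W F : Type*} (G : Market W F)

/-- An assignment of positions is stable if every firm holds at most one contract, and every
contract passed over by a worker is worse for its firm than the one that the firm holds. -/
structure Stable (pos : W → ℕ) : Prop where
  le_K : ∀ w, pos w ≤ G.K
  full : ∀ w, pos w < G.K → ∃ f, G.Pr w (pos w) f
  inj : ∀ {w w' f}, G.Pr w (pos w) f → G.Pr w' (pos w') f → w = w'
  not_block : ∀ {w q f}, q < pos w → G.Pr w q f →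
    ∃ w', G.Pr w' (pos w') f ∧ G.key w' (pos w') f < G.key w q f

/-- Worker `w` has to move on: its position is empty, or the firm there holds a better contract. -/
def Rejected (pos : W → ℕ) (w : W) : Prop :=
  pos w < G.K ∧ ((∀ f, ¬ G.Pr w (pos w) f) ∨ ∃ f, G.Pr w (pos w) f ∧
    ∃ w', G.Pr w' (pos w') f ∧ G.key w' (pos w') f < G.key w (pos w) f)

open Classical in
/-- One round of deferred acceptance. -/
noncomputable def step (pos : W → ℕ) (w : W) : ℕ :=
  if G.Rejected pos w then pos w + 1 else pos w

/-- The positions after `t` rounds of deferred acceptance. -/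
noncomputable def run (t : ℕ) : W → ℕ := G.step^[t] fun _ => 0

theorem run_zero : G.run 0 = fun _ => 0 := rfl

theorem run_succ (t : ℕ) : G.run (t + 1) = G.step (G.run t) :=
  Function.iterate_succ_apply' _ _ _

theorem le_step (pos : W → ℕ) (w : W) : pos w ≤ G.step pos w := by
  unfold step; split_ifs <;> omega

theorem run_le_K (t : ℕ) (w : W) : G.run t w ≤ G.K := by
  induction t with
  | zero => simp [run_zero]
  | succ t ih =>
    rw [run_succ, step]
    split_ifs with h
    · exact h.1
    · exact ih

/-- The best contract of a firm survives a round. -/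
theorem exists_step_le [Finite W] {pos : W → ℕ} {w : W} {f : F} (h : G.Pr w (pos w) f) :
    ∃ w', G.Pr w' (G.step pos w') f ∧
      G.key w' (G.step pos w') f ≤ G.key w (pos w) f := by
  obtain ⟨w', hw', hmin⟩ := Set.exists_min_image {w' | G.Pr w' (pos w') f}
    (fun w' => G.key w' (pos w') f) (Set.toFinite _) ⟨w, h⟩
  have hs : G.step pos w' = pos w' := by
    unfold step
    rw [if_neg]
    rintro ⟨-, h1 | ⟨f', hf', w'', h2, h3⟩⟩
    · exact h1 f hw'
    · obtain rfl := G.uniq hw' hf'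
      exact absurd (hmin w'' h2) (not_le.2 h3)
  exact ⟨w', by rw [hs]; exact hw', by rw [hs]; exact hmin w h⟩

/-- A worker passes over a contract only when the firm holds a better one, and what a firm holds
best never gets worse. -/
theorem run_not_block [Finite W] (t : ℕ) {w : W} {q : ℕ} {f : F} (hq : q < G.run t w)
    (h : G.Pr w q f) :
    ∃ w', G.Pr w' (G.run t w') f ∧ G.key w' (G.run t w') f < G.key w q f := by
  induction t with
  | zero => simp [run_zero] at hq
  | succ t ih =>
    rw [run_succ] at hq ⊢
    have : ∃ w', G.Pr w' (G.run t w') f ∧ G.key w' (G.run t w') f < G.key w q f := by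
      by_cases hlt : q < G.run t w
      · exact ih hlt
      · unfold step at hq
        split_ifs at hq with hr
        · obtain rfl : q = G.run t w := by omega
          obtain ⟨-, h1 | ⟨f', hf', h1⟩⟩ := hr
          · exact absurd h (h1 f)
          · obtain rfl := G.uniq h hf'
            exact h1
        · omega
    obtain ⟨w', h1, h2⟩ := this
    obtain ⟨w'', h3, h4⟩ := G.exists_step_le h1
    exact ⟨w'', h3, h4.trans_lt h2⟩

/-- No worker moves beyond its position in a stable assignment. -/
theorem run_le_stable {S : W → ℕ} (hS : G.Stable S) (t : ℕ) (w : W) : G.run t w ≤ S w := by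
  induction t generalizing w with
  | zero => simp [run_zero]
  | succ t ih =>
    rw [run_succ]
    unfold step
    split_ifs with hr
    -- Suppose that `w` is rejected at `S w` in favour of `w'`. If `w'` is still before `S w'`, then
    -- stability of `S` requires the firm to hold in `S` something better than the contract of `w'`,
    -- but it holds that of `w`. If `w'` is at `S w'`, the firm has two contracts in `S`.
    · refine lt_of_le_of_ne (ih w) fun heq => ?_
      obtain ⟨hK, h1 | ⟨f, hf, w', hw', hlt⟩⟩ := hr
      · obtain ⟨f, hf⟩ := hS.full w (heq ▸ hK)
        exact h1 f (heq ▸ hf)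
      · have hSf : G.Pr w (S w) f := heq ▸ hf
        rcases (ih w').lt_or_eq with h2 | h2
        · obtain ⟨w'', h3, h4⟩ := hS.not_block h2 hw'
          obtain rfl := hS.inj h3 hSf
          rw [← heq] at h4
          omega
        · obtain rfl := hS.inj (h2 ▸ hw') hSf
          exact lt_irrefl _ hlt
    · exact ih w

variable [Fintype W]

/-- Each round before the fixed point increases the sum of the positions, which is at most `card W *
K`. -/
theorem step_run_eq {t : ℕ} (ht : Fintype.card W * G.K < t) : G.step (G.run t) = G.run t := by
  have key : ∀ t, G.step (G.run t) = G.run t ∨ t ≤ ∑ w, G.run t w := by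
    intro t
    induction t with
    | zero => right; exact Nat.zero_le _
    | succ t ih =>
      by_cases hfix : G.step (G.run t) = G.run t
      · left; rw [run_succ, hfix, hfix]
      · right
        have h1 := ih.resolve_left hfix
        have : ∑ w, G.run t w < ∑ w, G.run (t + 1) w := by
          rw [run_succ]
          obtain ⟨w, hw⟩ := Function.ne_iff.1 hfix
          exact Finset.sum_lt_sum (fun w _ => G.le_step _ w)
            ⟨w, Finset.mem_univ w, lt_of_le_of_ne (G.le_step _ w) (Ne.symm hw)⟩
        omega
  refine (key t).resolve_right fun h => ?_
  have : ∑ w, G.run t w ≤ ∑ _w : W, G.K := Finset.sum_le_sum fun w _ => G.run_le_K t w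
  simp only [Finset.sum_const, Finset.card_univ, smul_eq_mul] at this
  omega

/-- Deferred acceptance ends with a stable assignment. -/
theorem stable_run {t : ℕ} (ht : Fintype.card W * G.K < t) : G.Stable (G.run t) := by
  have hfix := G.step_run_eq ht
  have hr : ∀ w, ¬ G.Rejected (G.run t) w := by
    intro w h
    have := congrFun hfix w
    simp [step, h] at this
  refine ⟨G.run_le_K t, ?_, ?_, G.run_not_block t⟩
  · intro w hw
    by_contra hno
    push Not at hno
    exact hr w ⟨hw, Or.inl hno⟩
  · intro w w' f h h'
    rcases lt_trichotomy (G.key w (G.run t w) f) (G.key w' (G.run t w') f) with h1 | h1 | h1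
    · exact absurd ⟨G.lt_K h', Or.inr ⟨f, h', w, h, h1⟩⟩ (hr w')
    · exact (G.key_inj h h' h1).1
    · exact absurd ⟨G.lt_K h, Or.inr ⟨f, h, w', h', h1⟩⟩ (hr w)

theorem exists_stable : ∃ pos, G.Stable pos := ⟨_, G.stable_run (Nat.lt_succ_self _)⟩

open Classical in
/-- A firm with a contract in a stable assignment has a contract, no better for the firm, in a
stable assignment with smaller positions. -/
theorem Stable.exists_key_le [Fintype F] {G : Market W F} {T S : W → ℕ} (hT : G.Stable T)
    (hS : G.Stable S) (hle : ∀ w, T w ≤ S w) {w₀ : W} {f₀ : F} (h₀ : G.Pr w₀ (S w₀) f₀) :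
    ∃ w, G.Pr w (T w) f₀ ∧ G.key w₀ (S w₀) f₀ ≤ G.key w (T w) f₀ := by
  have : Nonempty W := ⟨w₀⟩
  have : Nonempty F := ⟨f₀⟩
  have h1 : ∀ {w f}, G.Pr w (T w) f →
      ∃ w', G.Pr w' (S w') f ∧ G.key w' (S w') f ≤ G.key w (T w) f := by
    intro w f h
    rcases (hle w).lt_or_eq with h2 | h2
    · obtain ⟨w', h3, h4⟩ := hS.not_block h2 h
      exact ⟨w', h3, h4.le⟩
    · exact ⟨w, h2 ▸ h, by rw [h2]⟩
  -- The counting argument of the rural hospitals theorem, with `A` the firms and `B` the workers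
  -- that have contracts: `A T ⊆ A S`, `|A S| ≤ |B S| ≤ |B T| ≤ |A T|`, so `A T = A S`.
  set A : (W → ℕ) → Finset F := fun p => Finset.univ.filter fun f => ∃ w, G.Pr w (p w) f
    with hA
  set B : (W → ℕ) → Finset W := fun p => Finset.univ.filter fun w => p w < G.K with hB
  have hsub : A T ⊆ A S := by
    intro f hf
    simp only [hA, Finset.mem_filter, Finset.mem_univ, true_and] at hf ⊢
    obtain ⟨w, hw⟩ := hf
    obtain ⟨w', h, -⟩ := h1 hw
    exact ⟨w', h⟩
  have hAB : (A S).card ≤ (B S).card := by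
    have : ∀ f ∈ A S, ∃ w, G.Pr w (S w) f := by simp [hA]
    choose! g hg using this
    refine Finset.card_le_card_of_injOn g (fun f hf => ?_) fun f hf f' hf' he => ?_
    · simpa [hB] using G.lt_K (hg f hf)
    · have := hg f hf
      rw [he] at this
      exact G.uniq this (hg f' hf')
  have hBB : (B S).card ≤ (B T).card := by
    refine Finset.card_le_card fun w hw => ?_
    simp only [hB, Finset.mem_filter, Finset.mem_univ, true_and] at hw ⊢
    exact (hle w).trans_lt hw
  have hBA : (B T).card ≤ (A T).card := by
    have : ∀ w ∈ B T, ∃ f, G.Pr w (T w) f := by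
      intro w hw
      exact hT.full w (by simpa [hB] using hw)
    choose! g hg using this
    refine Finset.card_le_card_of_injOn g (fun w hw => ?_) fun w hw w' hw' he => ?_
    · simpa [hA] using ⟨w, hg w hw⟩
    · have := hg w hw
      rw [he] at this
      exact hT.inj this (hg w' hw')
  have heq : A T = A S := Finset.eq_of_subset_of_card_le hsub (by omega)
  have : f₀ ∈ A T := by
    rw [heq]
    simpa [hA] using ⟨w₀, h₀⟩
  simp only [hA, Finset.mem_filter, Finset.mem_univ, true_and] at this
  obtain ⟨w, hw⟩ := this
  obtain ⟨w', h2, h3⟩ := h1 hw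
  obtain rfl := hS.inj h2 h₀
  exact ⟨w, hw, h3⟩

end Market

/-! ## Preferences given by ranks, and stability with levels -/

/-- A bipartite graph with preferences: agents rank their neighbours injectively, and small ranks
are preferred. -/
structure Pref (W F : Type*) where
  E : W → F → Prop
  rw : W → F → ℕ
  rf : F → W → ℕ
  rw_inj : ∀ {w f f'}, E w f → E w f' → rw w f = rw w f' → f = f'
  rf_inj : ∀ {w w' f}, E w f → E w' f → rf f w = rf f w' → w = w'

namespace Pref

variable {W F : Type*} (R : Pref W F)

/-- Worker `w` is unmatched in `M` or prefers `f` to its partner in `M`. -/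
def WB (M : Finset (W × F)) (w : W) (f : F) : Prop := ∀ f', (w, f') ∈ M → R.rw w f < R.rw w f'

/-- Firm `f` is unmatched in `M` or prefers `w` to its partner in `M`. -/
def FB (M : Finset (W × F)) (w : W) (f : F) : Prop := ∀ w', (w', f) ∈ M → R.rf f w < R.rf f w'

/-- Stability of a matching `M` of workers at levels `l w < L`, who offer the contracts
`(w, f, j)` with `Al w f j`, those of low levels first.  Firms prefer high levels. -/
structure RStable (L : ℕ) (Al : W → F → ℕ → Prop) (M : Finset (W × F)) (l : W → ℕ) : Prop where
  matching : IsMatchingOf R.E M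
  lt_L : ∀ w, l w < L
  unmatched : ∀ w, (∀ f, (w, f) ∉ M) → l w + 1 = L
  allowed : ∀ {w f}, (w, f) ∈ M → Al w f (l w)
  not_block : ∀ {w f j}, R.E w f → j < L → Al w f j → (j < l w ∨ j = l w ∧ R.WB M w f) →
    ∃ w', (w', f) ∈ M ∧ (j < l w' ∨ j = l w' ∧ R.rf f w' < R.rf f w)

/-- Stability with all contracts. -/
def LStable (L : ℕ) (M : Finset (W × F)) (l : W → ℕ) : Prop := R.RStable L (fun _ _ _ => True) M l

/-- The contracts of firm `b` that are at least as good for `b` as that with `a` at level `j₀`,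
and all contracts of other firms. -/
def trunc (a : W) (b : F) (j₀ : ℕ) (w : W) (f : F) (j : ℕ) : Prop :=
  f = b → j₀ < j ∨ j = j₀ ∧ R.rf b w ≤ R.rf b a

variable {R}

/-- The deleted contracts cannot block, since `b` holds one that is better than all of them. -/
theorem RStable.of_trunc {L : ℕ} {a : W} {b : F} {M : Finset (W × F)} {l : W → ℕ}
    (h : R.RStable L (R.trunc a b (l a)) M l) (hab : (a, b) ∈ M) : R.LStable L M l := by
  refine ⟨h.matching, h.lt_L, h.unmatched, fun _ => trivial, fun {w f j} hE hj _ hb => ?_⟩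
  by_cases hA : R.trunc a b (l a) w f j
  · exact h.not_block hE hj hA hb
  · simp only [trunc, Classical.not_imp, not_or, not_lt, not_and, not_le] at hA
    obtain ⟨rfl, h1, h2⟩ := hA
    refine ⟨a, hab, ?_⟩
    rcases h1.lt_or_eq with h3 | h3
    · exact Or.inl h3
    · exact Or.inr ⟨h3, h2 h3⟩

/-- Deletion removes only possible blocking contracts as long as the one that `b` holds survives. -/
theorem LStable.trunc {L : ℕ} {a : W} {b : F} {M : Finset (W × F)} {l : W → ℕ}
    (h : R.LStable L M l) (hab : (a, b) ∈ M) : R.RStable L (R.trunc a b (l a)) M l := by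
  refine ⟨h.matching, h.lt_L, h.unmatched, ?_, fun hE hj _ hb => h.not_block hE hj trivial hb⟩
  rintro w f hwf rfl
  obtain rfl := h.matching.worker_unique hwf hab
  exact Or.inr ⟨rfl, le_rfl⟩

/-- The ranks of neighbours are smaller than `D`. -/
def Bounded (R : Pref W F) (D : ℕ) : Prop := ∀ w f, R.E w f → R.rw w f < D ∧ R.rf f w < D

theorem exists_bounded [Fintype W] [Fintype F] (R : Pref W F) : ∃ D, R.Bounded D := by
  refine ⟨∑ w, ∑ f, (R.rw w f + R.rf f w) + 1, fun w f _ => ?_⟩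
  have h1 : ∑ f, (R.rw w f + R.rf f w) ≤ ∑ w, ∑ f, (R.rw w f + R.rf f w) :=
    Finset.single_le_sum (f := fun w => ∑ f, (R.rw w f + R.rf f w)) (fun _ _ => Nat.zero_le _)
      (Finset.mem_univ w)
  have h2 : R.rw w f + R.rf f w ≤ ∑ f, (R.rw w f + R.rf f w) :=
    Finset.single_le_sum (f := fun f => R.rw w f + R.rf f w) (fun _ _ => Nat.zero_le _)
      (Finset.mem_univ f)
  omega

/-- The key of a contract at position `q` with a worker of rank `r`. -/
def levelKey (D q r : ℕ) : ℕ := (if q < D then D else 0) + r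

/-- Positions below `D` belong to level 0 and are penalized by `D`, which exceeds every rank; so
level decides first, in favour of level 1. -/
theorem levelKey_lt {D j r s j' r' s' : ℕ} (hj : j < 2) (hj' : j' < 2) (hr : r < D) (hr' : r' < D)
    (hs : s < D) (hs' : s' < D) :
    levelKey D (j * D + r) s < levelKey D (j' * D + r') s' ↔ j' < j ∨ j' = j ∧ s < s' := by
  unfold levelKey
  interval_cases j <;> interval_cases j' <;> simp [*] <;> omega

/-- The market in which contract `(w, f, j)` is at position `j * D + R.rw w f` of worker `w`. -/
def market (R : Pref W F) {L D : ℕ} (hL : L ≤ 2) (hD : R.Bounded D) (Al : W → F → ℕ → Prop) :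
    Market W F where
  Pr w q f := R.E w f ∧ ∃ j < L, q = j * D + R.rw w f ∧ Al w f j
  key w q f := levelKey D q (R.rf f w)
  K := L * D
  uniq := by
    rintro w q f f' ⟨hE, j, hj, hq, -⟩ ⟨hE', j', hj', hq', -⟩
    have h1 := (hD w f hE).1
    have h2 := (hD w f' hE').1
    have hj2 : j < 2 := by omega
    have hj2' : j' < 2 := by omega
    refine R.rw_inj hE hE' ?_
    interval_cases j <;> interval_cases j' <;> omega
  lt_K := by
    rintro w q f ⟨hE, j, hj, hq, -⟩
    have h1 := (hD w f hE).1
    nlinarith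
  key_inj := by
    rintro w w' q q' f ⟨hE, j, hj, rfl, -⟩ ⟨hE', j', hj', rfl, -⟩ h
    have h1 := hD w f hE
    have h2 := hD w' f hE'
    have e1 := levelKey_lt (by omega : j < 2) (by omega : j' < 2) h1.1 h2.1 h1.2 h2.2
    have e2 := levelKey_lt (by omega : j' < 2) (by omega : j < 2) h2.1 h1.1 h2.2 h1.2
    have h3 : ¬ (j' < j ∨ j' = j ∧ R.rf f w < R.rf f w') := fun h' => absurd (e1.2 h') (by omega)
    have h4 : ¬ (j < j' ∨ j = j' ∧ R.rf f w' < R.rf f w) := fun h' => absurd (e2.2 h') (by omega)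
    have h5 : j = j' := by omega
    obtain rfl := R.rf_inj hE hE' (by omega)
    exact ⟨rfl, by rw [h5]⟩

/-! ### Stability with levels as stability in the contract market -/

section Translate

variable {L D : ℕ} {hL : L ≤ 2} {hD : R.Bounded D} {Al : W → F → ℕ → Prop}

/-- The level of a worker at position `p`. -/
def posLevel (L D p : ℕ) : ℕ := if p < L * D ∧ p < D then 0 else L - 1

theorem market_Pr {w : W} {q : ℕ} {f : F} :
    (R.market hL hD Al).Pr w q f ↔ R.E w f ∧ ∃ j < L, q = j * D + R.rw w f ∧ Al w f j := Iff.rfl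

theorem posLevel_eq (hL : L ≤ 2) {j r : ℕ} (hj : j < L) (hr : r < D) :
    posLevel L D (j * D + r) = j := by
  have : L = 1 ∨ L = 2 := by omega
  unfold posLevel
  rcases this with rfl | rfl
  · obtain rfl : j = 0 := by omega
    simp
  · interval_cases j
    · simp [hr]; omega
    · simp

theorem add_lt_mul {j r L D : ℕ} (hj : j < L) (hr : r < D) : j * D + r < L * D := by
  nlinarith

theorem add_lt_add_iff_lex {j j' r r' D : ℕ} (hr : r < D) (hr' : r' < D) :
    j * D + r < j' * D + r' ↔ j < j' ∨ j = j' ∧ r < r' := by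
  rcases lt_trichotomy j j' with h | rfl | h
  · have := add_lt_mul h hr
    simp only [h, true_or, iff_true]; omega
  · simp
  · have := add_lt_mul h hr'
    constructor <;> omega

variable [Fintype W] [Fintype F]

open Classical in
/-- The matching given by the positions of the workers. -/
noncomputable def posMatching (R : Pref W F) (L D : ℕ) (p : W → ℕ) : Finset (W × F) :=
  Finset.univ.filter fun e : W × F =>
    R.E e.1 e.2 ∧ p e.1 < L * D ∧ (p e.1 = R.rw e.1 e.2 ∨ p e.1 = D + R.rw e.1 e.2)

theorem mem_posMatching {p : W → ℕ} (hp : (R.market hL hD Al).Stable p) {w : W} {f : F} :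
    (w, f) ∈ R.posMatching L D p ↔ (R.market hL hD Al).Pr w (p w) f := by
  simp only [posMatching, Finset.mem_filter, Finset.mem_univ, true_and]
  constructor
  · rintro ⟨hE, hlt, h⟩
    have hr := (hD w f hE).1
    obtain ⟨f', hf'⟩ := hp.full w hlt
    have : f = f' := by
      obtain ⟨hE', j, hj, hq, -⟩ := hf'
      have hr' := (hD w f' hE').1
      refine R.rw_inj hE hE' ?_
      have hj2 : j < 2 := by omega
      rw [hq] at h
      interval_cases j <;> omega
    exact this ▸ hf'
  · rintro ⟨hE, j, hj, hq, -⟩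
    have hj2 : j < 2 := by omega
    refine ⟨hE, hq ▸ add_lt_mul hj (hD w f hE).1, ?_⟩
    interval_cases j
    · left; simpa using hq
    · right; simpa using hq

/-- Positions order the contracts of a worker lexicographically by level and rank. An unmatched
worker sits at `L * D` and therefore counts as being at the last level. -/
theorem rstable_of_stable (hL1 : 1 ≤ L) {p : W → ℕ} (hp : (R.market hL hD Al).Stable p) :
    R.RStable L Al (R.posMatching L D p) fun w => posLevel L D (p w) := by
  have hlev : ∀ {w f}, (w, f) ∈ R.posMatching L D p → R.E w f ∧
      p w = posLevel L D (p w) * D + R.rw w f ∧ posLevel L D (p w) < L ∧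
      Al w f (posLevel L D (p w)) := by
    intro w f h
    obtain ⟨hE, j, hj, hq, hA⟩ := (mem_posMatching hp).1 h
    have := posLevel_eq hL hj (hD w f hE).1
    rw [hq, this]
    exact ⟨hE, rfl, hj, hA⟩
  have hun : ∀ w, (∀ f, (w, f) ∉ R.posMatching L D p) → p w = L * D := by
    intro w h
    by_contra hne
    obtain ⟨f, hf⟩ := hp.full w (lt_of_le_of_ne (hp.le_K w) hne)
    exact h f ((mem_posMatching hp).2 hf)
  refine ⟨IsMatchingOf.of_unique (fun w f h => (hlev h).1) ?_ ?_, ?_, ?_, ?_, ?_⟩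
  · intro w f f' h h'
    exact (R.market hL hD Al).uniq ((mem_posMatching hp).1 h) ((mem_posMatching hp).1 h')
  · intro w w' f h h'
    exact hp.inj ((mem_posMatching hp).1 h) ((mem_posMatching hp).1 h')
  · intro w
    simp only [posLevel]; split_ifs <;> omega
  · intro w h
    simp [posLevel, hun w h]; omega
  · intro w f h
    exact (hlev h).2.2.2
  · intro w f j hE hj hA hb
    have hr := hD w f hE
    have hlt : j * D + R.rw w f < p w := by
      by_cases hm : ∃ f', (w, f') ∈ R.posMatching L D p
      · obtain ⟨f', hf'⟩ := hm
        obtain ⟨hE', hq, -, -⟩ := hlev hf'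
        rw [hq, add_lt_add_iff_lex hr.1 (hD w f' hE').1]
        rcases hb with hb | ⟨hb, hb'⟩
        · exact Or.inl hb
        · exact Or.inr ⟨hb, hb' f' hf'⟩
      · push Not at hm
        rw [hun w hm]
        exact add_lt_mul hj hr.1
    obtain ⟨w', h1, h2⟩ := hp.not_block hlt ⟨hE, j, hj, rfl, hA⟩
    have hm := (mem_posMatching hp).2 h1
    refine ⟨w', hm, ?_⟩
    obtain ⟨hE', hq, hl, -⟩ := hlev hm
    have h3 : levelKey D (p w') (R.rf f w') < levelKey D (j * D + R.rw w f) (R.rf f w) := h2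
    rw [hq] at h3
    have hr' := hD w' f hE'
    exact (levelKey_lt (by omega) (by omega) hr'.1 hr.1 hr'.2 hr.2).1 h3

open Classical in
/-- The positions of the workers in a matching with levels. -/
noncomputable def matchingPos (R : Pref W F) (L D : ℕ) (M : Finset (W × F)) (l : W → ℕ) (w : W) :
    ℕ :=
  if h : ∃ f, (w, f) ∈ M then l w * D + R.rw w h.choose else L * D

theorem matchingPos_of_mem {M : Finset (W × F)} {l : W → ℕ} (hM : IsMatchingOf R.E M) {w : W}
    {f : F} (h : (w, f) ∈ M) : R.matchingPos L D M l w = l w * D + R.rw w f := by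
  have hex : ∃ f, (w, f) ∈ M := ⟨f, h⟩
  simp only [matchingPos, hex, dite_true]
  rw [hM.firm_unique hex.choose_spec h]

theorem stable_of_rstable {M : Finset (W × F)} {l : W → ℕ} (h : R.RStable L Al M l) :
    (R.market hL hD Al).Stable (R.matchingPos L D M l) := by
  have hL2 := hL
  have hmem : ∀ {w f}, (w, f) ∈ M → (R.market hL hD Al).Pr w (R.matchingPos L D M l w) f :=
    fun {w f} hm => ⟨h.matching.edge hm, l w, h.lt_L w, matchingPos_of_mem h.matching hm,
      h.allowed hm⟩
  have hun : ∀ {w}, (∀ f, (w, f) ∉ M) → R.matchingPos L D M l w = L * D := by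
    intro w hw
    simp [matchingPos, hw]
  have hmem' : ∀ {w f}, (R.market hL hD Al).Pr w (R.matchingPos L D M l w) f → (w, f) ∈ M := by
    intro w f hP
    by_cases hm : ∃ f', (w, f') ∈ M
    · obtain ⟨f', hf'⟩ := hm
      rwa [(R.market hL hD Al).uniq hP (hmem hf')]
    · push Not at hm
      have := (R.market hL hD Al).lt_K hP
      rw [hun hm] at this
      exact absurd this (lt_irrefl _)
  refine ⟨fun w => ?_, fun w hw => ?_, fun h1 h2 => ?_, fun {w q f} hq hP => ?_⟩
  · by_cases hm : ∃ f', (w, f') ∈ M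
    · obtain ⟨f', hf'⟩ := hm
      exact ((R.market hL hD Al).lt_K (hmem hf')).le
    · push Not at hm
      exact (hun hm).le
  · by_contra hno
    have hm : ∀ f, (w, f) ∉ M := fun f hf => hno ⟨f, hmem hf⟩
    rw [hun hm] at hw
    exact lt_irrefl _ hw
  · exact h.matching.worker_unique (hmem' h1) (hmem' h2)
  · obtain ⟨hE, j, hj, rfl, hA⟩ := hP
    have hr := hD w f hE
    have hb : j < l w ∨ j = l w ∧ R.WB M w f := by
      by_cases hm : ∃ f', (w, f') ∈ M
      · obtain ⟨f', hf'⟩ := hm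
        rw [matchingPos_of_mem h.matching hf',
          add_lt_add_iff_lex hr.1 (hD w f' (h.matching.edge hf')).1] at hq
        rcases hq with hq | ⟨hq, hq'⟩
        · exact Or.inl hq
        · refine Or.inr ⟨hq, fun f'' hf'' => ?_⟩
          rwa [h.matching.firm_unique hf'' hf']
      · push Not at hm
        have h1 := h.unmatched w hm
        by_cases h2 : j < l w
        · exact Or.inl h2
        · exact Or.inr ⟨by omega, fun f' hf' => absurd hf' (hm f')⟩
    obtain ⟨w', hw', hc⟩ := h.not_block hE hj hA hb
    refine ⟨w', hmem hw', ?_⟩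
    have hr' := hD w' f (h.matching.edge hw')
    change levelKey D _ _ < levelKey D _ _
    rw [matchingPos_of_mem h.matching hw',
      levelKey_lt (by have := h.lt_L w'; omega) (by omega) hr'.1 hr.1 hr'.2 hr.2]
    exact hc

theorem exists_rstable (R : Pref W F) (hL1 : 1 ≤ L) (hL : L ≤ 2) (Al : W → F → ℕ → Prop) :
    ∃ M l, R.RStable L Al M l := by
  obtain ⟨D, hD⟩ := R.exists_bounded
  obtain ⟨p, hp⟩ := (R.market hL hD Al).exists_stable
  exact ⟨_, _, rstable_of_stable hL1 hp⟩

/-- Deferred acceptance with the contracts of `b` truncated finds the contract with `a` at level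
`j₀` if it occurs in a stable matching. -/
theorem run_trunc_eq {a : W} {b : F} {j₀ t : ℕ}
    (ht : Fintype.card W * (L * D) < t) {M : Finset (W × F)} {l : W → ℕ} (h : R.LStable L M l)
    (hab : (a, b) ∈ M) (hl : l a = j₀) :
    (R.market hL hD (R.trunc a b j₀)).run t a = j₀ * D + R.rw a b := by
  subst hl
  have hS := stable_of_rstable (hL := hL) (hD := hD) (h.trunc hab)
  have hT := (R.market hL hD (R.trunc a b (l a))).stable_run ht
  have hpos := matchingPos_of_mem (L := L) (D := D) (l := l) h.matching hab
  have hP : (R.market hL hD (R.trunc a b (l a))).Pr a (R.matchingPos L D M l a) b :=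
    ⟨h.matching.edge hab, l a, h.lt_L a, hpos, fun _ => Or.inr ⟨rfl, le_rfl⟩⟩
  obtain ⟨w, hw, hk⟩ := hT.exists_key_le hS
    ((R.market hL hD _).run_le_stable hS t) hP
  have hE := h.matching.edge hab
  have hr := hD a b hE
  obtain ⟨hE', j, hj, hq, hA⟩ := id hw
  have hr' := hD w b hE'
  -- The contract of `b` in the run is no better for `b` than the target, as the run has the
  -- smallest positions among stable assignments; by truncation it is no worse either.
  have hk' : ¬ levelKey D _ _ < levelKey D _ _ := not_lt.2 hk
  have hla := h.lt_L a
  rw [hpos, hq, levelKey_lt (by omega) (by omega) hr'.1 hr.1 hr'.2 hr.2] at hk'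
  have hA := hA rfl
  have hj2 : j = l a := by omega
  have hrr : R.rf b w = R.rf b a := by omega
  obtain rfl := R.rf_inj hE' hE hrr
  rw [hq, hj2]

/-- If deferred acceptance with truncation finds the target contract, then its result is stable
with respect to all contracts. -/
theorem lstable_of_run_trunc {a : W} {b : F} {j₀ t : ℕ}
    (ht : Fintype.card W * (L * D) < t) (hE : R.E a b) (hj : j₀ < L)
    (h : (R.market hL hD (R.trunc a b j₀)).run t a = j₀ * D + R.rw a b) :
    (a, b) ∈ R.posMatching L D ((R.market hL hD (R.trunc a b j₀)).run t) ∧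
      R.LStable L (R.posMatching L D ((R.market hL hD (R.trunc a b j₀)).run t))
        fun w => posLevel L D ((R.market hL hD (R.trunc a b j₀)).run t w) := by
  have hT := (R.market hL hD (R.trunc a b j₀)).stable_run ht
  have hab : (a, b) ∈ R.posMatching L D ((R.market hL hD (R.trunc a b j₀)).run t) :=
    (mem_posMatching hT).2 ⟨hE, j₀, hj, h, fun _ => Or.inr ⟨rfl, le_rfl⟩⟩
  refine ⟨hab, ?_⟩
  have hR := rstable_of_stable (by omega) hT
  have hlev : posLevel L D ((R.market hL hD (R.trunc a b j₀)).run t a) = j₀ := by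
    rw [h, posLevel_eq hL hj (hD a b hE).1]
  refine RStable.of_trunc (a := a) (b := b) ?_ hab
  simpa only [hlev] using hR

end Translate

end Pref

/-! ## Popular and dominant matchings in terms of gains -/

section Gain

variable {X : Type*}

open Classical in
/-- Whether an agent with the set `S` of partners is matched. -/
noncomputable def matchedInd (S : X → Prop) : ℤ := if ∃ y, S y then 1 else 0

open Classical in
/-- The vote of an agent with the set `S` of partners for the partner `x`, plus `1` if the agent
is matched. -/
noncomputable def rankGain (r : X → ℕ) (S : X → Prop) (x : X) : ℤ :=
  if S x then 1 else if ∃ y, S y then (if ∃ y, S y ∧ r x < r y then 2 else 0) else 1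

/-- The cases are: same partner, unmatched, improvement, loss. The gain minus the indicator is 0, 1,
1, -1 respectively, which is the vote of the agent for `x` against `S`. -/
theorem rankGain_cases {r : X → ℕ} {S : X → Prop} (hS : ∀ x y, S x → S y → x = y) {x : X}
    (hr : ∀ y, S y → r x = r y → x = y) :
    (S x ∧ matchedInd S = 1 ∧ rankGain r S x = 1) ∨
    (¬ S x ∧ (∀ y, ¬ S y) ∧ matchedInd S = 0 ∧ rankGain r S x = 1) ∨
    (¬ S x ∧ (∀ y, S y → r x < r y) ∧ matchedInd S = 1 ∧ rankGain r S x = 2) ∨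
    (¬ S x ∧ (∃ y, S y ∧ r y < r x) ∧ matchedInd S = 1 ∧ rankGain r S x = 0) := by
  by_cases hx : S x
  · exact Or.inl ⟨hx, by simp [matchedInd, show ∃ y, S y from ⟨x, hx⟩], by simp [rankGain, hx]⟩
  · right
    by_cases h : ∃ y, S y
    · right
      obtain ⟨y, hy⟩ := id h
      have hiff : (∃ y, S y ∧ r x < r y) ↔ r x < r y :=
        ⟨fun ⟨z, hz, hlt⟩ => hS z y hz hy ▸ hlt, fun hlt => ⟨y, hy, hlt⟩⟩
      rcases lt_trichotomy (r x) (r y) with hlt | heq | hlt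
      · left
        exact ⟨hx, fun z hz => hS y z hy hz ▸ hlt, by simp [matchedInd, h],
          by simp [rankGain, hx, h, hiff, hlt]⟩
      · exact absurd (hr y hy heq ▸ hy) hx
      · right
        exact ⟨hx, ⟨y, hy, hlt⟩, by simp [matchedInd, h],
          by simp [rankGain, hx, h, hiff, not_lt.2 hlt.le]⟩
    · left
      exact ⟨hx, not_exists.1 h, by simp [matchedInd, h], by simp [rankGain, hx, h]⟩

end Gain

/-! ### Dual witnesses of popularity and stable matchings through edges of popular matchings -/

namespace Pref

variable {W F : Type*} (R : Pref W F)

/-- The gain of worker `w` when matched to `f` instead of its partner in `M`. -/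
noncomputable def gainW (M : Finset (W × F)) (w : W) (f : F) : ℤ :=
  rankGain (R.rw w) (fun f' => (w, f') ∈ M) f

/-- The gain of firm `f` when matched to `w` instead of its partner in `M`. -/
noncomputable def gainF (M : Finset (W × F)) (w : W) (f : F) : ℤ :=
  rankGain (R.rf f) (fun w' => (w', f) ∈ M) w

/-- The total gain of the two ends of an edge. -/
noncomputable def gain (M : Finset (W × F)) (w : W) (f : F) : ℤ := R.gainW M w f + R.gainF M w f

/-- Popularity in terms of gains. -/
def IsPop (M : Finset (W × F)) : Prop :=
  IsMatchingOf R.E M ∧ ∀ M', IsMatchingOf R.E M' → ∑ e ∈ M', R.gain M e.1 e.2 ≤ 2 * M.card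

/-- Dominance in terms of gains. -/
def IsDom (M : Finset (W × F)) : Prop :=
  R.IsPop M ∧ ∀ M', IsMatchingOf R.E M' → M.card < M'.card →
    ∑ e ∈ M', R.gain M e.1 e.2 < 2 * M.card

variable {R} {M : Finset (W × F)}

/-- The indicator of the matched workers. -/
noncomputable def indW (M : Finset (W × F)) (w : W) : ℤ := matchedInd fun f => (w, f) ∈ M

/-- The indicator of the matched firms. -/
noncomputable def indF (M : Finset (W × F)) (f : F) : ℤ := matchedInd fun w => (w, f) ∈ M

theorem indW_of_mem {w : W} {f : F} (h : (w, f) ∈ M) : indW M w = 1 := by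
  simp [indW, matchedInd, show ∃ f, (w, f) ∈ M from ⟨f, h⟩]

theorem indF_of_mem {w : W} {f : F} (h : (w, f) ∈ M) : indF M f = 1 := by
  simp [indF, matchedInd, show ∃ w, (w, f) ∈ M from ⟨w, h⟩]

theorem indW_of_not {w : W} (h : ∀ f, (w, f) ∉ M) : indW M w = 0 := by
  simp [indW, matchedInd, h]

theorem indF_of_not {f : F} (h : ∀ w, (w, f) ∉ M) : indF M f = 0 := by
  simp [indF, matchedInd, h]

theorem gainW_cases (hM : IsMatchingOf R.E M) {w : W} {f : F} (hE : R.E w f) :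
    ((w, f) ∈ M ∧ indW M w = 1 ∧ R.gainW M w f = 1) ∨
    ((w, f) ∉ M ∧ (∀ f', (w, f') ∉ M) ∧ indW M w = 0 ∧ R.gainW M w f = 1) ∨
    ((w, f) ∉ M ∧ R.WB M w f ∧ indW M w = 1 ∧ R.gainW M w f = 2) ∨
    ((w, f) ∉ M ∧ (∃ f', (w, f') ∈ M ∧ R.rw w f' < R.rw w f) ∧ indW M w = 1 ∧
      R.gainW M w f = 0) :=
  rankGain_cases (fun _ _ h h' => hM.firm_unique h h') fun _ h h' => R.rw_inj hE (hM.edge h) h'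

theorem gainF_cases (hM : IsMatchingOf R.E M) {w : W} {f : F} (hE : R.E w f) :
    ((w, f) ∈ M ∧ indF M f = 1 ∧ R.gainF M w f = 1) ∨
    ((w, f) ∉ M ∧ (∀ w', (w', f) ∉ M) ∧ indF M f = 0 ∧ R.gainF M w f = 1) ∨
    ((w, f) ∉ M ∧ R.FB M w f ∧ indF M f = 1 ∧ R.gainF M w f = 2) ∨
    ((w, f) ∉ M ∧ (∃ w', (w', f) ∈ M ∧ R.rf f w' < R.rf f w) ∧ indF M f = 1 ∧
      R.gainF M w f = 0) :=
  rankGain_cases (fun _ _ h h' => hM.worker_unique h h') fun _ h h' => R.rf_inj hE (hM.edge h) h'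

theorem gain_of_mem {w : W} {f : F} (h : (w, f) ∈ M) : R.gain M w f = 2 := by
  simp [gain, gainW, gainF, rankGain, h]

theorem sum_gain_self : ∑ e ∈ M, R.gain M e.1 e.2 = 2 * M.card := by
  rw [Finset.sum_congr rfl fun e he => gain_of_mem (R := R) (w := e.1) (f := e.2) he]
  simp [mul_comm]

theorem exists_of_not_WB (hM : IsMatchingOf R.E M) {w : W} {f : F} (hE : R.E w f)
    (hn : (w, f) ∉ M) (h : ¬ R.WB M w f) : ∃ f', (w, f') ∈ M ∧ R.rw w f' < R.rw w f := by
  simp only [WB, not_forall, not_lt] at h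
  obtain ⟨f', h1, h2⟩ := h
  refine ⟨f', h1, lt_of_le_of_ne h2 fun he => hn ?_⟩
  rwa [R.rw_inj hE (hM.edge h1) he.symm]

theorem exists_of_not_FB (hM : IsMatchingOf R.E M) {w : W} {f : F} (hE : R.E w f)
    (hn : (w, f) ∉ M) (h : ¬ R.FB M w f) : ∃ w', (w', f) ∈ M ∧ R.rf f w' < R.rf f w := by
  simp only [FB, not_forall, not_lt] at h
  obtain ⟨w', h1, h2⟩ := h
  refine ⟨w', h1, lt_of_le_of_ne h2 fun he => hn ?_⟩
  rwa [R.rf_inj hE (hM.edge h1) he.symm]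

theorem WB_of_le (hM : IsMatchingOf R.E M) {w : W} {f : F} (hE : R.E w f) (hn : (w, f) ∉ M)
    (h : ∀ f', (w, f') ∈ M → R.rw w f ≤ R.rw w f') : R.WB M w f :=
  fun f' h1 => lt_of_le_of_ne (h f' h1) fun he => hn (by rwa [R.rw_inj hE (hM.edge h1) he])

theorem FB_of_le (hM : IsMatchingOf R.E M) {w : W} {f : F} (hE : R.E w f) (hn : (w, f) ∉ M)
    (h : ∀ w', (w', f) ∈ M → R.rf f w ≤ R.rf f w') : R.FB M w f :=
  fun w' h1 => lt_of_le_of_ne (h w' h1) fun he => hn (by rwa [R.rf_inj hE (hM.edge h1) he])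

/-- A dual certificate of popularity. -/
structure Witness (R : Pref W F) (M : Finset (W × F)) (γ : W → ℤ) (δ : F → ℤ) : Prop where
  matched : ∀ {w f}, (w, f) ∈ M → γ w + δ f = 0
  worker_unmatched : ∀ {w}, (∀ f, (w, f) ∉ M) → γ w = 0
  firm_unmatched : ∀ {f}, (∀ w, (w, f) ∉ M) → δ f = 0
  pos : ∀ {w f}, R.E w f → R.WB M w f → R.FB M w f → 0 < γ w ∧ 0 < δ f
  neg : ∀ {w f}, R.E w f → γ w + δ f < 0 →
    (∃ f', (w, f') ∈ M ∧ R.rw w f' < R.rw w f) ∧ ∃ w', (w', f) ∈ M ∧ R.rf f w' < R.rf f w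

variable [Fintype W] [Fintype F]

/-- Subtracting `2 * ind` from the doubled dual values makes their sum over an edge an upper bound
for twice the sum of the votes of its ends for this edge against `M`; on edges of `M` both are 0. -/
theorem IsPop.exists_witness (h : R.IsPop M) : ∃ γ δ, Witness R M γ δ := by
  obtain ⟨hM, hmax⟩ := h
  obtain ⟨β, β', h1, h2, h3, h4, h5, h6⟩ := exists_dual (R.gain M) hM fun M' hM' => by
    rw [sum_gain_self]; exact hmax M' hM'
  have hw0 : ∀ {w}, (∀ f, (w, f) ∉ M) → β w - 2 * indW M w = 0 := fun {w} hw => by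
    rw [h5 w hw, indW_of_not hw]; ring
  have hf0 : ∀ {f}, (∀ w, (w, f) ∉ M) → β' f - 2 * indF M f = 0 := fun {f} hf => by
    rw [h6 f hf, indF_of_not hf]; ring
  have hm : ∀ {w f}, (w, f) ∈ M → β w - 2 * indW M w + (β' f - 2 * indF M f) = 0 := by
    intro w f hwf
    have := h2 w f hwf
    rw [gain_of_mem hwf] at this
    rw [indW_of_mem hwf, indF_of_mem hwf]
    linarith
  -- The values of partners are opposite, and that of a matched agent is at least -2 because `β` and
  -- `β'` are nonnegative.
  have hwle : ∀ w, β w - 2 * indW M w ≤ 2 := by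
    intro w
    by_cases hw : ∃ f, (w, f) ∈ M
    · obtain ⟨f, hf⟩ := hw
      have := hm hf
      have := h4 f
      have := indF_of_mem hf
      linarith
    · push Not at hw
      rw [hw0 hw]; norm_num
  have hfle : ∀ f, β' f - 2 * indF M f ≤ 2 := by
    intro f
    by_cases hf : ∃ w, (w, f) ∈ M
    · obtain ⟨w, hw⟩ := hf
      have := hm hw
      have := h3 w
      have := indW_of_mem hw
      linarith
    · push Not at hf
      rw [hf0 hf]; norm_num
  -- If both ends vote for the edge, the sum of the values is at least 4, so each of them, being at
  -- most 2, is positive. If the sum is negative, the votes sum to a negative number, which for an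
  -- edge only happens when both ends lose.
  refine ⟨fun w => β w - 2 * indW M w, fun f => β' f - 2 * indF M f, hm, hw0, hf0, ?_, ?_⟩
  · intro w f hE hWB hFB
    have := h1 w f hE
    have hw := hwle w
    have hf := hfle f
    unfold gain at this
    have c1 : R.gainW M w f = 1 + indW M w := by
      rcases gainW_cases hM hE with c | c | c | c
      · exact absurd (hWB f c.1) (lt_irrefl _)
      · rw [c.2.2.1, c.2.2.2]; rfl
      · rw [c.2.2.1, c.2.2.2]; rfl
      · obtain ⟨f', c1, c2⟩ := c.2.1
        exact absurd (hWB f' c1) (by omega)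
    have c2 : R.gainF M w f = 1 + indF M f := by
      rcases gainF_cases hM hE with c | c | c | c
      · exact absurd (hFB w c.1) (lt_irrefl _)
      · rw [c.2.2.1, c.2.2.2]; rfl
      · rw [c.2.2.1, c.2.2.2]; rfl
      · obtain ⟨f', c1, c2⟩ := c.2.1
        exact absurd (hFB f' c1) (by omega)
    constructor <;> linarith
  · intro w f hE hlt
    have := h1 w f hE
    unfold gain at this
    rcases gainW_cases hM hE with c | c | c | c <;> rcases gainF_cases hM hE with d | d | d | d
    case inr.inr.inr.inr.inr.inr => exact ⟨c.2.1, d.2.1⟩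
    case inl.inl => have := hm c.1; linarith
    all_goals first
      | exact absurd c.1 d.1
      | exact absurd d.1 c.1
      | (exfalso; have e1 := c.2.2.1; have e2 := c.2.2.2; have e3 := d.2.2.1; have e4 := d.2.2.2
         rw [e1, e3] at hlt; rw [e2, e4] at this; linarith)

/-- An edge of a popular matching at which the certificate vanishes is in a stable matching. -/
theorem Witness.exists_stable {γ : W → ℤ} {δ : F → ℤ} (hγ : Witness R M γ δ)
    (hM : IsMatchingOf R.E M) :
    ∃ N l, R.LStable 1 N l ∧ ∀ w f, (w, f) ∈ M → γ w = 0 → (w, f) ∈ N := by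
  -- Agents of value 0 are confined to their edges in `M`; the others are matched among themselves,
  -- where those of positive value may not lose against `M`. A stable matching of this subgraph
  -- turns out to be stable in the whole graph.
  obtain ⟨N, l, hN⟩ := R.exists_rstable le_rfl one_le_two fun w f _ =>
    ((w, f) ∈ M ∧ γ w = 0) ∨ (γ w ≠ 0 ∧ δ f ≠ 0 ∧
      (0 < γ w → ∀ f', (w, f') ∈ M → R.rw w f ≤ R.rw w f') ∧
      (0 < δ f → ∀ w', (w', f) ∈ M → R.rf f w ≤ R.rf f w'))
  have hl : ∀ w, l w = 0 := fun w => by have := hN.lt_L w; omega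
  have hNb : ∀ {w f}, R.E w f → (((w, f) ∈ M ∧ γ w = 0) ∨ (γ w ≠ 0 ∧ δ f ≠ 0 ∧
      (0 < γ w → ∀ f', (w, f') ∈ M → R.rw w f ≤ R.rw w f') ∧
      (0 < δ f → ∀ w', (w', f) ∈ M → R.rf f w ≤ R.rf f w'))) → R.WB N w f →
      ∃ w', (w', f) ∈ N ∧ R.rf f w' < R.rf f w := by
    intro w f hE hA hb
    obtain ⟨w', h1, h2⟩ := hN.not_block (j := 0) hE one_pos hA (Or.inr ⟨(hl w).symm, hb⟩)
    rw [hl w'] at h2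
    exact ⟨w', h1, by omega⟩
  have hA := fun {w f} => hN.allowed (w := w) (f := f)
  have hmm := fun {w f} (h : (w, f) ∈ M) => hγ.matched h
  -- Both ends have value 0 and no other admissible edge, so nothing competes with this one.
  have F1 : ∀ w f, (w, f) ∈ M → γ w = 0 → (w, f) ∈ N := by
    intro w f hwf h0
    by_contra hn
    have hu : ∀ f', (w, f') ∉ N := by
      intro f' hf'
      rcases hA hf' with h | h
      · exact hn (hM.firm_unique h.1 hwf ▸ hf')
      · exact h.1 h0
    obtain ⟨w', h1, h2⟩ := hNb (hM.edge hwf) (Or.inl ⟨hwf, h0⟩) fun f' h => absurd h (hu f')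
    rcases hA h1 with h | h
    · obtain rfl := hM.worker_unique h.1 hwf
      exact hn h1
    · have := hmm hwf
      exact h.2.1 (by omega)
  -- Were `w` unmatched in `N`, its partner `f` in `M`, of negative value, would hold a better `w₁`.
  -- If `w₁` has negative value, this contradicts `neg`. If `w₁` has positive value, it does not
  -- lose, and `pos` makes the value of `f` positive.
  have F2 : ∀ w f, (w, f) ∈ M → 0 < γ w → ∃ f', (w, f') ∈ N ∧ R.rw w f' ≤ R.rw w f := by
    intro w f hwf h0
    by_cases hm : ∃ f', (w, f') ∈ N
    · obtain ⟨f', hf'⟩ := hm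
      rcases hA hf' with h | h
      · omega
      · exact ⟨f', hf', h.2.2.1 h0 f hwf⟩
    · push Not at hm
      have hs := hmm hwf
      obtain ⟨w₁, h1, h2⟩ := hNb (hM.edge hwf)
        (Or.inr ⟨by omega, by omega, fun _ f' h => (hM.firm_unique hwf h ▸ le_rfl),
          fun h => by omega⟩) fun f' h => absurd h (hm f')
      have hE1 := hN.matching.edge h1
      rcases hA h1 with h | h
      · obtain rfl := hM.worker_unique h.1 hwf
        exact absurd h1 (hm f)
      · have hne : (w₁, f) ∉ M := fun h' => by
          obtain rfl := hM.worker_unique h' hwf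
          exact hm f h1
        rcases lt_or_gt_of_ne h.1 with hg | hg
        · obtain ⟨-, w', h3, h4⟩ := hγ.neg hE1 (by omega)
          obtain rfl := hM.worker_unique h3 hwf
          omega
        · have := (hγ.pos hE1 (WB_of_le hM hE1 hne (h.2.2.1 hg))
            fun w' h' => hM.worker_unique h' hwf ▸ h2).2
          omega
  -- The mirror image: were `f` unmatched in `N`, its partner in `M` would have moved to a better
  -- firm, which is excluded in the same way.
  have F3 : ∀ w f, (w, f) ∈ M → 0 < δ f → ∃ w', (w', f) ∈ N ∧ R.rf f w' ≤ R.rf f w := by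
    intro w f hwf h0
    by_cases hm : ∃ w', (w', f) ∈ N
    · obtain ⟨w', hw'⟩ := hm
      rcases hA hw' with h | h
      · have := hmm h.1
        omega
      · exact ⟨w', hw', h.2.2.2 h0 w hwf⟩
    · push Not at hm
      have hs := hmm hwf
      have hnb : ¬ R.WB N w f := fun hb => by
        obtain ⟨w₁, h1, h2⟩ := hNb (hM.edge hwf)
          (Or.inr ⟨by omega, by omega, fun h => by omega,
            fun _ w' h => (hM.worker_unique hwf h ▸ le_rfl)⟩) hb
        exact hm w₁ h1
      obtain ⟨f₁, h1, h2⟩ := exists_of_not_WB hN.matching (hM.edge hwf) (hm w) hnb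
      have hE1 := hN.matching.edge h1
      rcases hA h1 with h | h
      · omega
      · have hne : (w, f₁) ∉ M := fun h' => by
          obtain rfl := hM.firm_unique h' hwf
          exact hm w h1
        rcases lt_or_gt_of_ne h.2.1 with hg | hg
        · obtain ⟨⟨f', h3, h4⟩, -⟩ := hγ.neg hE1 (by omega)
          obtain rfl := hM.firm_unique h3 hwf
          omega
        · have := (hγ.pos hE1 (fun f' h' => hM.firm_unique h' hwf ▸ h2)
            (FB_of_le hM hE1 hne (h.2.2.2 hg))).1
          omega
  have hfm : ∀ {w f}, (w, f) ∈ M → δ f = 0 → (w, f) ∈ N := fun {w f} h h0 =>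
    F1 w f h (by have := hmm h; omega)
  refine ⟨N, l, ⟨hN.matching, hN.lt_L, hN.unmatched, fun _ => trivial, ?_⟩, F1⟩
  intro w f j hE hj _ hb
  have hb : R.WB N w f := by
    rcases hb with hb | hb
    · rw [hl w] at hb; omega
    · exact hb.2
  suffices ∃ w', (w', f) ∈ N ∧ R.rf f w' < R.rf f w by
    obtain ⟨w', h1, h2⟩ := this
    exact ⟨w', h1, Or.inr ⟨by rw [hl w']; omega, h2⟩⟩
  have hWB0 : γ w = 0 → R.WB M w f := fun h0 f' hf' => hb f' (F1 w f' hf' h0)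
  by_cases hwfM : (w, f) ∈ M ∧ γ w = 0
  · exact hNb hE (Or.inl hwfM) hb
  -- If `w` has value 0, then it prefers `f` to its situation in `M` as well, so by `pos` firm `f`
  -- has a better partner in `M`; `N` keeps or improves it when `δ f ≥ 0`, and `δ f < 0` contradicts
  -- `neg`. The case `δ f = 0` is dual. If neither value is 0 and the edge is inadmissible, an end
  -- of positive value would lose against `M`, and F2 or F3 applies.
  rcases eq_or_ne (γ w) 0 with hw | hw
  · have hne : (w, f) ∉ M := fun h => hwfM ⟨h, hw⟩
    have hWB := hWB0 hw
    have hnF : ¬ R.FB M w f := fun h => by have := (hγ.pos hE hWB h).1; omega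
    obtain ⟨w', h1, h2⟩ := exists_of_not_FB hM hE hne hnF
    rcases lt_trichotomy (δ f) 0 with hf | hf | hf
    · obtain ⟨⟨f', h3, h4⟩, -⟩ := hγ.neg hE (by omega)
      have := hWB f' h3
      omega
    · exact ⟨w', hfm h1 hf, h2⟩
    · obtain ⟨w'', h3, h4⟩ := F3 w' f h1 hf
      exact ⟨w'', h3, by omega⟩
  · rcases eq_or_ne (δ f) 0 with hf | hf
    · have hne : (w, f) ∉ M := fun h => by have := hmm h; omega
      rcases lt_or_gt_of_ne hw with hw | hw
      · obtain ⟨-, w', h3, h4⟩ := hγ.neg hE (by omega)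
        exact ⟨w', hfm h3 hf, h4⟩
      · have hWB : R.WB M w f := fun f' hf' => by
          obtain ⟨f'', h1, h2⟩ := F2 w f' hf' hw
          exact (hb f'' h1).trans_le h2
        have hnF : ¬ R.FB M w f := fun h => by have := (hγ.pos hE hWB h).2; omega
        obtain ⟨w', h1, h2⟩ := exists_of_not_FB hM hE hne hnF
        exact ⟨w', hfm h1 hf, h2⟩
    · by_cases hA1 : 0 < γ w → ∀ f', (w, f') ∈ M → R.rw w f ≤ R.rw w f'
      · by_cases hA2 : 0 < δ f → ∀ w', (w', f) ∈ M → R.rf f w ≤ R.rf f w'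
        · exact hNb hE (Or.inr ⟨hw, hf, hA1, hA2⟩) hb
        · push Not at hA2
          obtain ⟨hf0, w', h1, h2⟩ := hA2
          obtain ⟨w'', h3, h4⟩ := F3 w' f h1 hf0
          exact ⟨w'', h3, by omega⟩
      · push Not at hA1
        obtain ⟨hw0, f', h1, h2⟩ := hA1
        obtain ⟨f'', h3, h4⟩ := F2 w f' h1 hw0
        have := hb f'' h3
        omega

/-- An edge of a popular matching at which the certificate does not vanish is in a matching that
is stable with two levels. -/
theorem Witness.exists_stable_two {γ : W → ℤ} {δ : F → ℤ} (hγ : Witness R M γ δ)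
    (hM : IsMatchingOf R.E M) :
    ∃ N l, R.LStable 2 N l ∧ ∀ w f, (w, f) ∈ M → γ w ≠ 0 → (w, f) ∈ N := by
  -- The roles are exchanged: agents of nonzero value keep their partners in `M`, at the level given
  -- by the sign of the value of the worker. Agents of value 0 are matched among themselves; at
  -- level 1 the worker may not lose against `M`, at level 0 the firm may not.
  obtain ⟨N, l, hN⟩ := R.exists_rstable one_le_two le_rfl fun w f j =>
    ((w, f) ∈ M ∧ γ w ≠ 0 ∧ j = if 0 < γ w then 0 else 1) ∨ (γ w = 0 ∧ δ f = 0 ∧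
      (j = 1 → ∀ f', (w, f') ∈ M → R.rw w f ≤ R.rw w f') ∧
      (j = 0 → ∀ w', (w', f) ∈ M → R.rf f w ≤ R.rf f w'))
  have hA := fun {w f} => hN.allowed (w := w) (f := f)
  have hl := hN.lt_L
  have hmm := fun {w f} (h : (w, f) ∈ M) => hγ.matched h
  have F1 : ∀ w f, (w, f) ∈ M → γ w ≠ 0 → (w, f) ∈ N ∧ l w = if 0 < γ w then 0 else 1 := by
    intro w f hwf h0
    have hs := hmm hwf
    have hin : (w, f) ∈ N := by
      by_contra hn
      have hu : ∀ f', (w, f') ∉ N := by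
        intro f' hf'
        rcases hA hf' with h | h
        · exact hn (hM.firm_unique h.1 hwf ▸ hf')
        · exact h0 h.1
      have hlw := hN.unmatched w hu
      obtain ⟨w', h1, h2⟩ := hN.not_block (j := if 0 < γ w then 0 else 1) (hM.edge hwf)
        (by split_ifs <;> omega) (Or.inl ⟨hwf, h0, rfl⟩) (by
          have hb : R.WB N w f := fun f' h => absurd h (hu f')
          split_ifs
          · left; omega
          · right; exact ⟨by omega, hb⟩)
      rcases hA h1 with h | h
      · obtain rfl := hM.worker_unique h.1 hwf
        exact hn h1
      · omega
    refine ⟨hin, ?_⟩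
    rcases hA hin with h | h
    · exact h.2.2
    · exact absurd h.1 h0
  -- Were `w` unmatched, `f` would hold a better `w₁` at level 1, where `w₁` does not lose; then
  -- `pos` makes the value of `w₁` positive, whereas it is 0.
  have F2 : ∀ w f, (w, f) ∈ M → γ w = 0 → l w = 1 → ∃ f', (w, f') ∈ N ∧
      R.rw w f' ≤ R.rw w f := by
    intro w f hwf h0 hlw
    by_cases hm : ∃ f', (w, f') ∈ N
    · obtain ⟨f', hf'⟩ := hm
      rcases hA hf' with h | h
      · exact absurd h0 h.2.1
      · exact ⟨f', hf', h.2.2.1 hlw f hwf⟩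
    · push Not at hm
      have hs := hmm hwf
      obtain ⟨w₁, h1, h2⟩ := hN.not_block (j := 1) (hM.edge hwf) one_lt_two
        (Or.inr ⟨h0, by omega, fun _ f' h => (hM.firm_unique hwf h ▸ le_rfl), fun h => by omega⟩)
        (Or.inr ⟨hlw.symm, fun f' h => absurd h (hm f')⟩)
      have hl1 := hl w₁
      have hl2 : l w₁ = 1 := by omega
      have hE1 := hN.matching.edge h1
      have hne : (w₁, f) ∉ M := fun h' => by
        obtain rfl := hM.worker_unique h' hwf
        exact hm f h1
      rcases hA h1 with h | h
      · exact absurd h.1 hne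
      · have := (hγ.pos hE1 (WB_of_le hM hE1 hne (h.2.2.1 hl2))
          fun w' h' => hM.worker_unique h' hwf ▸ (by omega)).1
        omega
  -- Were `f` unmatched, its partner in `M` would be at level 0 with a better firm `f₁`, which does
  -- not lose there; this contradicts `pos`.
  have F3 : ∀ w f, (w, f) ∈ M → δ f = 0 → ∃ w', (w', f) ∈ N ∧
      (l w' = 1 ∨ l w' = 0 ∧ R.rf f w' ≤ R.rf f w) := by
    intro w f hwf h0
    have hs := hmm hwf
    by_cases hm : ∃ w', (w', f) ∈ N
    · obtain ⟨w', hw'⟩ := hm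
      refine ⟨w', hw', ?_⟩
      rcases hA hw' with h | h
      · have := hmm h.1
        omega
      · by_cases h3 : l w' = 0
        · exact Or.inr ⟨h3, h.2.2.2 h3 w hwf⟩
        · have := hl w'; omega
    · push Not at hm
      exfalso
      have hnb : ¬ (0 < l w ∨ 0 = l w ∧ R.WB N w f) := fun hb => by
        obtain ⟨w₁, h1, h2⟩ := hN.not_block (j := 0) (hM.edge hwf) two_pos
          (Or.inr ⟨by omega, h0, fun h => by omega,
            fun _ w' h => (hM.worker_unique hwf h ▸ le_rfl)⟩) hb
        exact hm w₁ h1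
      push Not at hnb
      have hl0 : l w = 0 := by omega
      obtain ⟨f₁, h1, h2⟩ := exists_of_not_WB hN.matching (hM.edge hwf) (hm w) (hnb.2 hl0.symm)
      have hE1 := hN.matching.edge h1
      have hne : (w, f₁) ∉ M := fun h' => by
        obtain rfl := hM.firm_unique h' hwf
        exact hm w h1
      rcases hA h1 with h | h
      · exact hne h.1
      · have := (hγ.pos hE1 (fun f' h' => hM.firm_unique h' hwf ▸ h2)
          (FB_of_le hM hE1 hne (h.2.2.2 hl0))).1
        omega
  refine ⟨N, l, ⟨hN.matching, hN.lt_L, hN.unmatched, fun _ => trivial, ?_⟩,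
    fun w f h h0 => (F1 w f h h0).1⟩
  intro w f j hE hj _ hb
  have hlw := hl w
  by_cases hwfM : (w, f) ∈ M ∧ γ w ≠ 0
  · obtain ⟨h1, h2⟩ := F1 w f hwfM.1 hwfM.2
    rcases hb with hb | hb
    · exact ⟨w, h1, Or.inl hb⟩
    · exact absurd (hb.2 f h1) (lt_irrefl _)
  -- A firm of nonzero value is matched in `M`, and by F1 it keeps its partner, at level 1 iff the
  -- value of the firm is positive.
  have hFp : δ f ≠ 0 → ∃ w', (w', f) ∈ M ∧ (w', f) ∈ N ∧ γ w' + δ f = 0 ∧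
      l w' = if 0 < γ w' then 0 else 1 := by
    intro h0
    by_contra! hno
    refine h0 (hγ.firm_unmatched fun w' hw' => ?_)
    have := hmm hw'
    obtain ⟨h1, h2⟩ := F1 w' f hw' (by omega)
    exact hno w' hw' h1 this h2
  have hFF : ∀ w', (w', f) ∈ M → R.rf f w' < R.rf f w → δ f = 0 → j = 0 →
      ∃ w', (w', f) ∈ N ∧ (j < l w' ∨ j = l w' ∧ R.rf f w' < R.rf f w) := by
    intro w' h1 h2 h3 h4
    obtain ⟨w'', h5, h6⟩ := F3 w' f h1 h3
    exact ⟨w'', h5, by omega⟩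
  have hb1 : j = l w → R.WB N w f := fun h => by
    rcases hb with hb | hb
    · omega
    · exact hb.2
  have hjl : j ≤ l w := hb.elim le_of_lt fun h => h.1.le
  -- A strictly higher level of the worker that `f` holds settles the claim at once. At equal
  -- levels, `neg` (when the sum of the values is negative) or `pos` (when the values are not both
  -- positive) shows that `f` has a better partner in `M`, and F1 or F3 carries this over to `N`.
  rcases eq_or_ne (γ w) 0 with hw | hw
  · have hWB1 : j = 1 → R.WB M w f := fun h f' hf' => by
      obtain ⟨f'', h1, h2⟩ := F2 w f' hf' hw (by omega)
      exact (hb1 (by omega) f'' h1).trans_le h2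
    rcases eq_or_ne (δ f) 0 with hf | hf
    · by_cases hA2 : j = 0 → ∀ w', (w', f) ∈ M → R.rf f w ≤ R.rf f w'
      · refine hN.not_block hE hj (Or.inr ⟨hw, hf, fun h f' hf' => ?_, hA2⟩) hb
        exact (hWB1 h f' hf').le
      · push Not at hA2
        obtain ⟨hj0, w', h1, h2⟩ := hA2
        exact hFF w' h1 h2 hf hj0
    · obtain ⟨w', h1, h2, h3, h4⟩ := hFp hf
      have hne : (w, f) ∉ M := fun h => by have := hmm h; omega
      refine ⟨w', h2, ?_⟩
      rcases lt_or_gt_of_ne hf with hf | hf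
      · rw [if_pos (by omega)] at h4
        obtain ⟨⟨f₁, h5, h6⟩, w'', h7, h8⟩ := hγ.neg hE (by omega)
        obtain rfl := hM.worker_unique h7 h1
        right
        refine ⟨?_, h8⟩
        by_contra hj0
        have := hWB1 (by omega) f₁ h5
        omega
      · rw [if_neg (by omega)] at h4
        by_cases hj0 : j = 0
        · left; omega
        · right
          refine ⟨by omega, ?_⟩
          have hnF : ¬ R.FB M w f := fun h => by
            have := (hγ.pos hE (hWB1 (by omega)) h).1; omega
          obtain ⟨w'', h5, h6⟩ := exists_of_not_FB hM hE hne hnF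
          obtain rfl := hM.worker_unique h5 h1
          exact h6
  · have hne : (w, f) ∉ M := fun h => hwfM ⟨h, hw⟩
    have hlw' : l w = if 0 < γ w then 0 else 1 := by
      by_contra hno
      exact hw (hγ.worker_unmatched fun f' hf' => hno (F1 w f' hf' hw).2)
    have hWB : j = l w → R.WB M w f := fun h f' hf' => hb1 h f' (F1 w f' hf' hw).1
    have hnF : j = l w → ¬ (0 < γ w ∧ 0 < δ f) →
        ∃ w', (w', f) ∈ M ∧ R.rf f w' < R.rf f w := fun h h' =>
      exists_of_not_FB hM hE hne fun hF => h' (hγ.pos hE (hWB h) hF)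
    rcases eq_or_ne (δ f) 0 with hf | hf
    · rcases lt_or_gt_of_ne hw with hw | hw
      · rw [if_neg (by omega)] at hlw'
        obtain ⟨⟨f₁, h5, h6⟩, w', h7, h8⟩ := hγ.neg hE (by omega)
        refine hFF w' h7 h8 hf ?_
        by_contra hj0
        have := hWB (by omega) f₁ h5
        omega
      · rw [if_pos hw] at hlw'
        obtain ⟨w', h1, h2⟩ := hnF (by omega) (by omega)
        exact hFF w' h1 h2 hf (by omega)
    · obtain ⟨w', h1, h2, h3, h4⟩ := hFp hf
      refine ⟨w', h2, ?_⟩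
      rcases lt_or_gt_of_ne hw with hw | hw
      · rw [if_neg (by omega)] at hlw'
        rcases lt_or_gt_of_ne hf with hf | hf
        · rw [if_pos (by omega)] at h4
          obtain ⟨⟨f₁, h5, h6⟩, w'', h7, h8⟩ := hγ.neg hE (by omega)
          obtain rfl := hM.worker_unique h7 h1
          right
          refine ⟨?_, h8⟩
          by_contra hj0
          have := hWB (by omega) f₁ h5
          omega
        · rw [if_neg (by omega)] at h4
          by_cases hj0 : j = 0
          · left; omega
          · obtain ⟨w'', h7, h8⟩ := hnF (by omega) (by omega)
            obtain rfl := hM.worker_unique h7 h1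
            right; exact ⟨by omega, h8⟩
      · rw [if_pos hw] at hlw'
        rcases lt_or_gt_of_ne hf with hf | hf
        · rw [if_pos (by omega)] at h4
          obtain ⟨w'', h7, h8⟩ := hnF (by omega) (by omega)
          obtain rfl := hM.worker_unique h7 h1
          right; exact ⟨by omega, h8⟩
        · rw [if_neg (by omega)] at h4
          left; omega

/-- An edge of a popular matching is in a matching that is stable with one or two levels. -/
theorem IsPop.exists_lstable (h : R.IsPop M) {a : W} {b : F} (hab : (a, b) ∈ M) :
    (∃ N l, R.LStable 1 N l ∧ (a, b) ∈ N) ∨ ∃ N l, R.LStable 2 N l ∧ (a, b) ∈ N := by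
  obtain ⟨γ, δ, hγ⟩ := h.exists_witness
  by_cases h0 : γ a = 0
  · obtain ⟨N, l, h1, h2⟩ := hγ.exists_stable h.1
    exact Or.inl ⟨N, l, h1, h2 a b hab h0⟩
  · obtain ⟨N, l, h1, h2⟩ := hγ.exists_stable_two h.1
    exact Or.inr ⟨N, l, h1, h2 a b hab h0⟩

end Pref

/-! ### Certificates: one-level stable matchings are popular, two-level stable matchings are the
dominant ones -/

namespace Pref

variable {W F : Type*} {R : Pref W F} {M : Finset (W × F)}

theorem card_le_of_matched {E : W → F → Prop} {N : Finset (W × F)} (hN : IsMatchingOf E N)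
    (h : ∀ w f, (w, f) ∈ N → ∃ f', (w, f') ∈ M) : N.card ≤ M.card := by
  classical
  have : ∀ e ∈ N, ∃ e' ∈ M, e'.1 = e.1 := fun e he => by
    obtain ⟨f', hf'⟩ := h e.1 e.2 he
    exact ⟨_, hf', rfl⟩
  choose! g hg hg1 using this
  refine Finset.card_le_card_of_injOn g hg fun e he e' he' heq => ?_
  have h1 : e.1 = e'.1 := by rw [← hg1 e he, ← hg1 e' he', heq]
  by_contra hne
  exact (hN.2 e he e' he' hne).1 h1

theorem sum_fst_le [Fintype W] {E : W → F → Prop} {N : Finset (W × F)} (hN : IsMatchingOf E N)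
    (α : W → ℤ) (h0 : ∀ w, 0 ≤ α w) : ∑ e ∈ N, α e.1 ≤ ∑ w, α w := by
  classical
  rw [← Finset.sum_image (s := N) (g := Prod.fst) (f := α)]
  · exact Finset.sum_le_sum_of_subset_of_nonneg (Finset.subset_univ _) fun _ _ _ => h0 _
  · intro e he e' he' heq
    by_contra hne
    exact (hN.2 e he e' he' hne).1 heq

theorem sum_snd_le [Fintype F] {E : W → F → Prop} {N : Finset (W × F)} (hN : IsMatchingOf E N)
    (α : F → ℤ) (h0 : ∀ f, 0 ≤ α f) : ∑ e ∈ N, α e.2 ≤ ∑ f, α f := by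
  classical
  rw [← Finset.sum_image (s := N) (g := Prod.snd) (f := α)]
  · exact Finset.sum_le_sum_of_subset_of_nonneg (Finset.subset_univ _) fun _ _ _ => h0 _
  · intro e he e' he' heq
    by_contra hne
    exact (hN.2 e he e' he' hne).2 heq

theorem sum_fst_eq [Fintype W] {E : W → F → Prop} (hM : IsMatchingOf E M)
    (α : W → ℤ) (h0 : ∀ w, (∀ f, (w, f) ∉ M) → α w = 0) : ∑ e ∈ M, α e.1 = ∑ w, α w := by
  classical
  rw [← Finset.sum_image (s := M) (g := Prod.fst) (f := α)]
  · refine Finset.sum_subset (Finset.subset_univ _) fun w _ hw => h0 w fun f hf => hw ?_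
    exact Finset.mem_image.2 ⟨_, hf, rfl⟩
  · intro e he e' he' heq
    by_contra hne
    exact (hM.2 e he e' he' hne).1 heq

theorem sum_snd_eq [Fintype F] {E : W → F → Prop} (hM : IsMatchingOf E M)
    (α : F → ℤ) (h0 : ∀ f, (∀ w, (w, f) ∉ M) → α f = 0) : ∑ e ∈ M, α e.2 = ∑ f, α f := by
  classical
  rw [← Finset.sum_image (s := M) (g := Prod.snd) (f := α)]
  · refine Finset.sum_subset (Finset.subset_univ _) fun f _ hf => h0 f fun w hw => hf ?_
    exact Finset.mem_image.2 ⟨_, hw, rfl⟩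
  · intro e he e' he' heq
    by_contra hne
    exact (hM.2 e he e' he' hne).2 heq

/-- Nonnegative values of the agents that bound the gains of all edges and add up to `2` on the
edges of `M`. -/
structure Certificate (R : Pref W F) (M : Finset (W × F)) (α : W → ℤ) (β : F → ℤ) : Prop where
  nonneg_worker : ∀ w, 0 ≤ α w
  nonneg_firm : ∀ f, 0 ≤ β f
  worker_unmatched : ∀ w, (∀ f, (w, f) ∉ M) → α w = 0
  firm_unmatched : ∀ f, (∀ w, (w, f) ∉ M) → β f = 0
  matched : ∀ {w f}, (w, f) ∈ M → α w + β f = 2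
  gain_le : ∀ {w f}, R.E w f → R.gain M w f ≤ α w + β f

/-- Weak duality: no matching collects more than the total value, and `M` collects all of it. -/
theorem Certificate.sum_le [Fintype W] [Fintype F] {α : W → ℤ} {β : F → ℤ}
    (h : Certificate R M α β) (hM : IsMatchingOf R.E M) {N : Finset (W × F)}
    (hN : IsMatchingOf R.E N) : ∑ e ∈ N, (α e.1 + β e.2) ≤ 2 * M.card := by
  have h1 := sum_fst_le hN α h.nonneg_worker
  have h2 := sum_snd_le hN β h.nonneg_firm
  have h3 : ∑ e ∈ M, (α e.1 + β e.2) = 2 * M.card := by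
    rw [Finset.sum_congr rfl fun e he => h.matched (w := e.1) (f := e.2) he]
    simp [mul_comm]
  rw [Finset.sum_add_distrib] at h3 ⊢
  rw [sum_fst_eq hM α h.worker_unmatched, sum_snd_eq hM β h.firm_unmatched] at h3
  linarith

theorem Certificate.isPop [Fintype W] [Fintype F] {α : W → ℤ} {β : F → ℤ}
    (h : Certificate R M α β) (hM : IsMatchingOf R.E M) : R.IsPop M :=
  ⟨hM, fun _ hN => (Finset.sum_le_sum fun _ he => h.gain_le (hN.edge he)).trans (h.sum_le hM hN)⟩

/-- An end of an edge gains at most its indicator plus 1, and a losing end gains its indicator minus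
1. Off `M`, stability makes at least one end lose. -/
theorem LStable.certificate {l : W → ℕ} (h : R.LStable 1 M l) :
    Certificate R M (indW M) (indF M) := by
  have hM := h.matching
  refine ⟨fun w => ?_, fun f => ?_, fun w => indW_of_not, fun f => indF_of_not, fun hm => ?_,
    fun {w f} hE => ?_⟩
  · unfold indW matchedInd; split_ifs <;> norm_num
  · unfold indF matchedInd; split_ifs <;> norm_num
  · rw [indW_of_mem hm, indF_of_mem hm]; norm_num
  · have hl : ∀ w, l w = 0 := fun w => by have := h.lt_L w; omega
    have hb : R.WB M w f → ∃ w', (w', f) ∈ M ∧ R.rf f w' < R.rf f w := fun hb => by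
      obtain ⟨w', h1, h2⟩ := h.not_block hE one_pos trivial (Or.inr ⟨(hl w).symm, hb⟩)
      rw [hl w'] at h2
      exact ⟨w', h1, by omega⟩
    unfold gain
    by_cases hWB : R.WB M w f
    · obtain ⟨w', h1, h2⟩ := hb hWB
      have c : R.gainW M w f ≤ 1 + indW M w := by
        rcases gainW_cases hM hE with c | c | c | c
        · rw [c.2.1, c.2.2]; norm_num
        all_goals rw [c.2.2.1, c.2.2.2]; norm_num
      rcases gainF_cases hM hE with d | d | d | d
      · exact absurd (hM.worker_unique d.1 h1 ▸ h2) (lt_irrefl _)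
      · exact absurd h1 (d.2.1 w')
      · exact absurd (d.2.1 w' h1) (by omega)
      · rw [d.2.2.1, d.2.2.2]; linarith
    · rcases gainW_cases hM hE with c | c | c | c
      · rw [c.2.1, c.2.2, indF_of_mem c.1]
        simp [gainF, rankGain, c.1]
      · exact absurd (fun f' h' => absurd h' (c.2.1 f')) hWB
      · exact absurd c.2.1 hWB
      · rw [c.2.2.1, c.2.2.2]
        rcases gainF_cases hM hE with d | d | d | d
        · exact absurd d.1 c.1
        all_goals rw [d.2.2.1, d.2.2.2]; norm_num

open Classical in
/-- A matching that is stable with two levels has a certificate that is not tight at edges with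
an unmatched end. -/
theorem LStable.certificate_two {l : W → ℕ} (h : R.LStable 2 M l) :
    ∃ α β, Certificate R M α β ∧ ∀ w f, R.E w f → ((∀ f', (w, f') ∉ M) ∨ ∀ w', (w', f) ∉ M) →
      R.gain M w f < α w + β f := by
  have hM := h.matching
  have hl := h.lt_L
  -- Each edge of `M` carries total value 2: at the worker if it is at level 0, at the firm if it is
  -- at level 1. An edge that both ends want needs value 4, and indeed stability puts the worker at
  -- level 0 and the worker held by the firm at level 1.
  set α : W → ℤ := fun w => if (∃ f, (w, f) ∈ M) ∧ l w = 0 then 2 else 0 with hα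
  set β : F → ℤ := fun f => if ∃ w, (w, f) ∈ M ∧ l w = 1 then 2 else 0 with hβ
  have hβm : ∀ {w f}, (w, f) ∈ M → β f = if l w = 1 then 2 else 0 := by
    intro w f hwf
    simp only [hβ]
    congr 1
    refine propext ⟨fun ⟨w', h1, h2⟩ => hM.worker_unique h1 hwf ▸ h2, fun h => ⟨w, hwf, h⟩⟩
  have hα1 : ∀ {w f}, (w, f) ∈ M → α w = if l w = 0 then 2 else 0 := by
    intro w f hwf
    simp [hα, show ∃ f, (w, f) ∈ M from ⟨f, hwf⟩]
  have hα0 : ∀ w, (∀ f, (w, f) ∉ M) → α w = 0 := fun w hw => by simp [hα, hw]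
  have hβ0 : ∀ f, (∀ w, (w, f) ∉ M) → β f = 0 := fun f hf => by simp [hβ, hf]
  have key : ∀ {w f}, R.E w f → R.gain M w f ≤ α w + β f ∧
      (((∀ f', (w, f') ∉ M) ∨ ∀ w', (w', f) ∉ M) → R.gain M w f < α w + β f) := by
    intro w f hE
    have hlw := hl w
    unfold gain
    rcases gainW_cases hM hE with c | c | c | c
    · have hF : R.gainF M w f = 1 := by simp [gainF, rankGain, c.1]
      have hs : α w + β f = 2 := by
        rw [hα1 c.1, hβm c.1]
        split_ifs <;> omega
      rw [c.2.2, hF, hs]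
      refine ⟨by norm_num, ?_⟩
      rintro (h1 | h1)
      · exact absurd c.1 (h1 f)
      · exact absurd c.1 (h1 w)
    · have hl1 : l w = 1 := by have := h.unmatched w c.2.1; omega
      obtain ⟨w', h1, h2⟩ := h.not_block (j := 1) hE one_lt_two trivial
        (Or.inr ⟨hl1.symm, fun f' hf' => absurd hf' (c.2.1 f')⟩)
      have hlw' := hl w'
      have hF : R.gainF M w f = 0 := by
        rcases gainF_cases hM hE with d | d | d | d
        · exact absurd d.1 c.1
        · exact absurd h1 (d.2.1 w')
        · exact absurd (d.2.1 w' h1) (by omega)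
        · exact d.2.2.2
      rw [c.2.2.2, hF, hα0 w c.2.1, hβm h1, if_pos (by omega)]
      norm_num
    · have hm : ∃ f', (w, f') ∈ M := by
        by_contra hno
        push Not at hno
        rw [indW_of_not hno] at c
        exact absurd c.2.2.1 (by norm_num)
      obtain ⟨f', hf'⟩ := hm
      obtain ⟨w', h1, h2⟩ := h.not_block hE hlw trivial (Or.inr ⟨rfl, c.2.1⟩)
      have hlw' := hl w'
      have hFle : R.gainF M w f ≤ 2 := by
        rcases gainF_cases hM hE with d | d | d | d
        · exact absurd d.1 c.1
        all_goals linarith [d.2.2.2]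
      have hF0 : R.rf f w' < R.rf f w → R.gainF M w f = 0 := fun hlt => by
        rcases gainF_cases hM hE with d | d | d | d
        · exact absurd d.1 c.1
        · exact absurd h1 (d.2.1 w')
        · exact absurd (d.2.1 w' h1) (by omega)
        · exact d.2.2.2
      refine ⟨?_, ?_⟩
      · rw [c.2.2.2, hα1 hf', hβm h1]
        rcases h2 with h2 | ⟨h2, h3⟩
        · rw [if_pos (by omega), if_pos (by omega)]; linarith
        · rw [hF0 h3]
          split_ifs <;> omega
      · rintro (h3 | h3)
        · exact absurd hf' (h3 f')
        · exact absurd h1 (h3 w')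
    · obtain ⟨f', hf', -⟩ := c.2.1
      rw [c.2.2.2, hα1 hf']
      by_cases hm : ∃ w', (w', f) ∈ M
      · obtain ⟨w', hw'⟩ := hm
        rw [hβm hw']
        refine ⟨?_, ?_⟩
        · rcases gainF_cases hM hE with d | d | d | d
          · exact absurd d.1 c.1
          · exact absurd hw' (d.2.1 w')
          · rw [d.2.2.2]
            by_cases hl0 : l w = 0
            · rw [if_pos hl0]; split_ifs <;> norm_num
            · obtain ⟨w'', h1, h2⟩ := h.not_block (j := 0) hE two_pos trivial (Or.inl (by omega))
              obtain rfl := hM.worker_unique h1 hw'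
              have := d.2.1 w'' h1
              have hl'' := hl w''
              rw [if_neg hl0, if_pos (by omega)]
          · rw [d.2.2.2]; split_ifs <;> norm_num
        · rintro (h3 | h3)
          · exact absurd hf' (h3 f')
          · exact absurd hw' (h3 w')
      · push Not at hm
        have hF : R.gainF M w f = 1 := by simp [gainF, rankGain, hm]
        have hl0 : l w = 0 := by
          by_contra hl0
          obtain ⟨w'', h1, -⟩ := h.not_block (j := 0) hE two_pos trivial (Or.inl (by omega))
          exact hm w'' h1
        rw [hF, hβ0 f hm, if_pos hl0]
        norm_num
  refine ⟨α, β, ⟨fun w => ?_, fun f => ?_, hα0, hβ0, fun {w f} hm => ?_, fun hE => (key hE).1⟩,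
    fun w f hE => (key hE).2⟩
  · simp only [hα]; split_ifs <;> norm_num
  · simp only [hβ]; split_ifs <;> norm_num
  · have := hl w
    rw [hα1 hm, hβm hm]
    split_ifs <;> omega

variable [Fintype W] [Fintype F]

theorem LStable.isPop_one {l : W → ℕ} (h : R.LStable 1 M l) : R.IsPop M :=
  h.certificate.isPop h.matching

/-- A competitor that matches an agent unmatched in a matching that is stable with two levels
has a smaller gain. -/
theorem LStable.sum_gain_lt {l : W → ℕ} (h : R.LStable 2 M l) {N : Finset (W × F)}
    (hN : IsMatchingOf R.E N) {w : W} {f : F} (hwf : (w, f) ∈ N)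
    (hu : (∀ f', (w, f') ∉ M) ∨ ∀ w', (w', f) ∉ M) : ∑ e ∈ N, R.gain M e.1 e.2 < 2 * M.card := by
  obtain ⟨α, β, hc, hs⟩ := h.certificate_two
  refine lt_of_lt_of_le (Finset.sum_lt_sum (fun e he => hc.gain_le (hN.edge he)) ⟨_, hwf, ?_⟩)
    (hc.sum_le h.matching hN)
  exact hs w f (hN.edge hwf) hu

/-- A larger matching contains a worker unmatched in `M`, and at its edge the certificate is not
tight. -/
theorem LStable.isDom {l : W → ℕ} (h : R.LStable 2 M l) : R.IsDom M := by
  obtain ⟨α, β, hc, -⟩ := h.certificate_two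
  refine ⟨hc.isPop h.matching, fun N hN hcard => ?_⟩
  by_contra hge
  refine absurd (card_le_of_matched (M := M) hN fun w f hwf => ?_) (not_le.2 hcard)
  by_contra hno
  exact hge (h.sum_gain_lt hN hwf (Or.inl (not_exists.1 hno)))

theorem LStable.isPop {L : ℕ} (hL1 : 1 ≤ L) (hL : L ≤ 2) {l : W → ℕ} (h : R.LStable L M l) :
    R.IsPop M := by
  have : L = 1 ∨ L = 2 := by omega
  rcases this with rfl | rfl
  · exact h.isPop_one
  · exact h.isDom.1

/-- Dominant matchings are stable with two levels. -/
theorem IsDom.exists_lstable (h : R.IsDom M) : ∃ l, R.LStable 2 M l := by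
  classical
  obtain ⟨⟨hM, hpop⟩, hdom⟩ := h
  -- `K` exceeds the size of every matching, so the weight `K * gain + 1` compares gains first and
  -- sizes second. Dominance makes `M` a matching of maximum weight: a larger competitor loses at
  -- least 1 in gain.
  set K : ℤ := Fintype.card (W × F) + 1 with hK
  have hsum : ∀ N : Finset (W × F), ∑ e ∈ N, (K * R.gain M e.1 e.2 + 1) =
      K * ∑ e ∈ N, R.gain M e.1 e.2 + N.card := by
    intro N
    rw [Finset.sum_add_distrib, Finset.mul_sum]
    simp
  obtain ⟨β, β', h1, h2, h3, h4, h5, h6⟩ :=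
      exists_dual (fun w f => K * R.gain M w f + 1) hM fun N hN => by
    rw [hsum, hsum, sum_gain_self]
    have hKp : 0 ≤ K := by positivity
    rcases le_or_gt N.card M.card with hc | hc
    · have := mul_le_mul_of_nonneg_left (hpop N hN) hKp
      have : (N.card : ℤ) ≤ M.card := by exact_mod_cast hc
      linarith
    · have h7 : ∑ e ∈ N, R.gain M e.1 e.2 ≤ 2 * M.card - 1 := by
        have := hdom N hN hc
        omega
      have := mul_le_mul_of_nonneg_left h7 hKp
      have h8 : (N.card : ℤ) ≤ K := by
        have := Finset.card_le_univ N
        omega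
      have : (0 : ℤ) ≤ M.card := by positivity
      linarith
  have hK1 : 1 ≤ K := by omega
  set γ : W → ℤ := fun w => β w - 2 * K * indW M w with hγ
  set δ : F → ℤ := fun f => β' f - 2 * K * indF M f with hδ
  have hE1 : ∀ {w f}, R.E w f →
      2 * K * (R.gainW M w f + R.gainF M w f - indW M w - indF M f) + 2 ≤ γ w + δ f := by
    intro w f hE
    have := h1 w f hE
    simp only [gain] at this
    simp only [hγ, hδ]
    linarith
  have hm : ∀ {w f}, (w, f) ∈ M → γ w + δ f = 2 := by
    intro w f hwf
    have := h2 w f hwf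
    rw [gain_of_mem hwf] at this
    simp only [hγ, hδ, indW_of_mem hwf, indF_of_mem hwf]
    linarith
  have hw0 : ∀ {w}, (∀ f, (w, f) ∉ M) → γ w = 0 := fun {w} hw => by
    simp only [hγ]; rw [h5 w hw, indW_of_not hw]; ring
  have hf0 : ∀ {f}, (∀ w, (w, f) ∉ M) → δ f = 0 := fun {f} hf => by
    simp only [hδ]; rw [h6 f hf, indF_of_not hf]; ring
  have hwge : ∀ {w f}, (w, f) ∈ M → - (2 * K) ≤ γ w ∧ -(2 * K) ≤ δ f := fun {w f} hwf => by
    simp only [hγ, hδ, indW_of_mem hwf, indF_of_mem hwf]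
    have := h3 w
    have := h4 f
    constructor <;> linarith
  have hwle : ∀ w, γ w ≤ 2 * K + 2 := fun w => by
    by_cases hw : ∃ f, (w, f) ∈ M
    · obtain ⟨f, hf⟩ := hw
      have := hm hf
      have := (hwge hf).2
      linarith
    · rw [hw0 (not_exists.1 hw)]; linarith
  have hflt : ∀ {w f}, (w, f) ∈ M → δ f ≤ 2 * K + 2 := fun {w f} hf => by
    have := hm hf
    have := (hwge hf).1
    linarith
  have hwb : ∀ {w f}, R.E w f → R.WB M w f → R.gainW M w f = indW M w + 1 := by
    intro w f hE hWB
    rcases gainW_cases hM hE with c | c | c | c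
    · exact absurd (hWB f c.1) (lt_irrefl _)
    · rw [c.2.2.1, c.2.2.2]; rfl
    · rw [c.2.2.1, c.2.2.2]; rfl
    · obtain ⟨f', c1, c2⟩ := c.2.1
      exact absurd (hWB f' c1) (by omega)
  have hwlow : ∀ {w f}, R.E w f → indW M w - 1 ≤ R.gainW M w f := by
    intro w f hE
    rcases gainW_cases hM hE with c | c | c | c
    · rw [c.2.1, c.2.2]; norm_num
    all_goals rw [c.2.2.1, c.2.2.2]; norm_num
  have hmul : ∀ x : ℤ, 0 ≤ x → 0 ≤ 2 * K * x := fun x hx => by positivity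
  -- The signs of the dual values of the workers are the levels. As the values sum to 2 on `M`, a
  -- matched firm has value at least 2 iff its partner is at level 1. The summand 2 in `hE1` yields
  -- the strictness that unmatched firms need.
  obtain ⟨l, hl0, hl1⟩ : ∃ l : W → ℕ, (∀ w, 1 ≤ γ w → l w = 0) ∧ ∀ w, γ w ≤ 0 → l w = 1 :=
    ⟨fun w => if 1 ≤ γ w then 0 else 1, fun w h => if_pos h, fun w h => if_neg (by omega)⟩
  have hl : ∀ w, l w = 0 ∧ 1 ≤ γ w ∨ l w = 1 ∧ γ w ≤ 0 := fun w => by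
    rcases le_or_gt 1 (γ w) with h | h
    · exact Or.inl ⟨hl0 w h, h⟩
    · exact Or.inr ⟨hl1 w (by omega), by omega⟩
  refine ⟨l, hM, fun w => by have := hl w; omega, fun w hw => by
    rw [hl1 w (hw0 hw).le], fun _ => trivial, ?_⟩
  intro w f j hE hj _ hb
  have hEE := hE1 hE
  by_cases hwfM : (w, f) ∈ M
  · rcases hb with hb | hb
    · exact ⟨w, hwfM, Or.inl hb⟩
    · exact absurd (hb.2 f hwfM) (lt_irrefl _)
  have hlow := hwlow hE
  have hlw := hl w
  have hwlew := hwle w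
  rcases gainF_cases hM hE with d | d | d | d
  · exact absurd d.1 hwfM
  · exfalso
    rw [d.2.2.1, d.2.2.2, hf0 d.2.1] at hEE
    rcases hb with hb | ⟨-, hb⟩
    · have := hmul (R.gainW M w f + 1 - indW M w - 0) (by linarith)
      have : γ w ≤ 0 := by omega
      linarith
    · have h9 : 2 * K * (indW M w + 1 + 1 - indW M w - 0) = 4 * K := by ring
      rw [hwb hE hb, h9] at hEE
      linarith
  · have hm' : ∃ w', (w', f) ∈ M := by
      by_contra hno
      rw [indF_of_not (not_exists.1 hno)] at d
      exact absurd d.2.2.1 (by norm_num)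
    obtain ⟨w', hw'⟩ := hm'
    have hmw' := hm hw'
    have hlw' := hl w'
    have hfle := hflt hw'
    rw [d.2.2.1, d.2.2.2] at hEE
    refine ⟨w', hw', Or.inl ?_⟩
    rcases hb with hb | ⟨hb0, hb⟩
    · have := hmul (R.gainW M w f + 2 - indW M w - 1) (by linarith)
      have : γ w ≤ 0 := by omega
      have : ¬ δ f ≤ 1 := fun h => by linarith
      omega
    · have h9 : 2 * K * (indW M w + 1 + 2 - indW M w - 1) = 4 * K := by ring
      rw [hwb hE hb, h9] at hEE
      have h10 : ¬ δ f ≤ 1 := fun h => by linarith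
      have h11 : ¬ γ w ≤ 0 := fun h => by linarith
      omega
  · obtain ⟨w', hw', hlt⟩ := d.2.1
    have hmw' := hm hw'
    have hlw' := hl w'
    rw [d.2.2.1, d.2.2.2] at hEE
    refine ⟨w', hw', ?_⟩
    rcases hb with hb | ⟨hb0, hb⟩
    · omega
    · have h9 : 2 * K * (indW M w + 1 + 0 - indW M w - 1) = 0 := by ring
      rw [hwb hE hb, h9] at hEE
      omega

end Pref

/-! ## Popularity margins as gains -/

section Vote

variable {X : Type*} [DecidableEq X]

/-- An agent with preference list `l` prefers the set `S` of partners over the set `S'`. -/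
def PrefersSet (l : List X) (S S' : X → Prop) : Prop :=
  ∃ y, S y ∧ ((∀ y', ¬ S' y') ∨ ∃ y', S' y' ∧ RankedAbove l y y')

theorem PrefersSet.asymm {l : List X} {S S' : X → Prop} (hS : ∀ x y, S x → S y → x = y)
    (hS' : ∀ x y, S' x → S' y → x = y) (h : PrefersSet l S S') : ¬ PrefersSet l S' S := by
  rintro ⟨y, hy, h1⟩
  obtain ⟨x, hx, h2⟩ := h
  rcases h1 with h1 | ⟨x', hx', h1⟩
  · exact h1 x hx
  rcases h2 with h2 | ⟨y', hy', h2⟩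
  · exact h2 y hy
  obtain rfl := hS x x' hx hx'
  obtain rfl := hS' y y' hy hy'
  have := h1.2.2
  have := h2.2.2
  omega

-- If the partner in `S'` is `x`, the gain of `x` is the indicator plus the vote for `x`. If `S'` is
-- empty, the sum vanishes, and the vote for `S` is the indicator.
open Classical in
theorem vote_eq_gain [Fintype X] {l : List X} {S S' : X → Prop} (hS : ∀ x y, S x → S y → x = y)
    (hS' : ∀ x y, S' x → S' y → x = y) (hl : ∀ x, S x → x ∈ l) (hl' : ∀ x, S' x → x ∈ l) :
    (if PrefersSet l S S' then 1 else if PrefersSet l S' S then -1 else 0 : ℤ) =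
      matchedInd S - ∑ x, if S' x then rankGain (fun y => l.idxOf y) S x else 0 := by
  by_cases h' : ∃ x, S' x
  · obtain ⟨x, hx⟩ := h'
    have hsum : ∑ y, (if S' y then rankGain (fun y => l.idxOf y) S y else 0) =
        rankGain (fun y => l.idxOf y) S x := by
      rw [Finset.sum_eq_single x]
      · simp [hx]
      · intro y _ hne
        rw [if_neg fun hy => hne (hS' y x hy hx)]
      · simp
    rw [hsum]
    rcases rankGain_cases (r := fun y => l.idxOf y) hS (x := x)
      (fun y hy h => (List.idxOf_inj (hl' x hx)).1 h) with c | c | c | c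
    · have h1 : ¬ PrefersSet l S S' := by
        rintro ⟨y, hy, h | ⟨y', hy', h⟩⟩
        · exact h x hx
        · obtain rfl := hS y x hy c.1
          obtain rfl := hS' y y' hx hy'
          exact absurd h.2.2 (lt_irrefl _)
      have h2 : ¬ PrefersSet l S' S := by
        rintro ⟨y, hy, h | ⟨y', hy', h⟩⟩
        · exact h x c.1
        · obtain rfl := hS' y x hy hx
          obtain rfl := hS y y' c.1 hy'
          exact absurd h.2.2 (lt_irrefl _)
      rw [if_neg h1, if_neg h2, c.2.1, c.2.2]; norm_num
    · have h1 : ¬ PrefersSet l S S' := fun ⟨y, hy, _⟩ => c.2.1 y hy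
      have h2 : PrefersSet l S' S := ⟨x, hx, Or.inl c.2.1⟩
      rw [if_neg h1, if_pos h2, c.2.2.1, c.2.2.2]; norm_num
    · have hex : ∃ y, S y := by
        by_contra hno
        have := c.2.2.1
        simp [matchedInd, hno] at this
      obtain ⟨y, hy⟩ := hex
      have h2 : PrefersSet l S' S :=
        ⟨x, hx, Or.inr ⟨y, hy, hl' x hx, hl y hy, c.2.1 y hy⟩⟩
      rw [if_neg (h2.asymm hS' hS), if_pos h2, c.2.2.1, c.2.2.2]; norm_num
    · obtain ⟨y, hy, hlt⟩ := c.2.1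
      have h1 : PrefersSet l S S' := ⟨y, hy, Or.inr ⟨x, hx, hl y hy, hl' x hx, hlt⟩⟩
      rw [if_pos h1, c.2.2.1, c.2.2.2]; norm_num
  · have hn : ∀ x, ¬ S' x := not_exists.1 h'
    have h2 : ¬ PrefersSet l S' S := fun ⟨y, hy, _⟩ => hn y hy
    have h1 : PrefersSet l S S' ↔ ∃ y, S y :=
      ⟨fun ⟨y, hy, _⟩ => ⟨y, hy⟩, fun ⟨y, hy⟩ => ⟨y, hy, Or.inl hn⟩⟩
    simp [h1, h2, hn, matchedInd]

end Vote

namespace MatP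

variable {W F : Type*} [DecidableEq W] [DecidableEq F] (I : MatP W F)

/-- The ranks given by the preference lists. -/
def pref : Pref W F where
  E := I.Edge
  rw w f := (I.worker w).idxOf f
  rf f w := (I.firm f).idxOf w
  rw_inj h _ he := (List.idxOf_inj h).1 he
  rf_inj h _ he := (List.idxOf_inj ((I.mem_worker_iff _ _).1 h)).1 he

variable [Fintype W] [Fintype F] {I} {M M' : Finset (W × F)}

/-- Votes are summed over agents, and the gains are then regrouped by the edges of `M'`; the
indicators of both sides add up to `2 * |M|`. -/
theorem margin_eq (hM : I.IsMatching M) (hM' : I.IsMatching M') :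
    I.margin M M' = 2 * M.card - ∑ e ∈ M', I.pref.gain M e.1 e.2 := by
  classical
  have hN : IsMatchingOf I.Edge M := hM
  have hN' : IsMatchingOf I.Edge M' := hM'
  have hw : ∀ w, I.vote (.inl w) M M' =
      Pref.indW M w - ∑ f, if (w, f) ∈ M' then I.pref.gainW M w f else 0 := fun w => by
    convert vote_eq_gain (l := I.worker w) (fun _ _ h h' => hN.firm_unique h h')
      (fun _ _ h h' => hN'.firm_unique h h') (fun _ h => hN.edge h) (fun _ h => hN'.edge h) <;> rfl
  have hf : ∀ f, I.vote (.inr f) M M' =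
      Pref.indF M f - ∑ w, if (w, f) ∈ M' then I.pref.gainF M w f else 0 := fun f => by
    convert vote_eq_gain (l := I.firm f) (fun _ _ h h' => hN.worker_unique h h')
      (fun _ _ h h' => hN'.worker_unique h h')
      (fun _ h => (I.mem_worker_iff _ _).1 (hN.edge h))
      (fun _ h => (I.mem_worker_iff _ _).1 (hN'.edge h)) <;> rfl
  have h1 : ∑ w, Pref.indW M w = M.card := by
    rw [← Pref.sum_fst_eq hN _ fun w => Pref.indW_of_not,
      Finset.sum_congr rfl fun e he => Pref.indW_of_mem (w := e.1) (f := e.2) he]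
    simp
  have h2 : ∑ f, Pref.indF M f = M.card := by
    rw [← Pref.sum_snd_eq hN _ fun w => Pref.indF_of_not,
      Finset.sum_congr rfl fun e he => Pref.indF_of_mem (w := e.1) (f := e.2) he]
    simp
  have h3 : ∑ w, ∑ f, (if (w, f) ∈ M' then I.pref.gainW M w f else 0) =
      ∑ e ∈ M', I.pref.gainW M e.1 e.2 := by
    rw [← Fintype.sum_prod_type' (f := fun w f => if (w, f) ∈ M' then I.pref.gainW M w f else 0)]
    simp
  have h4 : ∑ f, ∑ w, (if (w, f) ∈ M' then I.pref.gainF M w f else 0) =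
      ∑ e ∈ M', I.pref.gainF M e.1 e.2 := by
    rw [← Fintype.sum_prod_type_right'
      (f := fun w f => if (w, f) ∈ M' then I.pref.gainF M w f else 0)]
    simp
  unfold margin
  rw [Fintype.sum_sum_type, Finset.sum_congr rfl fun w _ => hw w,
    Finset.sum_congr rfl fun f _ => hf f, Finset.sum_sub_distrib, Finset.sum_sub_distrib, h1, h2,
    h3, h4]
  simp only [Pref.gain, Finset.sum_add_distrib]
  ring

theorem margin_antisymm (hM : I.IsMatching M) (hM' : I.IsMatching M') :
    I.margin M M' = - I.margin M' M := by
  classical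
  have hN : IsMatchingOf I.Edge M := hM
  have hN' : IsMatchingOf I.Edge M' := hM'
  unfold margin
  rw [← Finset.sum_neg_distrib]
  refine Finset.sum_congr rfl fun x _ => ?_
  have hasymm : I.Prefers x M M' → ¬ I.Prefers x M' M := by
    rcases x with w | f
    · exact PrefersSet.asymm (l := I.worker w) (fun _ _ h h' => hN.firm_unique h h')
        (fun _ _ h h' => hN'.firm_unique h h')
    · exact PrefersSet.asymm (l := I.firm f) (fun _ _ h h' => hN.worker_unique h h')
        (fun _ _ h h' => hN'.worker_unique h h')
  unfold vote
  by_cases h1 : I.Prefers x M M'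
  · simp [h1, hasymm h1]
  · by_cases h2 : I.Prefers x M' M <;> simp [h1, h2]

theorem isPopular_iff : I.IsPopular M ↔ I.pref.IsPop M := by
  refine and_congr_right fun hM => forall₂_congr fun M' hM' => ?_
  rw [margin_eq hM hM']
  constructor <;> intro h <;> linarith

theorem isDominant_iff : I.IsDominant M ↔ I.pref.IsDom M := by
  unfold IsDominant Pref.IsDom
  rw [isPopular_iff]
  refine and_congr_right fun hM => forall₃_congr fun M' hM' _ => ?_
  rw [margin_eq hM.1 hM']
  constructor <;> intro h <;> linarith

/-- The popularity of `N` is read from the side of `M`, by antisymmetry of the margin, so that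
certificates of `M` can be applied to `N`. -/
theorem le_sum_gain {N : Finset (W × F)} (hN : I.pref.IsPop N) (hM : I.IsMatching M) :
    2 * (M.card : ℤ) ≤ ∑ e ∈ N, I.pref.gain M e.1 e.2 := by
  have h1 := margin_eq hM hN.1
  rw [margin_antisymm hM hN.1, margin_eq hN.1 hM] at h1
  have := hN.2 M hM
  linarith

/-- Agents unmatched in a popular matching are unmatched in stable matchings. -/
theorem unmatched_of_isPop {N : Finset (W × F)} {l : W → ℕ} (hN : I.pref.IsPop N)
    (hM : I.pref.LStable 1 M l) :
    (∀ w, (∀ f, (w, f) ∉ N) → ∀ f, (w, f) ∉ M) ∧ ∀ f, (∀ w, (w, f) ∉ N) → ∀ w, (w, f) ∉ M := by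
  classical
  have hc := hM.certificate
  have h1 : 2 * (M.card : ℤ) ≤ ∑ e ∈ N, (Pref.indW M e.1 + Pref.indF M e.2) :=
    (le_sum_gain hN hM.matching).trans
      (Finset.sum_le_sum fun e he => hc.gain_le (hN.1.edge he))
  have hw : ∑ w, Pref.indW M w = M.card := by
    rw [← Pref.sum_fst_eq hM.matching _ fun w => Pref.indW_of_not,
      Finset.sum_congr rfl fun e he => Pref.indW_of_mem (w := e.1) (f := e.2) he]
    simp
  have hf : ∑ f, Pref.indF M f = M.card := by
    rw [← Pref.sum_snd_eq hM.matching _ fun w => Pref.indF_of_not,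
      Finset.sum_congr rfl fun e he => Pref.indF_of_mem (w := e.1) (f := e.2) he]
    simp
  have hw1 := Pref.sum_fst_le hN.1 _ hc.nonneg_worker
  have hf1 := Pref.sum_snd_le hN.1 _ hc.nonneg_firm
  rw [Finset.sum_add_distrib] at h1
  constructor
  · intro w₀ h0 f₀ hm
    -- Replacing the value of `w₀` by 0 does not affect the sum over `N` but lowers the total by 1.
    -- So `N` would collect at most `2 * |M| - 1`, against `h1`. The firms are treated in the same
    -- way.
    have h2 : ∑ e ∈ N, Pref.indW M e.1 = ∑ e ∈ N, if e.1 = w₀ then 0 else Pref.indW M e.1 := by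
      refine Finset.sum_congr rfl fun e he => ?_
      rw [if_neg]
      rintro rfl
      exact h0 e.2 he
    have h3 := Pref.sum_fst_le hN.1 (fun w => if w = w₀ then 0 else Pref.indW M w)
      (fun w => by split_ifs; exacts [le_rfl, hc.nonneg_worker w])
    have h4 : ∑ w, (if w = w₀ then 0 else Pref.indW M w) = ∑ w, Pref.indW M w - 1 := by
      rw [← Finset.add_sum_erase _ _ (Finset.mem_univ w₀),
        ← Finset.add_sum_erase _ _ (Finset.mem_univ w₀), Pref.indW_of_mem hm, if_pos rfl,
        Finset.sum_congr rfl fun w hw => if_neg (Finset.ne_of_mem_erase hw)]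
      ring
    linarith
  · intro f₀ h0 w₀ hm
    have h2 : ∑ e ∈ N, Pref.indF M e.2 = ∑ e ∈ N, if e.2 = f₀ then 0 else Pref.indF M e.2 := by
      refine Finset.sum_congr rfl fun e he => ?_
      rw [if_neg]
      rintro rfl
      exact h0 e.1 he
    have h3 := Pref.sum_snd_le hN.1 (fun f => if f = f₀ then 0 else Pref.indF M f)
      (fun f => by split_ifs; exacts [le_rfl, hc.nonneg_firm f])
    have h4 : ∑ f, (if f = f₀ then 0 else Pref.indF M f) = ∑ f, Pref.indF M f - 1 := by
      rw [← Finset.add_sum_erase _ _ (Finset.mem_univ f₀),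
        ← Finset.add_sum_erase _ _ (Finset.mem_univ f₀), Pref.indF_of_mem hm, if_pos rfl,
        Finset.sum_congr rfl fun f hf => if_neg (Finset.ne_of_mem_erase hf)]
      ring
    linarith

/-- Dominant matchings and matchings that are stable with two levels match the same agents. -/
theorem unmatched_of_isDom {N : Finset (W × F)} {l : W → ℕ} (hN : I.pref.IsDom N)
    (hM : I.pref.LStable 2 M l) :
    (∀ w, (∀ f, (w, f) ∉ N) → ∀ f, (w, f) ∉ M) ∧ ∀ f, (∀ w, (w, f) ∉ N) → ∀ w, (w, f) ∉ M := by
  have h1 := le_sum_gain hN.1 hM.matching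
  -- An edge of `N` with an end unmatched in `M` makes the gain of `N` smaller than `2 * |M|`,
  -- against `h1`. So `N` covers only agents covered by `M`; dominance of `N` excludes that `M` is
  -- larger, and equal sizes make the covered sets equal.
  have hmem : ∀ w f, (w, f) ∈ N → (∃ f', (w, f') ∈ M) ∧ ∃ w', (w', f) ∈ M := by
    intro w f hwf
    by_contra hno
    have := hM.sum_gain_lt hN.1.1 hwf (by
      rw [not_and_or, not_exists, not_exists] at hno; exact hno)
    linarith
  have hle : N.card ≤ M.card := Pref.card_le_of_matched hN.1.1 fun w f h => (hmem w f h).1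
  have hge : M.card ≤ N.card := by
    by_contra hlt
    have h2 := hN.2 M hM.matching (by omega)
    have h3 := le_sum_gain hM.isDom.1 hN.1.1
    linarith
  have hinj : ∀ {K : Finset (W × F)}, IsMatchingOf I.Edge K →
      (K.image Prod.fst).card = K.card ∧ (K.image Prod.snd).card = K.card := by
    intro K hK
    constructor <;> refine Finset.card_image_of_injOn fun e he e' he' heq => ?_ <;>
      by_contra hne
    · exact (hK.2 e he e' he' hne).1 heq
    · exact (hK.2 e he e' he' hne).2 heq
  have hM1 := hinj hM.matching
  have hN1 := hinj hN.1.1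
  have e1 : N.image Prod.fst = M.image Prod.fst := by
    refine Finset.eq_of_subset_of_card_le (fun w hw => ?_) (by omega)
    obtain ⟨⟨w, f⟩, hf, rfl⟩ := Finset.mem_image.1 hw
    obtain ⟨f', h⟩ := (hmem w f hf).1
    exact Finset.mem_image.2 ⟨_, h, rfl⟩
  have e2 : N.image Prod.snd = M.image Prod.snd := by
    refine Finset.eq_of_subset_of_card_le (fun w hw => ?_) (by omega)
    obtain ⟨⟨w, f⟩, hf, rfl⟩ := Finset.mem_image.1 hw
    obtain ⟨f', h⟩ := (hmem w f hf).2
    exact Finset.mem_image.2 ⟨_, h, rfl⟩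
  constructor
  · intro w h0 f hf
    have : w ∈ N.image Prod.fst := e1 ▸ Finset.mem_image.2 ⟨_, hf, rfl⟩
    obtain ⟨⟨w, f'⟩, hf', rfl⟩ := Finset.mem_image.1 this
    exact h0 f' hf'
  · intro f h0 w hw
    have : f ∈ N.image Prod.snd := e2 ▸ Finset.mem_image.2 ⟨_, hw, rfl⟩
    obtain ⟨⟨w', f⟩, hw', rfl⟩ := Finset.mem_image.1 this
    exact h0 w' hw'

end MatP

/-! ## Hybrid preferences -/

namespace Pref

variable {W F : Type*} {A B H : Pref W F} {M : Finset (W × F)}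

/-- In `H`, a neighbour of an agent matched in `M` is above its partner iff this is the case in
`A` or in `B`. -/
structure IsHybrid (A B H : Pref W F) (M : Finset (W × F)) : Prop where
  edge_left : H.E = A.E
  edge_right : H.E = B.E
  worker : ∀ {w f z}, (w, f) ∈ M → H.E w z →
    (H.rw w z < H.rw w f ↔ A.rw w z < A.rw w f ∨ B.rw w z < B.rw w f)
  firm : ∀ {w f z}, (w, f) ∈ M → H.E z f →
    (H.rf f z < H.rf f w ↔ A.rf f z < A.rf f w ∨ B.rf f z < B.rf f w)

/-- For a matched agent only the comparison with the partner enters, and the hypothesis makes it the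
disjunction of two comparisons; otherwise the gain is 1 for all ranks. -/
theorem rankGain_eq_max {X : Type*} {a b h : X → ℕ} {S : X → Prop} {x : X}
    (hS : ∀ x y, S x → S y → x = y)
    (H : ∀ y, S y → (h x < h y ↔ a x < a y ∨ b x < b y)) :
    rankGain h S x = max (rankGain a S x) (rankGain b S x) := by
  unfold rankGain
  by_cases hx : S x
  · simp [hx]
  by_cases hy : ∃ y, S y
  · obtain ⟨y, hy'⟩ := id hy
    have hiff : ∀ r : X → ℕ, (∃ y, S y ∧ r x < r y) ↔ r x < r y := fun r =>
      ⟨fun ⟨z, hz, hlt⟩ => hS z y hz hy' ▸ hlt, fun hlt => ⟨y, hy', hlt⟩⟩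
    simp only [hx, hy, hiff, H y hy']
    by_cases h1 : a x < a y <;> by_cases h2 : b x < b y <;> simp [h1, h2]
  · simp [hx, hy]

theorem IsHybrid.gainW_eq (h : IsHybrid A B H M) (hM : IsMatchingOf H.E M) {w : W} {f : F}
    (hE : H.E w f) : H.gainW M w f = max (A.gainW M w f) (B.gainW M w f) :=
  rankGain_eq_max (fun _ _ h h' => hM.firm_unique h h') fun _ hy => h.worker hy hE

theorem IsHybrid.gainF_eq (h : IsHybrid A B H M) (hM : IsMatchingOf H.E M) {w : W} {f : F}
    (hE : H.E w f) : H.gainF M w f = max (A.gainF M w f) (B.gainF M w f) :=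
  rankGain_eq_max (fun _ _ h h' => hM.worker_unique h h') fun _ hy => h.firm hy hE

theorem IsHybrid.gain_le (h : IsHybrid A B H M) (hM : IsMatchingOf H.E M) {w : W} {f : F}
    (hE : H.E w f) : A.gain M w f ≤ H.gain M w f ∧ B.gain M w f ≤ H.gain M w f := by
  unfold gain
  rw [h.gainW_eq hM hE, h.gainF_eq hM hE]
  exact ⟨add_le_add (le_max_left _ _) (le_max_left _ _),
    add_le_add (le_max_right _ _) (le_max_right _ _)⟩

/-- Gains in the hybrid dominate both, so the bound on the gain of every competitor is inherited. -/
theorem IsHybrid.isPop (h : IsHybrid A B H M) (hp : H.IsPop M) : A.IsPop M ∧ B.IsPop M := by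
  obtain ⟨hM, hp⟩ := hp
  refine ⟨⟨h.edge_left ▸ hM, fun N hN => ?_⟩, ⟨h.edge_right ▸ hM, fun N hN => ?_⟩⟩
  · rw [← h.edge_left] at hN
    exact (Finset.sum_le_sum fun e he => (h.gain_le hM (hN.edge he)).1).trans (hp N hN)
  · rw [← h.edge_right] at hN
    exact (Finset.sum_le_sum fun e he => (h.gain_le hM (hN.edge he)).2).trans (hp N hN)

theorem IsHybrid.isDom (h : IsHybrid A B H M) (hp : H.IsDom M) : A.IsDom M ∧ B.IsDom M := by
  obtain ⟨hp, hd⟩ := hp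
  have hM := hp.1
  obtain ⟨h1, h2⟩ := h.isPop hp
  refine ⟨⟨h1, fun N hN hc => ?_⟩, ⟨h2, fun N hN hc => ?_⟩⟩
  · rw [← h.edge_left] at hN
    exact (Finset.sum_le_sum fun e he => (h.gain_le hM (hN.edge he)).1).trans_lt (hd N hN hc)
  · rw [← h.edge_right] at hN
    exact (Finset.sum_le_sum fun e he => (h.gain_le hM (hN.edge he)).2).trans_lt (hd N hN hc)

/-- If at most one agent has different preferences, then the gains of the edges of a matching
agree with those in one of the two instances. -/
theorem IsHybrid.gain_eq (h : IsHybrid A B H M) (hM : IsMatchingOf H.E M) {D : W ⊕ F → Prop}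
    (hD : {x | D x}.Subsingleton) (hDw : ∀ w, ¬ D (.inl w) → A.rw w = B.rw w)
    (hDf : ∀ f, ¬ D (.inr f) → A.rf f = B.rf f) {N : Finset (W × F)} (hN : IsMatchingOf H.E N) :
    (∀ e ∈ N, H.gain M e.1 e.2 = A.gain M e.1 e.2) ∨
      ∀ e ∈ N, H.gain M e.1 e.2 = B.gain M e.1 e.2 := by
  by_contra! hno
  -- The first edge has an end at which `B` gains more than `A`, the second one an end at which `A`
  -- gains more than `B`. Both ends are the differing agent, which has only one edge in `N`; the two
  -- strict inequalities then contradict each other.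
  obtain ⟨⟨⟨w, f⟩, he, h1⟩, ⟨w', f'⟩, he', h2⟩ := hno
  simp only [gain] at h1 h2
  rw [h.gainW_eq hM (hN.edge he), h.gainF_eq hM (hN.edge he)] at h1
  rw [h.gainW_eq hM (hN.edge he'), h.gainF_eq hM (hN.edge he')] at h2
  have hw : ∀ w f, A.gainW M w f ≠ B.gainW M w f → D (.inl w) := fun w f hne => by
    by_contra hn
    exact hne (by simp only [gainW, hDw w hn])
  have hf : ∀ w f, A.gainF M w f ≠ B.gainF M w f → D (.inr f) := fun w f hne => by
    by_contra hn
    exact hne (by simp only [gainF, hDf f hn])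
  have c1 : A.gainW M w f < B.gainW M w f ∨ A.gainF M w f < B.gainF M w f := by
    by_contra! hno
    rw [max_eq_left hno.1, max_eq_left hno.2] at h1
    exact h1 rfl
  have c2 : B.gainW M w' f' < A.gainW M w' f' ∨ B.gainF M w' f' < A.gainF M w' f' := by
    by_contra! hno
    rw [max_eq_right hno.1, max_eq_right hno.2] at h2
    exact h2 rfl
  rcases c1 with c1 | c1 <;> rcases c2 with c2 | c2
  · obtain rfl : w = w' := Sum.inl_injective (hD (hw w f c1.ne) (hw w' f' c2.ne'))
    obtain rfl := hN.firm_unique he he'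
    exact lt_asymm c1 c2
  · exact Sum.inl_ne_inr (hD (hw w f c1.ne) (hf w' f' c2.ne'))
  · exact Sum.inr_ne_inl (hD (hf w f c1.ne) (hw w' f' c2.ne'))
  · obtain rfl : f = f' := Sum.inr_injective (hD (hf w f c1.ne) (hf w' f' c2.ne'))
    obtain rfl := hN.worker_unique he he'
    exact lt_asymm c1 c2

/-- Against a single competitor the hybrid behaves like one of the two instances, although which one
depends on the competitor. -/
theorem IsHybrid.isPop_of (h : IsHybrid A B H M) {D : W ⊕ F → Prop}
    (hD : {x | D x}.Subsingleton) (hDw : ∀ w, ¬ D (.inl w) → A.rw w = B.rw w)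
    (hDf : ∀ f, ¬ D (.inr f) → A.rf f = B.rf f) (hA : A.IsPop M) (hB : B.IsPop M) :
    H.IsPop M := by
  have hM : IsMatchingOf H.E M := h.edge_left ▸ hA.1
  refine ⟨hM, fun N hN => ?_⟩
  rcases h.gain_eq hM hD hDw hDf hN with he | he <;> rw [Finset.sum_congr rfl he]
  · exact hA.2 N (h.edge_left ▸ hN)
  · exact hB.2 N (h.edge_right ▸ hN)

theorem IsHybrid.isDom_of (h : IsHybrid A B H M) {D : W ⊕ F → Prop}
    (hD : {x | D x}.Subsingleton) (hDw : ∀ w, ¬ D (.inl w) → A.rw w = B.rw w)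
    (hDf : ∀ f, ¬ D (.inr f) → A.rf f = B.rf f) (hA : A.IsDom M) (hB : B.IsDom M) :
    H.IsDom M := by
  refine ⟨h.isPop_of hD hDw hDf hA.1 hB.1, fun N hN hc => ?_⟩
  rcases h.gain_eq (h.edge_left ▸ hA.1.1) hD hDw hDf hN with he | he <;>
    rw [Finset.sum_congr rfl he]
  · exact hA.2 N (h.edge_left ▸ hN) hc
  · exact hB.2 N (h.edge_right ▸ hN) hc

end Pref

/-! ## A calculus of functions computable in polynomial time -/

namespace RAM

/-- Functions bounded by a polynomial. -/
def PolyBdd (b : ℕ → ℕ) : Prop := ∃ q : Polynomial ℕ, ∀ n, b n ≤ q.eval n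

theorem PolyBdd.const (c : ℕ) : PolyBdd fun _ => c := ⟨Polynomial.C c, fun n => by simp⟩

theorem PolyBdd.id : PolyBdd fun n => n := ⟨Polynomial.X, fun n => by simp⟩

theorem PolyBdd.add {b c : ℕ → ℕ} (hb : PolyBdd b) (hc : PolyBdd c) :
    PolyBdd fun n => b n + c n := by
  obtain ⟨p, hp⟩ := hb
  obtain ⟨q, hq⟩ := hc
  exact ⟨p + q, fun n => by simpa using add_le_add (hp n) (hq n)⟩

theorem PolyBdd.mul {b c : ℕ → ℕ} (hb : PolyBdd b) (hc : PolyBdd c) :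
    PolyBdd fun n => b n * c n := by
  obtain ⟨p, hp⟩ := hb
  obtain ⟨q, hq⟩ := hc
  exact ⟨p * q, fun n => by simpa using Nat.mul_le_mul (hp n) (hq n)⟩

/-- The test counts the remaining iterations, so the body runs exactly `N` times; the factor `N + 1`
includes the failing last test. -/
theorem exec_loop {x : Expr} {body : Prog} {N T : ℕ} {Inv : ℕ → Store → Prop}
    (hval : ∀ i s, Inv i s → x.eval s = N - i)
    (hbody : ∀ i s, i < N → Inv i s → ∃ t s', Exec body s t s' ∧ t ≤ T ∧ Inv (i + 1) s')
    {s : Store} (h0 : Inv 0 s) :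
    ∃ t s', Exec (.loop x body) s t s' ∧ t ≤ (N + 1) * (x.cost + 1 + T) ∧ Inv N s' := by
  have key : ∀ j i s, i + j = N → Inv i s → ∃ t s', Exec (.loop x body) s t s' ∧
      t ≤ (j + 1) * (x.cost + 1 + T) ∧ Inv N s' := by
    intro j
    induction j with
    | zero =>
      intro i s hi h
      obtain rfl : i = N := by omega
      refine ⟨_, s, .loop_done (by rw [hval i s h]; omega), by omega, h⟩
    | succ j ih =>
      intro i s hi h
      obtain ⟨t, s', h1, h2, h3⟩ := hbody i s (by omega) h
      obtain ⟨t', s'', h4, h5, h6⟩ := ih (i + 1) s' (by omega) h3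
      refine ⟨_, s'', .loop_step (by rw [hval i s h]; omega) h1 h4, ?_, h6⟩
      have : (j + 1 + 1) * (x.cost + 1 + T) = (j + 1) * (x.cost + 1 + T) + (x.cost + 1 + T) := by
        ring
      omega
  exact key N 0 s (by omega) h0

/-- The stores agree on the first `k` registers and the first `l` arrays. -/
def Same (k l : ℕ) (s s' : Store) : Prop :=
  (∀ x < k, s'.reg x = s.reg x) ∧ ∀ a < l, s'.arr a = s.arr a

theorem Same.trans {k l k' l' : ℕ} {s s' s'' : Store} (h : Same k l s s')
    (h' : Same k' l' s' s'') (hk : k ≤ k' := by omega) (hl : l ≤ l' := by omega) :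
    Same k l s s'' :=
  ⟨fun x hx => (h'.1 x (by omega)).trans (h.1 x hx), fun a ha =>
    (h'.2 a (by omega)).trans (h.2 a ha)⟩

theorem Same.mono {k l k' l' : ℕ} {s s' : Store} (h : Same k' l' s s') (hk : k ≤ k' := by omega)
    (hl : l ≤ l' := by omega) : Same k l s s' :=
  ⟨fun x hx => h.1 x (by omega), fun a ha => h.2 a (by omega)⟩

theorem same_update_reg {k l x v : ℕ} {s : Store} (hx : k ≤ x := by omega) :
    Same k l s { s with reg := Function.update s.reg x v } :=
  ⟨fun y hy => Function.update_of_ne (by omega) _ _, fun _ _ => rfl⟩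

theorem same_update_arr {k l a : ℕ} {v : ℕ → ℕ} {s : Store} (ha : l ≤ a := by omega) :
    Same k l s { s with arr := Function.update s.arr a v } :=
  ⟨fun _ _ => rfl, fun y hy => Function.update_of_ne (by omega) _ _⟩

/-- A representation of the values in `E` by the first `k` registers and the first `l` arrays. -/
structure Layout (E : Type) where
  k : ℕ
  l : ℕ
  pos_k : 0 < k
  pos_l : 0 < l
  rel : E → Store → Prop
  rel_of_same : ∀ {e s s'}, Same k l s s' → rel e s → rel e s'

/-- The number of iterations of all loops on an input word. -/
def loopBound (n : ℕ) : ℕ := 8 * n * n + 8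

/-- A context: values that depend on an input word, with their representations. -/
structure Ctx (E : Type) where
  word : E → List ℕ
  lay : Layout E → Prop
  reg_zero : ∀ {π e s}, lay π → π.rel e s → s.reg 0 = loopBound (word e).length
  arr_zero : ∀ {π e s}, lay π → π.rel e s → s.arr 0 = fun i => (word e).getD i 0

/-- The number of iterations of all loops. -/
def Ctx.size {E : Type} (Λ : Ctx E) (e : E) : ℕ := loopBound (Λ.word e).length

/-- A representation in which register `r` holds an additional number. -/
def Layout.withVar {E : Type} (π : Layout E) (r : ℕ) (hr : π.k ≤ r) : Layout (E × ℕ) where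
  k := r + 1
  l := π.l
  pos_k := Nat.succ_pos r
  pos_l := π.pos_l
  rel e s := π.rel e.1 s ∧ s.reg r = e.2
  rel_of_same h h' := ⟨π.rel_of_same h.mono h'.1, (h.1 r (Nat.lt_succ_self r)).trans h'.2⟩

/-- A representation in which array `a` holds an additional table. -/
def Layout.withTab {E : Type} (π : Layout E) (a : ℕ) (ha : π.l ≤ a) : Layout (E × (ℕ → ℕ)) where
  k := π.k
  l := a + 1
  pos_k := π.pos_k
  pos_l := Nat.succ_pos a
  rel e s := π.rel e.1 s ∧ ∀ i < s.reg 0, s.arr a i = e.2 i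
  rel_of_same h h' := ⟨π.rel_of_same h.mono h'.1, fun i hi => by
    rw [h.2 a (Nat.lt_succ_self a)]
    exact h'.2 i (by rwa [h.1 0 π.pos_k] at hi)⟩

/-- The context extended by a number. -/
def Ctx.var {E : Type} (Λ : Ctx E) : Ctx (E × ℕ) where
  word e := Λ.word e.1
  lay π' := ∃ π r, ∃ hr : π.k ≤ r, Λ.lay π ∧ π' = π.withVar r hr
  reg_zero := by
    rintro _ e s ⟨π, r, hr, h, rfl⟩ h'
    exact Λ.reg_zero h h'.1
  arr_zero := by
    rintro _ e s ⟨π, r, hr, h, rfl⟩ h'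
    exact Λ.arr_zero h h'.1

/-- The context extended by a table. -/
def Ctx.tab {E : Type} (Λ : Ctx E) : Ctx (E × (ℕ → ℕ)) where
  word e := Λ.word e.1
  lay π' := ∃ π a, ∃ ha : π.l ≤ a, Λ.lay π ∧ π' = π.withTab a ha
  reg_zero := by
    rintro _ e s ⟨π, a, ha, h, rfl⟩ h'
    exact Λ.reg_zero h h'.1
  arr_zero := by
    rintro _ e s ⟨π, a, ha, h, rfl⟩ h'
    exact Λ.arr_zero h h'.1

/-- The function `f` is computed in polynomial time from any representation of its argument,
and the computation leaves the store unchanged up to scratch space. -/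
def C {E : Type} (Λ : Ctx E) (f : E → ℕ) : Prop :=
  ∀ π, Λ.lay π → ∀ k l, π.k ≤ k → π.l ≤ l → ∃ (p : Prog) (b : ℕ → ℕ), PolyBdd b ∧
    ∀ e s, π.rel e s → ∃ t s', Exec p s t s' ∧ t ≤ b (Λ.size e) ∧ s'.reg k = f e ∧ Same k l s s'

open Classical in
/-- The predicate `p` is decided in polynomial time. -/
def CP {E : Type} (Λ : Ctx E) (p : E → Prop) : Prop := C Λ fun e => if p e then 1 else 0

/-- The tables `τ e` are part of the representations. -/
def HasTab {E : Type} (Λ : Ctx E) (τ : E → ℕ → ℕ) : Prop :=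
  ∀ π, Λ.lay π → ∃ a < π.l, ∀ e s, π.rel e s → ∀ i < s.reg 0, s.arr a i = τ e i

variable {E : Type} {Λ : Ctx E} {f g : E → ℕ}

/-- Functions whose values can be assigned to a register by an expression. -/
theorem C.of_expr (h : ∀ π, Λ.lay π → ∃ x : Expr, ∀ e s, π.rel e s → x.eval s = f e) :
    C Λ f := by
  intro π hπ k l hk hl
  obtain ⟨x, hx⟩ := h π hπ
  refine ⟨.assign k x, _, .const (x.cost + 1), fun e s hr => ?_⟩
  exact ⟨_, _, .assign k x s, le_rfl, by simp [hx e s hr], same_update_reg⟩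

theorem C.congr (hf : C Λ f) (h : ∀ e, g e = f e) : C Λ g := (funext h : g = f) ▸ hf

theorem C.const (c : ℕ) : C Λ fun _ => c := C.of_expr fun _ _ => ⟨.const c, fun _ _ _ => rfl⟩

theorem C.size : C Λ Λ.size := C.of_expr fun _ h => ⟨.reg 0, fun _ _ h' => Λ.reg_zero h h'⟩

theorem C.last : C Λ.var fun e => e.2 := C.of_expr fun _ h => by
  obtain ⟨π, r, hr, h, rfl⟩ := h
  exact ⟨.reg r, fun _ _ h' => h'.2⟩

/-- Programs exist for any start of the scratch space, so it can be placed above the register of the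
new variable. -/
theorem C.weaken (hf : C Λ f) : C Λ.var fun e => f e.1 := by
  rintro _ ⟨π, r, hr, h, rfl⟩ k l hk hl
  obtain ⟨p, b, hb, H⟩ := hf π h k l (hr.trans (Nat.le_of_succ_le hk)) hl
  exact ⟨p, b, hb, fun e s h' => H e.1 s h'.1⟩

theorem C.weaken_tab (hf : C Λ f) : C Λ.tab fun e => f e.1 := by
  rintro _ ⟨π, a, ha, h, rfl⟩ k l hk hl
  obtain ⟨p, b, hb, H⟩ := hf π h k l hk (ha.trans (Nat.le_of_succ_le hl))
  exact ⟨p, b, hb, fun e s h' => H e.1 s h'.1⟩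

theorem HasTab.last : HasTab Λ.tab fun e => e.2 := by
  rintro _ ⟨π, a, ha, h, rfl⟩
  exact ⟨a, Nat.lt_succ_self a, fun e s h => h.2⟩

theorem HasTab.weaken {τ : E → ℕ → ℕ} (h : HasTab Λ τ) : HasTab Λ.var fun e => τ e.1 := by
  rintro _ ⟨π, r, hr, hπ, rfl⟩
  obtain ⟨a, ha, H⟩ := h π hπ
  exact ⟨a, ha, fun e s h => H e.1 s h.1⟩

/-- Applying an operation given by an expression in two registers. -/
theorem C.bin {op : ℕ → ℕ → ℕ} (hop : ∀ k, ∃ x : Expr, ∀ s, x.eval s = op (s.reg k)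
    (s.reg (k + 1))) (hf : C Λ f) (hg : C Λ g) : C Λ fun e => op (f e) (g e) := by
  intro π hπ k l hk hl
  obtain ⟨p, b, hb, hp⟩ := hf π hπ k l hk hl
  obtain ⟨q, c, hc, hq⟩ := hg π hπ (k + 1) l (by omega) hl
  obtain ⟨x, hx⟩ := hop k
  refine ⟨.seq p (.seq q (.assign k x)), _, hb.add (hc.add (.const (x.cost + 1))),
    fun e s h => ?_⟩
  obtain ⟨t, s₁, h1, h2, h3, h4⟩ := hp e s h
  obtain ⟨t', s₂, h5, h6, h7, h8⟩ := hq e s₁ (π.rel_of_same h4.mono h)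
  refine ⟨_, _, .seq h1 (.seq h5 (.assign k x s₂)), by omega, ?_,
    (h4.trans h8).trans (same_update_reg (k := k) (l := l))⟩
  simp [hx, h7, h8.1 k (Nat.lt_succ_self k), h3]

theorem C.add (hf : C Λ f) (hg : C Λ g) : C Λ fun e => f e + g e :=
  C.bin (op := (· + ·)) (fun k => ⟨.add (.reg k) (.reg (k + 1)), fun _ => rfl⟩) hf hg

theorem C.sub (hf : C Λ f) (hg : C Λ g) : C Λ fun e => f e - g e :=
  C.bin (op := (· - ·)) (fun k => ⟨.sub (.reg k) (.reg (k + 1)), fun _ => rfl⟩) hf hg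

theorem CP.lt (hf : C Λ f) (hg : C Λ g) : CP Λ fun e => f e < g e := by
  refine C.congr (C.bin (op := fun a b => if a < b then 1 else 0) (fun k =>
    ⟨.sub (.const 1) (.sub (.const 1) (.sub (.reg (k + 1)) (.reg k))), fun s => ?_⟩) hf hg) fun e => by
    dsimp only; split_ifs <;> rfl
  simp only [Expr.eval]; split_ifs <;> omega

theorem CP.le (hf : C Λ f) (hg : C Λ g) : CP Λ fun e => f e ≤ g e := by
  refine C.congr (C.bin (op := fun a b => if a ≤ b then 1 else 0) (fun k =>
    ⟨.sub (.const 1) (.sub (.reg k) (.reg (k + 1))), fun s => ?_⟩) hf hg) fun e => by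
    dsimp only; split_ifs <;> rfl
  simp only [Expr.eval]; split_ifs <;> omega

theorem CP.eq (hf : C Λ f) (hg : C Λ g) : CP Λ fun e => f e = g e := by
  refine C.congr (C.bin (op := fun a b => if a = b then 1 else 0) (fun k =>
    ⟨.sub (.const 1) (.add (.sub (.reg k) (.reg (k + 1))) (.sub (.reg (k + 1)) (.reg k))),
      fun s => ?_⟩) hf hg) fun e => by
    dsimp only; split_ifs <;> rfl
  simp only [Expr.eval]; split_ifs <;> omega

theorem C.ite {p : E → Prop} [∀ e, Decidable (p e)] (hp : CP Λ p) (hf : C Λ f) (hg : C Λ g) :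
    C Λ fun e => if p e then f e else g e := by
  intro π hπ k l hk hl
  obtain ⟨P, b, hb, hP⟩ := hp π hπ k l hk hl
  obtain ⟨Q, c, hc, hQ⟩ := hf π hπ k l hk hl
  obtain ⟨R, d, hd, hR⟩ := hg π hπ k l hk hl
  refine ⟨.seq P (.ite (.reg k) Q R), _, hb.add ((hc.add hd).add (.const 2)), fun e s h => ?_⟩
  obtain ⟨t, s₁, h1, h2, h3, h4⟩ := hP e s h
  have hr := π.rel_of_same (h4.mono hk hl) h
  by_cases hpe : p e
  · obtain ⟨t', s₂, h5, h6, h7, h8⟩ := hQ e s₁ hr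
    refine ⟨_, s₂, .seq h1 (.ite_true ?_ h5), ?_, by rw [h7]; exact (if_pos hpe).symm, h4.trans h8⟩
    · simp [Expr.eval, h3, hpe]
    · simp only [Expr.cost]; omega
  · obtain ⟨t', s₂, h5, h6, h7, h8⟩ := hR e s₁ hr
    refine ⟨_, s₂, .seq h1 (.ite_false ?_ h5), ?_, by rw [h7]; exact (if_neg hpe).symm, h4.trans h8⟩
    · simp [Expr.eval, h3, hpe]
    · simp only [Expr.cost]; omega

theorem CP.congr {p q : E → Prop} (hp : CP Λ p) (h : ∀ e, q e ↔ p e) : CP Λ q := by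
  have : q = p := funext fun e => propext (h e)
  exact this ▸ hp

theorem CP.and {p q : E → Prop} (hp : CP Λ p) (hq : CP Λ q) : CP Λ fun e => p e ∧ q e := by
  classical
  exact (C.ite hp hq (.const 0)).congr fun e => by by_cases p e <;> simp [*]

theorem CP.or {p q : E → Prop} (hp : CP Λ p) (hq : CP Λ q) : CP Λ fun e => p e ∨ q e := by
  classical
  exact (C.ite hp (.const 1) hq).congr fun e => by by_cases p e <;> simp [*]

theorem CP.not {p : E → Prop} (hp : CP Λ p) : CP Λ fun e => ¬ p e := by
  classical
  exact (C.ite hp (.const 0) (.const 1)).congr fun e => by by_cases p e <;> simp [*]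

theorem CP.imp {p q : E → Prop} (hp : CP Λ p) (hq : CP Λ q) : CP Λ fun e => p e → q e :=
  (hp.not.or hq).congr fun _ => imp_iff_not_or

/-- Primitive recursion over all numbers below the loop bound. -/
theorem C.natRec {g : E → ℕ → ℕ → ℕ} (hf : C Λ f)
    (hg : C Λ.var.var fun e => g e.1.1 e.1.2 e.2) :
    C Λ fun e => Nat.rec (motive := fun _ => ℕ) (f e) (fun i acc => g e i acc) (Λ.size e) := by
  intro π hπ k l hk hl
  obtain ⟨p, b, hb, hp⟩ := hf π hπ (k + 1) l (by omega) hl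
  -- Register `k` is the counter, `k + 1` the accumulator; the step is evaluated into `k + 2` and
  -- then moved.
  obtain ⟨q, c, hc, hq⟩ := hg ((π.withVar k hk).withVar (k + 1) le_rfl)
    ⟨_, _, le_rfl, ⟨π, k, hk, hπ, rfl⟩, rfl⟩ (k + 2) l le_rfl hl
  refine ⟨.seq p (.seq (.assign k (.const 0)) (.seq (.loop (.sub (.reg 0) (.reg k))
    (.seq q (.seq (.assign (k + 1) (.reg (k + 2))) (.assign k (.add (.reg k) (.const 1))))))
    (.assign k (.reg (k + 1))))), _,
    hb.add ((PolyBdd.const 2).add (((PolyBdd.id.add (.const 1)).mul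
      ((PolyBdd.const 4).add (hc.add (.const 6)))).add (.const 2))), fun e s h => ?_⟩
  obtain ⟨t, s₁, h1, h2, h3, h4⟩ := hp e s h
  have h0k : 0 < k := lt_of_lt_of_le π.pos_k hk
  set r : ℕ → ℕ := fun n => Nat.rec (motive := fun _ => ℕ) (f e) (fun i acc => g e i acc) n
    with hr
  obtain ⟨t', s₂, h5, h6, h7, h8, h9⟩ := exec_loop (N := Λ.size e) (T := c (Λ.size e) + 6)
    (x := .sub (.reg 0) (.reg k))
    (body := .seq q (.seq (.assign (k + 1) (.reg (k + 2))) (.assign k (.add (.reg k) (.const 1)))))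
    (Inv := fun i s' => Same k l s s' ∧ s'.reg k = i ∧ s'.reg (k + 1) = r i)
    (fun i s' hI => by
      simp only [Expr.eval]
      rw [hI.2.1, Λ.reg_zero hπ (π.rel_of_same hI.1.mono h)]
      rfl)
    (fun i s' hi hI => by
      obtain ⟨t, s₂, h5, h6, h7, h8⟩ := hq ((e, i), r i) s'
        ⟨⟨π.rel_of_same hI.1.mono h, hI.2.1⟩, hI.2.2⟩
      refine ⟨_, _, .seq h5 (.seq (.assign _ _ _) (.assign _ _ _)), ?_, ?_, ?_, ?_⟩
      · simp only [Expr.cost]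
        have : c (Λ.var.var.size ((e, i), r i)) = c (Λ.size e) := rfl
        omega
      · exact ((hI.1.trans h8).trans (same_update_reg (k := k) (l := l))).trans
          (same_update_reg (k := k) (l := l))
      · simp [Expr.eval, h8.1 k (by omega), hI.2.1]
      · simp [Expr.eval, h7, hr])
    (s := { s₁ with reg := Function.update s₁.reg k 0 })
    ⟨h4.mono.trans (same_update_reg (k := k) (l := l)), by simp, by simp [h3, hr]⟩
  refine ⟨_, _, .seq h1 (.seq (.assign _ _ _) (.seq h5 (.assign _ _ _))), ?_, ?_,
    h7.trans (same_update_reg (k := k) (l := l))⟩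
  · simp only [Expr.cost, Nat.reduceAdd] at h6 ⊢
    omega
  · simp [Expr.eval, h9, hr]

theorem C.sum {g : E → ℕ → ℕ} (hg : C Λ.var fun e => g e.1 e.2) :
    C Λ fun e => ∑ i ∈ Finset.range (Λ.size e), g e i := by
  refine (C.natRec (f := fun _ => 0) (g := fun e i acc => acc + g e i) (.const 0)
    (C.add .last hg.weaken)).congr fun e => ?_
  generalize Λ.size e = n
  induction n with
  | zero => simp
  | succ n ih => rw [Finset.sum_range_succ, ih]

theorem CP.exists {p : E → ℕ → Prop} (hp : CP Λ.var fun e => p e.1 e.2) :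
    CP Λ fun e => ∃ i < Λ.size e, p e i := by
  classical
  have h : C Λ.var.var fun e => if p e.1.1 e.1.2 then 1 else e.2 :=
    C.ite (p := fun e : (E × ℕ) × ℕ => p e.1.1 e.1.2) hp.weaken (.const 1) .last
  refine (C.natRec (f := fun _ => 0) (g := fun e i acc => if p e i then 1 else acc)
    (.const 0) h).congr fun e => ?_
  beta_reduce
  generalize Λ.size e = n
  induction n with
  | zero => simp
  | succ n ih =>
    change _ = if p e n then 1 else
      Nat.rec (motive := fun _ => ℕ) 0 (fun i acc => if p e i then 1 else acc) n
    rw [← ih]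
    by_cases h : p e n
    · rw [if_pos ⟨n, Nat.lt_succ_self n, h⟩]; simp [h]
    · simp only [h, if_false]
      congr 1
      refine propext ⟨fun ⟨i, hi, hp⟩ => ⟨i, ?_, hp⟩, fun ⟨i, hi, hp⟩ => ⟨i, by omega, hp⟩⟩
      have : i ≠ n := fun he => h (he ▸ hp)
      omega

open Classical in
/-- The least number below `n` with the property `p`, and `n` if there is none. -/
noncomputable def least (n : ℕ) (p : ℕ → Prop) : ℕ :=
  ∑ i ∈ Finset.range n, if ∃ j < n, j ≤ i ∧ p j then 0 else 1

/-- The summand is 1 exactly for the `i` below the first witness, so the sum counts up to that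
witness. -/
theorem least_spec {n : ℕ} {p : ℕ → Prop} (h : ∃ i < n, p i) :
    least n p < n ∧ p (least n p) ∧ ∀ j, p j → least n p ≤ j := by
  classical
  have hex : ∃ i, i < n ∧ p i := h
  have hf := Nat.find_spec hex
  have heq : least n p = Nat.find hex := by
    unfold least
    rw [Finset.sum_congr rfl fun i hi => show (if ∃ j < n, j ≤ i ∧ p j then 0 else 1) =
      if i < Nat.find hex then 1 else 0 from ?_]
    · rw [← Finset.sum_filter, Finset.sum_const, smul_eq_mul, mul_one]
      have : (Finset.range n).filter (fun i => i < Nat.find hex) =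
          Finset.range (Nat.find hex) := by
        ext i
        have := hf.1
        simp only [Finset.mem_filter, Finset.mem_range]
        omega
      rw [this, Finset.card_range]
    · by_cases hlt : i < Nat.find hex
      · rw [if_pos hlt, if_neg]
        rintro ⟨j, hj, hji, hp⟩
        have := Nat.find_min' hex ⟨hj, hp⟩
        omega
      · rw [if_neg hlt, if_pos ⟨_, hf.1, by omega, hf.2⟩]
  rw [heq]
  refine ⟨hf.1, hf.2, fun j hj => ?_⟩
  by_cases hjn : j < n
  · exact Nat.find_min' hex ⟨hjn, hj⟩
  · omega

theorem C.least {p : E → ℕ → Prop} (hp : CP Λ.var fun e => p e.1 e.2) :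
    C Λ fun e => least (Λ.size e) (p e) := by
  classical
  have h2 : CP Λ.var.var fun e => e.2 ≤ e.1.2 ∧ p e.1.1 e.2 := by
    refine (CP.le .last C.last.weaken).and ?_
    -- The predicate does not use the middle variable. As layouts may leave gaps between registers,
    -- forgetting register `r'` gives a layout of the smaller context.
    rintro _ ⟨_, r, hr, ⟨π, r', hr', h, rfl⟩, rfl⟩ k l hk hl
    have hr1 : r' + 1 ≤ r := hr
    obtain ⟨P, b, hb, H⟩ := hp (π.withVar r (by omega)) ⟨π, r, _, h, rfl⟩ k l hk hl
    exact ⟨P, b, hb, fun e s h => H (e.1.1, e.2) s ⟨h.1.1, h.2⟩⟩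
  have h1 : CP Λ.var fun e => ∃ j < Λ.size e.1, j ≤ e.2 ∧ p e.1 j := CP.exists (Λ := Λ.var) h2
  have h3 : C Λ.var fun e => if ∃ j < Λ.size e.1, j ≤ e.2 ∧ p e.1 j then 0 else 1 :=
    C.ite h1 (.const 0) (.const 1)
  exact C.sum h3

theorem C.word (hf : C Λ f) : C Λ fun e => (Λ.word e).getD (f e) 0 := by
  intro π hπ k l hk hl
  obtain ⟨p, b, hb, hp⟩ := hf π hπ k l hk hl
  refine ⟨.seq p (.assign k (.read 0 (.reg k))), _, hb.add (.const 3), fun e s h => ?_⟩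
  obtain ⟨t, s₁, h1, h2, h3, h4⟩ := hp e s h
  refine ⟨_, _, .seq h1 (.assign _ _ _), ?_, ?_, h4.trans (same_update_reg (k := k) (l := l))⟩
  · simp only [Expr.cost]; omega
  · simp [Expr.eval, h3, Λ.arr_zero hπ (π.rel_of_same (h4.mono hk hl) h)]

/-- Tables are represented only at indices below register 0, hence the bound on the index. -/
theorem C.read {τ : E → ℕ → ℕ} (hτ : HasTab Λ τ) (hf : C Λ f) (hlt : ∀ e, f e < Λ.size e) :
    C Λ fun e => τ e (f e) := by
  intro π hπ k l hk hl
  obtain ⟨p, b, hb, hp⟩ := hf π hπ k l hk hl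
  obtain ⟨a, ha, H⟩ := hτ π hπ
  refine ⟨.seq p (.assign k (.read a (.reg k))), _, hb.add (.const 3), fun e s h => ?_⟩
  obtain ⟨t, s₁, h1, h2, h3, h4⟩ := hp e s h
  have hr := π.rel_of_same (h4.mono hk hl) h
  refine ⟨_, _, .seq h1 (.assign _ _ _), ?_, ?_, h4.trans (same_update_reg (k := k) (l := l))⟩
  · simp only [Expr.cost]; omega
  · simp only [Expr.eval, h3, Function.update_self]
    refine H e s₁ hr _ ?_
    rw [Λ.reg_zero hπ hr]
    exact hlt e

/-- Filling an array with the values of a function. -/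
theorem C.fill {h : E → ℕ → ℕ} (hh : C Λ.var fun e => h e.1 e.2) {π : Layout E} (hπ : Λ.lay π)
    {k l : ℕ} (hk : π.k ≤ k) (hl : π.l ≤ l) : ∃ (p : Prog) (b : ℕ → ℕ), PolyBdd b ∧
      ∀ e s, π.rel e s → ∃ t s', Exec p s t s' ∧ t ≤ b (Λ.size e) ∧ Same k l s s' ∧
        ∀ i < Λ.size e, s'.arr l i = h e i := by
  obtain ⟨q, c, hc, hq⟩ := hh (π.withVar k hk) ⟨π, k, hk, hπ, rfl⟩ (k + 1) (l + 1) le_rfl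
    (Nat.le_succ_of_le hl)
  refine ⟨.seq (.assign k (.const 0)) (.loop (.sub (.reg 0) (.reg k))
    (.seq q (.seq (.write l (.reg k) (.reg (k + 1))) (.assign k (.add (.reg k) (.const 1)))))), _,
    (PolyBdd.const 2).add ((PolyBdd.id.add (.const 1)).mul
      ((PolyBdd.const 4).add (hc.add (.const 7)))), fun e s hs => ?_⟩
  have h0k : 0 < k := lt_of_lt_of_le π.pos_k hk
  obtain ⟨t', s₂, h5, h6, h7, h8, h9⟩ := exec_loop (N := Λ.size e) (T := c (Λ.size e) + 7)
    (x := .sub (.reg 0) (.reg k))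
    (body := .seq q (.seq (.write l (.reg k) (.reg (k + 1))) (.assign k (.add (.reg k) (.const 1)))))
    (Inv := fun i s' => Same k l s s' ∧ s'.reg k = i ∧ ∀ j < i, s'.arr l j = h e j)
    (fun i s' hI => by
      simp only [Expr.eval]
      rw [hI.2.1, Λ.reg_zero hπ (π.rel_of_same hI.1.mono hs)]
      rfl)
    (fun i s' hi hI => by
      obtain ⟨t, s₂, h5, h6, h7, h8⟩ := hq (e, i) s' ⟨π.rel_of_same hI.1.mono hs, hI.2.1⟩
      refine ⟨_, _, .seq h5 (.seq (.write _ _ _ _) (.assign _ _ _)), ?_, ?_, ?_, ?_⟩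
      · simp only [Expr.cost]
        have : c (Λ.var.size (e, i)) = c (Λ.size e) := rfl
        omega
      · exact ((hI.1.trans h8).trans (same_update_arr (k := k) (l := l))).trans
          (same_update_reg (k := k) (l := l))
      · simp [Expr.eval, h8.1 k (by omega), hI.2.1]
      · intro j hj
        simp only [Expr.eval, h8.1 k (by omega), hI.2.1, h7, Function.update_self]
        by_cases hji : j = i
        · simp [hji]
        · rw [Function.update_of_ne hji, h8.2 l (by omega)]
          exact hI.2.2 j (by omega))
    (s := { s with reg := Function.update s.reg k 0 })
    ⟨same_update_reg (k := k) (l := l), by simp, fun j hj => absurd hj (Nat.not_lt_zero j)⟩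
  refine ⟨_, _, .seq (.assign _ _ _) h5, ?_, h7, h9⟩
  simp only [Expr.cost, Nat.reduceAdd] at h6 ⊢
  omega

/-- Copying the first entries of array `b` to array `a`. -/
def copyProg (k a b : ℕ) : Prog :=
  .seq (.assign k (.const 0)) (.loop (.sub (.reg 0) (.reg k))
    (.seq (.write a (.reg k) (.read b (.reg k))) (.assign k (.add (.reg k) (.const 1)))))

theorem exec_copyProg {k a b N : ℕ} (hk : 0 < k) (hab : a ≠ b) {s : Store} (h0 : s.reg 0 = N) :
    ∃ t s', Exec (copyProg k a b) s t s' ∧ t ≤ 2 + (N + 1) * 12 ∧ (∀ x < k, s'.reg x = s.reg x) ∧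
      (∀ c, c ≠ a → s'.arr c = s.arr c) ∧ ∀ i < N, s'.arr a i = s.arr b i := by
  obtain ⟨t', s₂, h5, h6, h7, h8, h9, h10⟩ := exec_loop (N := N) (T := 8)
    (x := .sub (.reg 0) (.reg k))
    (body := .seq (.write a (.reg k) (.read b (.reg k))) (.assign k (.add (.reg k) (.const 1))))
    (Inv := fun i s' => (∀ x < k, s'.reg x = s.reg x) ∧ s'.reg k = i ∧
      (∀ c, c ≠ a → s'.arr c = s.arr c) ∧ ∀ j < i, s'.arr a j = s.arr b j)
    (fun i s' hI => by
      simp only [Expr.eval]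
      rw [hI.2.1, hI.1 0 hk, h0])
    (fun i s' hi hI => by
      refine ⟨_, _, .seq (.write _ _ _ _) (.assign _ _ _), ?_, ?_, ?_, ?_, ?_⟩
      · simp only [Expr.cost]; omega
      · intro x hx
        rw [← hI.1 x hx]
        exact Function.update_of_ne (by omega) _ _
      · simp [Expr.eval, hI.2.1]
      · intro c hc
        rw [← hI.2.2.1 c hc]
        exact Function.update_of_ne hc _ _
      · intro j hj
        simp only [Expr.eval, hI.2.1, Function.update_self]
        by_cases hji : j = i
        · simp [hji, hI.2.2.1 b hab.symm]
        · rw [Function.update_of_ne hji]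
          exact hI.2.2.2 j (by omega))
    (s := { s with reg := Function.update s.reg k 0 })
    ⟨fun x hx => Function.update_of_ne (by omega) _ _, by simp, fun _ _ => rfl,
      fun j hj => absurd hj (Nat.not_lt_zero j)⟩
  refine ⟨_, _, .seq (.assign _ _ _) h5, ?_, h7, h9, h10⟩
  simp only [Expr.cost, Nat.reduceAdd] at h6 ⊢
  omega

/-- Iterating a function on tables. -/
theorem C.iterate {init : E → ℕ → ℕ} {step : E → (ℕ → ℕ) → ℕ → ℕ} {out : E → (ℕ → ℕ) → ℕ}
    (hi : C Λ.var fun e => init e.1 e.2) (hs : C Λ.tab.var fun e => step e.1.1 e.1.2 e.2)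
    (ho : C Λ.tab fun e => out e.1 e.2) :
    C Λ fun e => out e ((step e)^[Λ.size e] (init e)) := by
  intro π hπ k l hk hl
  have hπ' : Λ.tab.lay (π.withTab l hl) := ⟨π, l, hl, hπ, rfl⟩
  obtain ⟨p, b, hb, hp⟩ := hi.fill hπ hk hl
  -- The new table is built in array `l + 1` and copied back to `l`, because each entry may depend
  -- on the whole old table.
  obtain ⟨q, c, hc, hq⟩ := C.fill (h := fun e i => step e.1 e.2 i) hs hπ' (k := k + 1) (l := l + 1) (Nat.le_succ_of_le hk) le_rfl
  obtain ⟨r, d, hd, hr⟩ := ho _ hπ' k (l + 1) hk le_rfl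
  refine ⟨.seq p (.seq (.assign k (.const 0)) (.seq (.loop (.sub (.reg 0) (.reg k))
    (.seq q (.seq (copyProg (k + 1) l (l + 1)) (.assign k (.add (.reg k) (.const 1)))))) r)), _,
    hb.add ((PolyBdd.const 2).add (((PolyBdd.id.add (.const 1)).mul
      ((PolyBdd.const 4).add ((hc.add ((PolyBdd.const 2).add ((PolyBdd.id.add (.const 1)).mul
        (.const 12)))).add (.const 4)))).add hd)), fun e s h => ?_⟩
  obtain ⟨t, s₁, h1, h2, h3, h4⟩ := hp e s h
  have h0k : 0 < k := lt_of_lt_of_le π.pos_k hk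
  obtain ⟨t', s₂, h5, h6, h7, h8, h9⟩ := exec_loop (N := Λ.size e)
    (T := c (Λ.size e) + (2 + (Λ.size e + 1) * 12) + 4)
    (x := .sub (.reg 0) (.reg k))
    (body := .seq q (.seq (copyProg (k + 1) l (l + 1)) (.assign k (.add (.reg k) (.const 1)))))
    (Inv := fun i s' => Same k l s s' ∧ s'.reg k = i ∧
      ∀ j < Λ.size e, s'.arr l j = (step e)^[i] (init e) j)
    (fun i s' hI => by
      simp only [Expr.eval]
      rw [hI.2.1, Λ.reg_zero hπ (π.rel_of_same hI.1.mono h)]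
      rfl)
    (fun i s' hi hI => by
      have hrel := π.rel_of_same (hI.1.mono hk hl) h
      have h0 : s'.reg 0 = Λ.size e := Λ.reg_zero hπ hrel
      obtain ⟨t, s₂, h5, h6, h7, h8⟩ := hq (e, (step e)^[i] (init e)) s'
        ⟨hrel, fun j hj => hI.2.2 j (h0 ▸ hj)⟩
      obtain ⟨t', s₃, g1, g2, g3, g4, g5⟩ := exec_copyProg (k := k + 1) (a := l) (b := l + 1)
        (by omega) (by omega) (s := s₂) (N := Λ.size e) (by rw [h7.1 0 (by omega), h0])
      refine ⟨_, _, .seq h5 (.seq g1 (.assign _ _ _)), ?_, ?_, ?_, ?_⟩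
      · simp only [Expr.cost]
        have : c (Λ.tab.size (e, (step e)^[i] (init e))) = c (Λ.size e) := rfl
        omega
      · have : Same k l s₂ s₃ := ⟨fun x hx => g3 x (by omega), fun a ha => g4 a (by omega)⟩
        exact ((hI.1.trans h7).trans this).trans (same_update_reg (k := k) (l := l))
      · simp [Expr.eval, g3 k (by omega), h7.1 k (by omega), hI.2.1]
      · intro j hj
        change s₃.arr l j = _
        rw [g5 j hj, h8 j hj, Function.iterate_succ_apply'])
    (s := { s₁ with reg := Function.update s₁.reg k 0 })
    ⟨h3.trans (same_update_reg (k := k) (l := l)), by simp, fun j hj => h4 j hj⟩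
  have hrel := π.rel_of_same (h7.mono hk hl) h
  have h0 : s₂.reg 0 = Λ.size e := Λ.reg_zero hπ hrel
  obtain ⟨t'', s₃, g1, g2, g3, g4⟩ := hr (e, (step e)^[Λ.size e] (init e)) s₂
    ⟨hrel, fun j hj => h9 j (h0 ▸ hj)⟩
  refine ⟨_, _, .seq h1 (.seq (.assign _ _ _) (.seq h5 g1)), ?_, g3, h7.trans g4⟩
  have : d (Λ.tab.size (e, (step e)^[Λ.size e] (init e))) = d (Λ.size e) := rfl
  simp only [Expr.cost, Nat.reduceAdd] at h6 ⊢
  omega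

/-- The context that consists of the input only. -/
def Ctx.base {α : Type} (enc : α → List ℕ) : Ctx α where
  word := enc
  lay π := π = ⟨1, 1, one_pos, one_pos, fun a s => s.reg 0 = loopBound (enc a).length ∧
    s.arr 0 = fun i => (enc a).getD i 0, fun h h' => by
      rw [h.1 0 one_pos, h.2 0 one_pos]; exact h'⟩
  reg_zero := by rintro _ e s rfl h; exact h.1
  arr_zero := by rintro _ e s rfl h; exact h.2

/-- Computes the number of iterations of all loops. -/
def boundProg : Prog :=
  -- For want of a multiplication, eight times the length is added to register 1 once per iteration.
  .seq (.assign 2 (.const 0)) (.seq (.loop (.sub (.reg 0) (.reg 2))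
    (.seq (.assign 1 (.add (.reg 1) (.add
      (.add (.add (.reg 0) (.reg 0)) (.add (.reg 0) (.reg 0)))
      (.add (.add (.reg 0) (.reg 0)) (.add (.reg 0) (.reg 0))))))
      (.assign 2 (.add (.reg 2) (.const 1)))))
    (.assign 0 (.add (.reg 1) (.const 8))))

theorem exec_boundProg (w : List ℕ) : ∃ t s', Exec boundProg (Store.input w) t s' ∧
    t ≤ 2 + (w.length + 1) * 30 + 4 ∧ s'.reg 0 = loopBound w.length ∧
      s'.arr 0 = fun i => w.getD i 0 := by
  obtain ⟨t', s₂, h5, h6, h7, h8, h9, h10⟩ := exec_loop (N := w.length) (T := 26)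
    (x := .sub (.reg 0) (.reg 2))
    (body := .seq (.assign 1 (.add (.reg 1) (.add
      (.add (.add (.reg 0) (.reg 0)) (.add (.reg 0) (.reg 0)))
      (.add (.add (.reg 0) (.reg 0)) (.add (.reg 0) (.reg 0))))))
      (.assign 2 (.add (.reg 2) (.const 1))))
    (Inv := fun i s' => s'.reg 0 = w.length ∧ s'.reg 1 = 8 * w.length * i ∧ s'.reg 2 = i ∧
      s'.arr 0 = fun i => w.getD i 0)
    (fun i s' hI => by
      simp only [Expr.eval]
      rw [hI.1, hI.2.2.1])
    (fun i s' hi hI => by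
      refine ⟨_, _, .seq (.assign _ _ _) (.assign _ _ _), ?_, ?_, ?_, ?_, ?_⟩
      · simp [Expr.cost]
      · simpa using hI.1
      · simp [Expr.eval, hI.1, hI.2.1]; ring
      · simp [Expr.eval, hI.2.2.1]
      · exact hI.2.2.2)
    (s := { Store.input w with reg := Function.update (Store.input w).reg 2 0 })
    ⟨by simp [Store.input], by simp [Store.input], by simp, by simp [Store.input]⟩
  refine ⟨_, _, .seq (.assign _ _ _) (.seq h5 (.assign _ _ _)), ?_, ?_, h10⟩
  · simp only [Expr.cost, Nat.reduceAdd] at h6 ⊢; omega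
  · simp [Expr.eval, h8, loopBound]

/-- A problem can be solved in polynomial time if the length and the entries of the output can be
computed in polynomial time. -/
theorem polyTimeSolvable {α : Type} {enc : α → List ℕ} {dom : α → Prop} {sol : α → List ℕ → Prop}
    {len : α → ℕ} {out : α → ℕ → ℕ} (hlen : C (Ctx.base enc) len)
    (hout : C (Ctx.base enc).var fun e => out e.1 e.2)
    (hle : ∀ a, dom a → len a ≤ loopBound (enc a).length)
    (hsol : ∀ a, dom a → sol a ((List.range (len a)).map (out a))) :
    PolyTimeSolvable enc dom sol := by
  obtain ⟨p, b, hb, hp⟩ := hlen _ rfl 1 1 le_rfl le_rfl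
  obtain ⟨q, c, hc, hq⟩ := hout.fill rfl (k := 2) (l := 1) one_le_two le_rfl
  obtain ⟨P, hP⟩ := hb.add (hc.add (((PolyBdd.const 2).add ((PolyBdd.id.add (.const 1)).mul
    (.const 12))).add (.const 2)))
  -- The output is prepared in array 1 and copied to array 0 at the end, because the input word is
  -- read until then. Apart from `boundProg`, costs are polynomial in the loop bound, which is
  -- itself a polynomial of the length of the word.
  refine ⟨.seq boundProg (.seq p (.seq q (.seq (copyProg 2 0 1) (.assign 0 (.reg 1))))),
    (2 + (Polynomial.X + 1) * 30 + 4) + P.comp (8 * Polynomial.X * Polynomial.X + 8),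
    fun a ha => ?_⟩
  obtain ⟨t₀, s₀, h1, h2, h3, h4⟩ := exec_boundProg (enc a)
  obtain ⟨t₁, s₁, h5, h6, h7, h8⟩ := hp a s₀ ⟨h3, h4⟩
  obtain ⟨t₂, s₂, g1, g2, g3, g4⟩ := hq a s₁ ⟨by rw [h8.1 0 one_pos, h3],
    by rw [h8.2 0 one_pos, h4]⟩
  obtain ⟨t₃, s₃, k1, k2, k3, k4, k5⟩ := exec_copyProg (k := 2) (a := 0) (b := 1) two_pos
    zero_ne_one (s := s₂) (N := loopBound (enc a).length)
    (by rw [g3.1 0 two_pos, h8.1 0 one_pos, h3])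
  refine ⟨_, _, .seq h1 (.seq h5 (.seq g1 (.seq k1 (.assign _ _ _)))), ?_, ?_⟩
  · have := hP (loopBound (enc a).length)
    have e1 : (Ctx.base enc).size a = loopBound (enc a).length := rfl
    rw [e1] at h6 g2
    dsimp only at this
    simp only [Polynomial.eval_add, Polynomial.eval_comp, Polynomial.eval_mul, Polynomial.eval_X,
      Polynomial.eval_one, Polynomial.eval_ofNat, Expr.cost]
    change _ ≤ _ + Polynomial.eval (loopBound (enc a).length) P
    omega
  · have : Store.output { s₃ with reg := Function.update s₃.reg 0 ((Expr.reg 1).eval s₃) } =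
        (List.range (len a)).map (out a) := by
      have hr : s₃.reg 1 = len a := by
        rw [k3 1 one_lt_two, g3.1 1 one_lt_two, h7]
      simp only [Store.output, Function.update_self, Expr.eval, hr]
      refine List.map_congr_left fun i hi => ?_
      have hi' : i < loopBound (enc a).length :=
        (List.mem_range.1 hi).trans_le (hle a ha)
      rw [k5 i hi', g4 i hi']
    rw [this]
    exact hsol a ha

end RAM

/-! ## The algorithm, as functions of the input word -/

namespace RobustAlg

open RAM

section Defs

open Classical

variable (w : List ℕ)

/-- The number of workers. -/
def nW : ℕ := w.getD 0 0

/-- The number of firms. -/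
def mW : ℕ := w.getD 1 0

/-- The position of the `i`-th list in the input word. -/
noncomputable def startW (i : ℕ) : ℕ :=
  Nat.rec (motive := fun _ => ℕ) 2
    (fun t acc => if t < i then acc + 1 + w.getD acc 0 else acc) (loopBound w.length)

/-- The length of the `i`-th list. -/
noncomputable def lenW (i : ℕ) : ℕ := w.getD (startW w i) 0

/-- The entry at position `k` of the `i`-th list. -/
noncomputable def entW (i k : ℕ) : ℕ := w.getD (startW w i + 1 + k) 0

/-- The number `z` occurs in the `i`-th list. -/
def memW (i z : ℕ) : Prop := ∃ k < loopBound w.length, k < lenW w i ∧ entW w i k = z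

/-- The position of `z` in the `i`-th list. -/
noncomputable def idxW (i z : ℕ) : ℕ :=
  ∑ k ∈ Finset.range (loopBound w.length), if k < lenW w i ∧ entW w i k = z then k else 0

/-- The lists with numbers `i` and `i'`, of equal lengths, are different. -/
def difW (i i' : ℕ) : Prop :=
  ∃ k < loopBound w.length, k < lenW w i ∧ ¬ entW w i k = entW w i' k

/-- Worker `x` and firm `y` are joined by an edge. -/
def edgeW (x y : ℕ) : Prop := x < nW w ∧ y < mW w ∧ memW w x y

/-- The rank of `z` when all agents above `t` in the `i`-th or in the `i'`-th list are moved
above `t`. -/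
noncomputable def hybW (i i' t z : ℕ) : ℕ :=
  if idxW w i z < idxW w i t ∨ idxW w i' z < idxW w i' t then idxW w i z
  else if z = t then nW w + mW w else nW w + mW w + 1 + idxW w i z

/-- The ranks of the workers in the hybrid preferences for the target edge `(a, b)`. -/
noncomputable def rwW (a b x y : ℕ) : ℕ :=
  if x = a then hybW w x (nW w + mW w + x) b y else idxW w x y

/-- The ranks of the firms in the hybrid preferences for the target edge `(a, b)`. -/
noncomputable def rfW (a b y x : ℕ) : ℕ :=
  if a < nW w ∧ y = b then hybW w (nW w + y) (nW w + mW w + nW w + y) a x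
  else idxW w (nW w + y) x

/-- A bound on all ranks. -/
def boundW : ℕ := nW w + mW w + (nW w + mW w) + 2

/-- The level of the target contract. -/
def levW (v : ℕ) : ℕ := if v = 2 then 1 else 0

/-- The contract of worker `x` with firm `y` at level `j` is not truncated. -/
def okW (v a b x y j : ℕ) : Prop :=
  a < nW w → y = b → levW v < j ∨ j = levW v ∧ rfW w a b b x ≤ rfW w a b b a

/-- The contract of worker `x` at position `q` is with firm `y`. -/
def conW (v a b x q y : ℕ) : Prop :=
  edgeW w x y ∧ (q = rwW w a b x y ∧ okW w v a b x y 0 ∨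
    ¬ v = 0 ∧ q = boundW w + rwW w a b x y ∧ okW w v a b x y 1)

/-- The key of the contract of worker `x` with firm `y` at position `q`. -/
noncomputable def keyW (a b x q y : ℕ) : ℕ :=
  (if q < boundW w then boundW w else 0) + rfW w a b y x

/-- The number of positions. -/
def topW (v : ℕ) : ℕ := if v = 0 then boundW w else boundW w + boundW w

/-- The entry of a table, with a guarded index. -/
def readW (T : ℕ → ℕ) (x : ℕ) : ℕ := T (if x < loopBound w.length then x else 0)

/-- Worker `x` has to move on. -/
def rejW (v a b : ℕ) (T : ℕ → ℕ) (x : ℕ) : Prop :=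
  readW w T x < topW w v ∧
    ((¬ ∃ y < loopBound w.length, conW w v a b x (readW w T x) y) ∨
      ∃ y < loopBound w.length, conW w v a b x (readW w T x) y ∧
        ∃ x' < loopBound w.length, conW w v a b x' (readW w T x') y ∧
          keyW w a b x' (readW w T x') y < keyW w a b x (readW w T x) y)

/-- A round of deferred acceptance. -/
noncomputable def stepW (v a b : ℕ) (T : ℕ → ℕ) (x : ℕ) : ℕ :=
  if rejW w v a b T x then readW w T x + 1 else readW w T x

/-- The final position of worker `x`. -/
noncomputable def posW (v a b x : ℕ) : ℕ :=
  readW w ((stepW w v a b)^[loopBound w.length] fun _ => 0) x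

/-- Worker `x` ends at a contract with firm `y`. -/
def pairW (v a b x y : ℕ) : Prop := conW w v a b x (posW w v a b x) y

/-- The candidate `(v, a, b)` succeeds. -/
def succW (v a b : ℕ) : Prop :=
  (a < nW w ∧ edgeW w a b ∧
    (¬ ∃ x < loopBound w.length, x < nW w ∧ difW w x (nW w + mW w + x) ∧ ¬ x = a) ∧
    (¬ ∃ y < loopBound w.length, y < mW w ∧
      difW w (nW w + y) (nW w + mW w + nW w + y) ∧ ¬ y = b) ∧
    posW w v a b a = (if v = 2 then boundW w else 0) + rwW w a b a b) ∨
  (nW w ≤ a ∧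
    (¬ ∃ x < loopBound w.length, x < nW w ∧ difW w x (nW w + mW w + x) ∧
      ∃ y < loopBound w.length, pairW w v a b x y) ∧
    ¬ ∃ y < loopBound w.length, y < mW w ∧
      difW w (nW w + y) (nW w + mW w + nW w + y) ∧
      ∃ x < loopBound w.length, pairW w v a b x y)

/-- There is a successful candidate of kind `v`. -/
def kindW (v₀ v : ℕ) : Prop :=
  v₀ ≤ v ∧ v < 3 ∧ ∃ a < loopBound w.length, ∃ b < loopBound w.length, succW w v a b

/-- There is a successful candidate. -/
def foundW (v₀ : ℕ) : Prop := ∃ v < loopBound w.length, kindW w v₀ v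

/-- The kind of the first successful candidate. -/
noncomputable def vW (v₀ : ℕ) : ℕ := least (loopBound w.length) (kindW w v₀)

/-- The worker of the first successful candidate. -/
noncomputable def aW (v₀ : ℕ) : ℕ :=
  least (loopBound w.length) fun a => ∃ b < loopBound w.length, succW w (vW w v₀) a b

/-- The firm of the first successful candidate. -/
noncomputable def bW (v₀ : ℕ) : ℕ :=
  least (loopBound w.length) fun b => succW w (vW w v₀) (aW w v₀) b

/-- The pairs in the output. -/
def outPairW (v₀ x y : ℕ) : Prop := pairW w (vW w v₀) (aW w v₀) (bW w v₀) x y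

/-- Worker `x` is matched in the output. -/
def matchedW (v₀ x : ℕ) : Prop := ∃ y < loopBound w.length, outPairW w v₀ x y

/-- The partner of worker `x` in the output. -/
noncomputable def partnerW (v₀ x : ℕ) : ℕ := least (loopBound w.length) (outPairW w v₀ x)

/-- The number of matched workers before `x`. -/
noncomputable def countW (v₀ x : ℕ) : ℕ :=
  ∑ i ∈ Finset.range (loopBound w.length), if i < x ∧ matchedW w v₀ i then 1 else 0

/-- The matched worker with exactly `i` matched workers before it. -/
noncomputable def nthW (v₀ i : ℕ) : ℕ :=
  least (loopBound w.length) fun x => matchedW w v₀ x ∧ countW w v₀ x = i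

/-- The rounded half of a small number `k`. -/
noncomputable def halfW (k : ℕ) : ℕ :=
  ∑ i ∈ Finset.range (loopBound w.length), if i + i + 2 ≤ k then 1 else 0

/-- The length of the output word. -/
noncomputable def outLenW (v₀ : ℕ) : ℕ :=
  if foundW w v₀ then countW w v₀ (nW w) + countW w v₀ (nW w) + 1 else 1

/-- The entries of the output word. -/
noncomputable def outW (v₀ k : ℕ) : ℕ :=
  if k = 0 then (if foundW w v₀ then 1 else 0)
  else if k - 1 = halfW w (k - 1) + halfW w (k - 1) then nthW w v₀ (halfW w (k - 1))
  else partnerW w v₀ (nthW w v₀ (halfW w (k - 1)))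

end Defs

/-! ### The functions of the algorithm are computable in polynomial time -/

section Computable

open Classical

variable {E : Type} {Λ : Ctx E} {i k z t v a b x y q j v₀ : E → ℕ}

theorem c_nW : C Λ fun e => nW (Λ.word e) := C.word (.const 0)

theorem c_mW : C Λ fun e => mW (Λ.word e) := C.word (.const 1)

theorem c_startW (hi : C Λ i) : C Λ fun e => startW (Λ.word e) (i e) :=
  C.natRec (f := fun _ => 2)
    (g := fun e t acc => if t < i e then acc + 1 + (Λ.word e).getD acc 0 else acc) (.const 2)
    (C.ite (CP.lt C.last.weaken hi.weaken.weaken) ((C.last.add (.const 1)).add (C.word .last)) .last)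

theorem c_lenW (hi : C Λ i) : C Λ fun e => lenW (Λ.word e) (i e) := C.word (c_startW hi)

theorem c_entW (hi : C Λ i) (hk : C Λ k) : C Λ fun e => entW (Λ.word e) (i e) (k e) :=
  C.word (((c_startW hi).add (.const 1)).add hk)

theorem c_memW (hi : C Λ i) (hz : C Λ z) : CP Λ fun e => memW (Λ.word e) (i e) (z e) :=
  CP.exists ((CP.lt .last (c_lenW hi.weaken)).and (CP.eq (c_entW hi.weaken .last) hz.weaken))

theorem c_idxW (hi : C Λ i) (hz : C Λ z) : C Λ fun e => idxW (Λ.word e) (i e) (z e) :=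
  C.sum (C.ite ((CP.lt .last (c_lenW hi.weaken)).and
    (CP.eq (c_entW hi.weaken .last) hz.weaken)) .last (.const 0))

theorem c_difW (hi : C Λ i) (hz : C Λ z) : CP Λ fun e => difW (Λ.word e) (i e) (z e) :=
  CP.exists ((CP.lt .last (c_lenW hi.weaken)).and
    (CP.eq (c_entW hi.weaken .last) (c_entW hz.weaken .last)).not)

theorem c_edgeW (hx : C Λ x) (hy : C Λ y) : CP Λ fun e => edgeW (Λ.word e) (x e) (y e) :=
  (CP.lt hx c_nW).and ((CP.lt hy c_mW).and (c_memW hx hy))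

theorem c_hybW (hi : C Λ i) (hj : C Λ j) (ht : C Λ t) (hz : C Λ z) :
    C Λ fun e => hybW (Λ.word e) (i e) (j e) (t e) (z e) :=
  C.ite ((CP.lt (c_idxW hi hz) (c_idxW hi ht)).or (CP.lt (c_idxW hj hz) (c_idxW hj ht)))
    (c_idxW hi hz) (C.ite (CP.eq hz ht) (c_nW.add c_mW)
      (((c_nW.add c_mW).add (.const 1)).add (c_idxW hi hz)))

theorem c_rwW (ha : C Λ a) (hb : C Λ b) (hx : C Λ x) (hy : C Λ y) :
    C Λ fun e => rwW (Λ.word e) (a e) (b e) (x e) (y e) :=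
  C.ite (CP.eq hx ha) (c_hybW hx ((c_nW.add c_mW).add hx) hb hy) (c_idxW hx hy)

theorem c_rfW (ha : C Λ a) (hb : C Λ b) (hy : C Λ y) (hx : C Λ x) :
    C Λ fun e => rfW (Λ.word e) (a e) (b e) (y e) (x e) :=
  C.ite ((CP.lt ha c_nW).and (CP.eq hy hb))
    (c_hybW (c_nW.add hy) (((c_nW.add c_mW).add c_nW).add hy) ha hx) (c_idxW (c_nW.add hy) hx)

theorem c_boundW : C Λ fun e => boundW (Λ.word e) :=
  ((c_nW.add c_mW).add (c_nW.add c_mW)).add (.const 2)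

theorem c_levW (hv : C Λ v) : C Λ fun e => levW (v e) :=
  C.ite (CP.eq hv (.const 2)) (.const 1) (.const 0)

theorem c_okW (hv : C Λ v) (ha : C Λ a) (hb : C Λ b) (hx : C Λ x) (hy : C Λ y) (hj : C Λ j) :
    CP Λ fun e => okW (Λ.word e) (v e) (a e) (b e) (x e) (y e) (j e) :=
  (CP.lt ha c_nW).imp ((CP.eq hy hb).imp ((CP.lt (c_levW hv) hj).or
    ((CP.eq hj (c_levW hv)).and (CP.le (c_rfW ha hb hb hx) (c_rfW ha hb hb ha)))))

theorem c_conW (hv : C Λ v) (ha : C Λ a) (hb : C Λ b) (hx : C Λ x) (hq : C Λ q) (hy : C Λ y) :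
    CP Λ fun e => conW (Λ.word e) (v e) (a e) (b e) (x e) (q e) (y e) :=
  (c_edgeW hx hy).and (((CP.eq hq (c_rwW ha hb hx hy)).and
    (c_okW hv ha hb hx hy (.const 0))).or ((CP.eq hv (.const 0)).not.and
      ((CP.eq hq (c_boundW.add (c_rwW ha hb hx hy))).and (c_okW hv ha hb hx hy (.const 1)))))

theorem c_keyW (ha : C Λ a) (hb : C Λ b) (hx : C Λ x) (hq : C Λ q) (hy : C Λ y) :
    C Λ fun e => keyW (Λ.word e) (a e) (b e) (x e) (q e) (y e) :=
  (C.ite (CP.lt hq c_boundW) c_boundW (.const 0)).add (c_rfW ha hb hy hx)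

theorem c_topW (hv : C Λ v) : C Λ fun e => topW (Λ.word e) (v e) :=
  C.ite (CP.eq hv (.const 0)) c_boundW (c_boundW.add c_boundW)

theorem c_readW {τ : E → ℕ → ℕ} (hτ : HasTab Λ τ) (hx : C Λ x) :
    C Λ fun e => readW (Λ.word e) (τ e) (x e) :=
  C.read (f := fun e => if x e < loopBound (Λ.word e).length then x e else 0) hτ
    (C.ite (CP.lt hx .size) hx (.const 0)) fun e => by
    have : 0 < Λ.size e := Nat.succ_pos _
    change (if x e < Λ.size e then x e else 0) < Λ.size e
    split_ifs <;> assumption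

theorem c_rejW {τ : E → ℕ → ℕ} (hτ : HasTab Λ τ) (hv : C Λ v) (ha : C Λ a) (hb : C Λ b)
    (hx : C Λ x) : CP Λ fun e => rejW (Λ.word e) (v e) (a e) (b e) (τ e) (x e) :=
  (CP.lt (c_readW hτ hx) (c_topW hv)).and
    ((CP.exists (c_conW hv.weaken ha.weaken hb.weaken hx.weaken (c_readW hτ hx).weaken .last)).not.or
      (CP.exists ((c_conW hv.weaken ha.weaken hb.weaken hx.weaken (c_readW hτ hx).weaken .last).and
        (CP.exists ((c_conW hv.weaken.weaken ha.weaken.weaken hb.weaken.weaken .last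
          (c_readW hτ.weaken.weaken .last) C.last.weaken).and
          (CP.lt (c_keyW ha.weaken.weaken hb.weaken.weaken .last (c_readW hτ.weaken.weaken .last)
            C.last.weaken)
            (c_keyW ha.weaken.weaken hb.weaken.weaken hx.weaken.weaken
              (c_readW hτ hx).weaken.weaken C.last.weaken)))))))

theorem c_stepW {τ : E → ℕ → ℕ} (hτ : HasTab Λ τ) (hv : C Λ v) (ha : C Λ a) (hb : C Λ b)
    (hx : C Λ x) : C Λ fun e => stepW (Λ.word e) (v e) (a e) (b e) (τ e) (x e) :=
  C.ite (c_rejW hτ hv ha hb hx) ((c_readW hτ hx).add (.const 1)) (c_readW hτ hx)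

theorem c_posW (hv : C Λ v) (ha : C Λ a) (hb : C Λ b) (hx : C Λ x) :
    C Λ fun e => posW (Λ.word e) (v e) (a e) (b e) (x e) :=
  C.iterate (init := fun _ _ => 0) (step := fun e => stepW (Λ.word e) (v e) (a e) (b e))
    (out := fun e T => readW (Λ.word e) T (x e)) (.const 0)
    (c_stepW (Λ := Λ.tab.var) HasTab.last.weaken hv.weaken_tab.weaken ha.weaken_tab.weaken
      hb.weaken_tab.weaken .last)
    (c_readW (Λ := Λ.tab) HasTab.last hx.weaken_tab)

theorem c_pairW (hv : C Λ v) (ha : C Λ a) (hb : C Λ b) (hx : C Λ x) (hy : C Λ y) :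
    CP Λ fun e => pairW (Λ.word e) (v e) (a e) (b e) (x e) (y e) :=
  c_conW hv ha hb hx (c_posW hv ha hb hx) hy

theorem c_succW (hv : C Λ v) (ha : C Λ a) (hb : C Λ b) :
    CP Λ fun e => succW (Λ.word e) (v e) (a e) (b e) :=
  ((CP.lt ha c_nW).and ((c_edgeW ha hb).and
    ((CP.exists ((CP.lt .last c_nW).and ((c_difW .last ((c_nW.add c_mW).add .last)).and
      (CP.eq .last ha.weaken).not))).not.and
    ((CP.exists ((CP.lt .last c_mW).and ((c_difW (c_nW.add .last)
      (((c_nW.add c_mW).add c_nW).add .last)).and (CP.eq .last hb.weaken).not))).not.and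
    (CP.eq (c_posW hv ha hb ha) ((C.ite (CP.eq hv (.const 2)) c_boundW (.const 0)).add
      (c_rwW ha hb ha hb))))))).or
  ((CP.le c_nW ha).and
    ((CP.exists ((CP.lt .last c_nW).and ((c_difW .last ((c_nW.add c_mW).add .last)).and
      (CP.exists (c_pairW hv.weaken.weaken ha.weaken.weaken hb.weaken.weaken C.last.weaken
        .last))))).not.and
    (CP.exists ((CP.lt .last c_mW).and ((c_difW (c_nW.add .last)
      (((c_nW.add c_mW).add c_nW).add .last)).and
      (CP.exists (c_pairW hv.weaken.weaken ha.weaken.weaken hb.weaken.weaken .last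
        C.last.weaken))))).not))

theorem c_kindW (h₀ : C Λ v₀) (hv : C Λ v) : CP Λ fun e => kindW (Λ.word e) (v₀ e) (v e) :=
  (CP.le h₀ hv).and ((CP.lt hv (.const 3)).and
    (CP.exists (CP.exists (c_succW hv.weaken.weaken C.last.weaken .last))))

theorem c_foundW (h₀ : C Λ v₀) : CP Λ fun e => foundW (Λ.word e) (v₀ e) :=
  CP.exists (c_kindW h₀.weaken .last)

theorem c_vW (h₀ : C Λ v₀) : C Λ fun e => vW (Λ.word e) (v₀ e) :=
  C.least (c_kindW h₀.weaken .last)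

theorem c_aW (h₀ : C Λ v₀) : C Λ fun e => aW (Λ.word e) (v₀ e) :=
  C.least (CP.exists (c_succW (c_vW h₀).weaken.weaken C.last.weaken .last))

theorem c_bW (h₀ : C Λ v₀) : C Λ fun e => bW (Λ.word e) (v₀ e) :=
  C.least (c_succW (c_vW h₀).weaken (c_aW h₀).weaken .last)

theorem c_outPairW (h₀ : C Λ v₀) (hx : C Λ x) (hy : C Λ y) :
    CP Λ fun e => outPairW (Λ.word e) (v₀ e) (x e) (y e) :=
  c_pairW (c_vW h₀) (c_aW h₀) (c_bW h₀) hx hy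

theorem c_matchedW (h₀ : C Λ v₀) (hx : C Λ x) :
    CP Λ fun e => matchedW (Λ.word e) (v₀ e) (x e) :=
  CP.exists (c_outPairW h₀.weaken hx.weaken .last)

theorem c_partnerW (h₀ : C Λ v₀) (hx : C Λ x) : C Λ fun e => partnerW (Λ.word e) (v₀ e) (x e) :=
  C.least (c_outPairW h₀.weaken hx.weaken .last)

theorem c_countW (h₀ : C Λ v₀) (hx : C Λ x) : C Λ fun e => countW (Λ.word e) (v₀ e) (x e) :=
  C.sum (C.ite ((CP.lt .last hx.weaken).and (c_matchedW h₀.weaken .last)) (.const 1) (.const 0))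

theorem c_nthW (h₀ : C Λ v₀) (hi : C Λ i) : C Λ fun e => nthW (Λ.word e) (v₀ e) (i e) :=
  C.least ((c_matchedW h₀.weaken .last).and (CP.eq (c_countW h₀.weaken .last) hi.weaken))

theorem c_halfW (hk : C Λ k) : C Λ fun e => halfW (Λ.word e) (k e) :=
  C.sum (C.ite (CP.le ((C.last.add .last).add (.const 2)) hk.weaken) (.const 1) (.const 0))

theorem c_outLenW (h₀ : C Λ v₀) : C Λ fun e => outLenW (Λ.word e) (v₀ e) :=
  C.ite (c_foundW h₀) (((c_countW h₀ c_nW).add (c_countW h₀ c_nW)).add (.const 1)) (.const 1)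

theorem c_outW (h₀ : C Λ v₀) (hk : C Λ k) : C Λ fun e => outW (Λ.word e) (v₀ e) (k e) :=
  have hk1 := hk.sub (.const 1)
  C.ite (CP.eq hk (.const 0)) (C.ite (c_foundW h₀) (.const 1) (.const 0))
    (C.ite (CP.eq hk1 ((c_halfW hk1).add (c_halfW hk1))) (c_nthW h₀ (c_halfW hk1))
      (c_partnerW h₀ (c_nthW h₀ (c_halfW hk1))))

end Computable

end RobustAlg

/-! ## Reading the input word -/

namespace RobustAlg

open RAM

/-- The numbers `n` and `m`, followed by the lists in `bs`, each preceded by its length. -/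
def blockWord (n m : ℕ) (bs : List (List ℕ)) : List ℕ :=
  n :: m :: bs.flatMap fun l => l.length :: l

section BlockWord

variable {n m : ℕ} {bs : List (List ℕ)} {i i' : ℕ} {l l' : List ℕ}

theorem length_le_loopBound (k : ℕ) : k ≤ loopBound k := by
  have := Nat.le_mul_self k
  unfold loopBound; nlinarith

theorem length_flatMap_ge (bs : List (List ℕ)) :
    bs.length ≤ (bs.flatMap fun l => l.length :: l).length := by
  induction bs with
  | nil => simp
  | cons l bs ih => simp only [List.flatMap_cons, List.length_append, List.length_cons]; omega

theorem length_blockWord : bs.length + 2 ≤ (blockWord n m bs).length := by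
  have := length_flatMap_ge bs
  simp only [blockWord, List.length_cons]; omega

/-- Phrased by the remaining suffix, so that one step of the recursion reads the length at its head
and skips one list. The recursion stands still after `i` rounds, and the loop bound allows for that
many. -/
theorem drop_startW (hi : i ≤ bs.length) :
    (blockWord n m bs).drop (startW (blockWord n m bs) i) =
      (bs.drop i).flatMap fun l => l.length :: l := by
  classical
  have key : ∀ t, (blockWord n m bs).drop (Nat.rec (motive := fun _ => ℕ) 2
      (fun t acc => if t < i then acc + 1 + (blockWord n m bs).getD acc 0 else acc) t) =
      (bs.drop (min t i)).flatMap fun l => l.length :: l := by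
    intro t
    induction t with
    | zero => simp [blockWord]
    | succ t ih =>
      by_cases ht : t < i
      · rw [min_eq_left ht.le, List.drop_eq_getElem_cons (by omega : t < bs.length),
          List.flatMap_cons, List.cons_append] at ih
        rw [min_eq_left ht]
        dsimp only
        rw [if_pos ht]
        generalize (Nat.rec (motive := fun _ => ℕ) 2
          (fun t acc => if t < i then acc + 1 + (blockWord n m bs).getD acc 0 else acc) t : ℕ)
          = p at ih ⊢
        have hp : (blockWord n m bs).getD p 0 = bs[t].length := by
          have := congrArg (fun l => l[0]?) ih
          simp only [List.getElem?_drop, List.getElem?_cons_zero, add_zero] at this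
          simp [List.getD, this]
        rw [hp, add_assoc, ← List.drop_drop, ih, add_comm, List.drop_succ_cons,
          List.drop_left]
      · dsimp only
        rw [if_neg ht, ih, min_eq_right (by omega), min_eq_right (by omega)]
  have h1 := length_blockWord (n := n) (m := m) (bs := bs)
  have h2 := length_le_loopBound (blockWord n m bs).length
  have := key (loopBound (blockWord n m bs).length)
  rw [min_eq_right (by omega)] at this
  rw [← this]
  unfold startW
  congr!

theorem drop_startW_of_getElem? (h : bs[i]? = some l) :
    ∃ r, (blockWord n m bs).drop (startW (blockWord n m bs) i) = l.length :: (l ++ r) := by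
  obtain ⟨hi, rfl⟩ := List.getElem?_eq_some_iff.1 h
  rw [drop_startW hi.le, List.drop_eq_getElem_cons hi, List.flatMap_cons, List.cons_append]
  exact ⟨_, rfl⟩

theorem lenW_eq (h : bs[i]? = some l) : lenW (blockWord n m bs) i = l.length := by
  obtain ⟨r, hr⟩ := drop_startW_of_getElem? (n := n) (m := m) h
  have := congrArg (fun l => l[0]?) hr
  simp only [List.getElem?_drop, List.getElem?_cons_zero, add_zero] at this
  simp [lenW, List.getD, this]

theorem entW_eq (h : bs[i]? = some l) {k : ℕ} (hk : k < l.length) :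
    entW (blockWord n m bs) i k = l[k] := by
  obtain ⟨r, hr⟩ := drop_startW_of_getElem? (n := n) (m := m) h
  have := congrArg (fun l => l[k + 1]?) hr
  simp only [List.getElem?_drop, List.getElem?_cons_succ, List.getElem?_append_left hk,
    List.getElem?_eq_getElem hk] at this
  simp [entW, List.getD, add_assoc, add_comm 1 k, this]

theorem length_lt_loopBound (h : bs[i]? = some l) :
    l.length < loopBound (blockWord n m bs).length := by
  obtain ⟨r, hr⟩ := drop_startW_of_getElem? (n := n) (m := m) h
  have := congrArg List.length hr
  simp only [List.length_drop, List.length_cons, List.length_append] at this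
  have := length_le_loopBound (blockWord n m bs).length
  omega

theorem memW_iff (h : bs[i]? = some l) {z : ℕ} : memW (blockWord n m bs) i z ↔ z ∈ l := by
  have hl := length_lt_loopBound (n := n) (m := m) h
  unfold memW
  rw [lenW_eq h, List.mem_iff_getElem]
  constructor
  · rintro ⟨k, -, hk, he⟩
    exact ⟨k, hk, by rw [← he, entW_eq h hk]⟩
  · rintro ⟨k, hk, he⟩
    exact ⟨k, hk.trans hl, hk, by rw [entW_eq h hk, he]⟩

/-- Without duplicates the sum has at most one nonzero term, the position of `z`. -/
theorem idxW_eq (h : bs[i]? = some l) (hl : l.Nodup) {z : ℕ} (hz : z ∈ l) :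
    idxW (blockWord n m bs) i z = l.idxOf z := by
  have hlen := length_lt_loopBound (n := n) (m := m) h
  have hk := List.idxOf_lt_length_iff.2 hz
  unfold idxW
  rw [Finset.sum_eq_single (l.idxOf z)]
  · rw [if_pos]
    exact ⟨by rwa [lenW_eq h], by rw [entW_eq h hk, List.getElem_idxOf]⟩
  · intro k _ hne
    rw [if_neg]
    rintro ⟨h1, h2⟩
    rw [lenW_eq h] at h1
    rw [entW_eq h h1] at h2
    exact hne (by rw [← h2, hl.idxOf_getElem])
  · intro hno
    exact absurd (Finset.mem_range.2 (hk.trans hlen)) hno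

theorem difW_iff (h : bs[i]? = some l) (h' : bs[i']? = some l') (hlen : l.length = l'.length) :
    difW (blockWord n m bs) i i' ↔ l ≠ l' := by
  have hl := length_lt_loopBound (n := n) (m := m) h
  unfold difW
  rw [lenW_eq h]
  constructor
  · rintro ⟨k, -, hk, he⟩ rfl
    rw [entW_eq h hk, entW_eq h' hk] at he
    exact he rfl
  · intro hne
    by_contra! hno
    refine hne (List.ext_getElem hlen fun k hk hk' => ?_)
    rw [← entW_eq (n := n) (m := m) h hk, ← entW_eq (n := n) (m := m) h' hk']
    exact hno k (hk.trans hl) hk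

end BlockWord

end RobustAlg

/-! ### The encoding of an instance pair as a word of preference lists -/

namespace InstancePair

open RobustAlg RAM

/-- The preference lists in the input word. -/
def blocks (P : InstancePair) : List (List ℕ) :=
  (List.ofFn fun x => (P.A.worker x).map Fin.val) ++ ((List.ofFn fun y => (P.A.firm y).map Fin.val) ++
    ((List.ofFn fun x => (P.B.worker x).map Fin.val) ++ List.ofFn fun y => (P.B.firm y).map Fin.val))

theorem encodeList_eq {k : ℕ} (l : List (Fin k)) : encodeList l = l.length :: l.map Fin.val := by
  have : (l >>= fun y => pure (y : ℕ)) = l.map Fin.val := by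
    induction l with
    | nil => rfl
    | cons y l ih => exact congrArg (List.cons (y : ℕ)) ih
  rw [encodeList, this, List.map_id']

theorem encode_eq (P : InstancePair) : P.encode = blockWord P.n P.m P.blocks := by
  simp only [encode, encodeInstance, blockWord, blocks, List.flatMap_append, List.ofFn_eq_map,
    List.flatMap_map, List.length_map, List.append_assoc, encodeList_eq]

variable {P : InstancePair}

theorem blocks_worker_left (x : Fin P.n) :
    P.blocks[(x : ℕ)]? = some ((P.A.worker x).map Fin.val) := by
  rw [blocks, List.getElem?_append_left (by simp)]
  simp

theorem blocks_firm_left (y : Fin P.m) :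
    P.blocks[P.n + y]? = some ((P.A.firm y).map Fin.val) := by
  rw [blocks, List.getElem?_append_right (by simp), List.getElem?_append_left (by simp)]
  simp

theorem blocks_worker_right (x : Fin P.n) :
    P.blocks[P.n + P.m + x]? = some ((P.B.worker x).map Fin.val) := by
  rw [blocks, List.getElem?_append_right (by simp; omega),
    List.getElem?_append_right (by simp; omega), List.getElem?_append_left (by simp; omega)]
  simp [show P.n + P.m + (x : ℕ) - P.n - P.m = x by omega]

theorem blocks_firm_right (y : Fin P.m) :
    P.blocks[P.n + P.m + P.n + y]? = some ((P.B.firm y).map Fin.val) := by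
  rw [blocks, List.getElem?_append_right (by simp; omega),
    List.getElem?_append_right (by simp; omega), List.getElem?_append_right (by simp; omega)]
  simp [show P.n + P.m + P.n + (y : ℕ) - P.n - P.m - P.n = y by omega]

theorem idxOf_map_val {k : ℕ} (l : List (Fin k)) (z : Fin k) :
    (l.map Fin.val).idxOf (z : ℕ) = l.idxOf z := by
  induction l with
  | nil => rfl
  | cons a l ih => simp [List.idxOf_cons, ih, Fin.ext_iff, beq_eq_decide]

theorem idxW_map_val {i k : ℕ} {l : List (Fin k)} (h : P.blocks[i]? = some (l.map Fin.val))
    (hl : l.Nodup) {z : Fin k} (hz : z ∈ l) : idxW P.encode i z = l.idxOf z := by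
  rw [encode_eq, idxW_eq h (hl.map Fin.val_injective) (List.mem_map_of_mem hz), idxOf_map_val]

theorem difW_map_val {i i' k : ℕ} {l l' : List (Fin k)} (h : P.blocks[i]? = some (l.map Fin.val))
    (h' : P.blocks[i']? = some (l'.map Fin.val)) (hl : l.Nodup) (hl' : l'.Nodup)
    (hm : ∀ z, z ∈ l ↔ z ∈ l') : difW P.encode i i' ↔ l ≠ l' := by
  rw [encode_eq, difW_iff h h' (by
    simpa using ((List.perm_ext_iff_of_nodup hl hl').2 hm).length_eq)]
  exact not_congr (List.map_injective_iff.2 Fin.val_injective).eq_iff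

theorem idxOf_lt {k : ℕ} {l : List (Fin k)} (hl : l.Nodup) {z : Fin k} (hz : z ∈ l) :
    l.idxOf z < k := by
  have h := hl.length_le_card
  rw [Fintype.card_fin] at h
  exact (List.idxOf_lt_length_iff.2 hz).trans_le h

theorem edgeW_iff {x : Fin P.n} {y : Fin P.m} : edgeW P.encode x y ↔ P.A.Edge x y := by
  have h : memW P.encode x y ↔ y ∈ P.A.worker x := by
    rw [encode_eq, memW_iff (blocks_worker_left x)]
    simp [Fin.val_inj]
  exact ⟨fun h' => h.1 h'.2.2, fun h' => ⟨x.2, y.2, h.2 h'⟩⟩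

theorem OneAgentPerturbed.firm_mem_iff (hP : P.OneAgentPerturbed) {y : Fin P.m} (x : Fin P.n) :
    x ∈ P.A.firm y ↔ x ∈ P.B.firm y := by
  rw [← P.A.mem_worker_iff, ← P.B.mem_worker_iff]
  exact hP.1 x y

theorem OneAgentPerturbed.difW_worker_iff (hP : P.OneAgentPerturbed) (x : Fin P.n) :
    difW P.encode x (P.n + P.m + x) ↔ P.A.worker x ≠ P.B.worker x :=
  difW_map_val (blocks_worker_left x) (blocks_worker_right x) (P.A.worker_nodup x)
    (P.B.worker_nodup x) (hP.1 x)

theorem OneAgentPerturbed.difW_firm_iff (hP : P.OneAgentPerturbed) (y : Fin P.m) :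
    difW P.encode (P.n + y) (P.n + P.m + P.n + y) ↔ P.A.firm y ≠ P.B.firm y :=
  difW_map_val (blocks_firm_left y) (blocks_firm_right y) (P.A.firm_nodup y)
    (P.B.firm_nodup y) fun _ => hP.firm_mem_iff _

/-- The bound on the rounds of deferred acceptance. -/
theorem lt_loopBound_encode (P : InstancePair) {L : ℕ} (hL : L ≤ 2) :
    P.n * (L * boundW P.encode) < loopBound P.encode.length := by
  have h1 : P.blocks.length = P.n + P.m + (P.n + P.m) := by simp [blocks]; omega
  have h2 := length_blockWord (n := P.n) (m := P.m) (bs := P.blocks)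
  rw [h1, ← encode_eq] at h2
  change P.n * (L * (P.n + P.m + (P.n + P.m) + 2)) < _
  unfold loopBound
  generalize P.encode.length = k at *
  -- By `h2` the word has length `k` at least `boundW`, so the left side is at most `2 * k * k`.
  nlinarith [Nat.mul_le_mul hL h2, Nat.mul_le_mul h2 h2, Nat.mul_le_mul_right (P.n + P.m + (P.n + P.m) + 2) hL, Nat.mul_le_mul_left P.n (Nat.mul_le_mul_right (P.n + P.m + (P.n + P.m) + 2) hL)]

theorem lt_loopBound_worker (P : InstancePair) : P.n + P.n + 1 < loopBound P.encode.length := by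
  have h := P.lt_loopBound_encode le_rfl
  change P.n * (2 * (P.n + P.m + (P.n + P.m) + 2)) < _ at h
  unfold loopBound at *
  rcases Nat.eq_zero_or_pos P.n with h0 | h0
  · rw [h0]; omega
  · nlinarith

theorem lt_loopBound_firm (P : InstancePair) : P.m < loopBound P.encode.length := by
  have h1 : P.blocks.length = P.n + P.m + (P.n + P.m) := by simp [blocks]; omega
  have h2 := length_blockWord (n := P.n) (m := P.m) (bs := P.blocks)
  have h3 := length_le_loopBound P.encode.length
  rw [h1, ← encode_eq] at h2
  omega

end InstancePair

/-! ### Ranks in the hybrid lists -/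

namespace RobustAlg

variable {w : List ℕ} {i i' t z z' k : ℕ}

theorem hybW_lt (hk : k ≤ nW w + mW w) (hz : idxW w i z < k) : hybW w i i' t z < boundW w := by
  unfold hybW boundW; split_ifs <;> omega

/-- The three branches have values below, at and above `nW w + mW w`, so equal ranks come from the
same branch. -/
theorem hybW_inj (hk : k ≤ nW w + mW w) (hz : idxW w i z < k) (hz' : idxW w i z' < k)
    (h : hybW w i i' t z = hybW w i i' t z') : idxW w i z = idxW w i z' ∨ z = z' := by
  unfold hybW at h; split_ifs at h <;> omega

theorem hybW_lt_iff (hk : k ≤ nW w + mW w) (hz : idxW w i z < k) :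
    hybW w i i' t z < hybW w i i' t t ↔
      idxW w i z < idxW w i t ∨ idxW w i' z < idxW w i' t := by
  unfold hybW
  simp only [lt_irrefl, or_self, if_false, if_true]
  split_ifs with h1 h2
  · simp only [h1, iff_true]; omega
  · simp [h1]
  · simp only [h1, iff_false]; omega

end RobustAlg

namespace Pref

variable {W F : Type*} {R R' : Pref W F} {M : Finset (W × F)} {L : ℕ} {l : W → ℕ}

/-- Stability only inspects ranks along edges, and the ranks read from the word are meaningful only
there. -/
theorem LStable.congr (h : R.LStable L M l) (hE : R.E = R'.E)
    (hw : ∀ x y, R'.E x y → R.rw x y = R'.rw x y) (hf : ∀ x y, R'.E x y → R.rf y x = R'.rf y x) :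
    R'.LStable L M l := by
  refine ⟨hE ▸ h.matching, h.lt_L, h.unmatched, h.allowed, fun {x y j} hxy hj _ hb => ?_⟩
  have hM : IsMatchingOf R'.E M := hE ▸ h.matching
  obtain ⟨x', hx', h'⟩ := h.not_block (hE ▸ hxy) hj trivial (hb.imp_right fun hb =>
    ⟨hb.1, fun y' hy' => by rw [hw x y hxy, hw x y' (hM.edge hy')]; exact hb.2 y' hy'⟩)
  rw [hf x y hxy, hf x' y (hM.edge hx')] at h'
  exact ⟨x', hx', h'⟩

end Pref

/-! ### The hybrid instance and deferred acceptance for a candidate -/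

namespace InstancePair.OneAgentPerturbed

open RobustAlg RAM

variable {P : InstancePair} {x : Fin P.n} {y : Fin P.m}

theorem idx_worker (hP : P.OneAgentPerturbed) (h : P.A.Edge x y) :
    idxW P.encode x y = P.A.pref.rw x y ∧ idxW P.encode (P.n + P.m + x) y = P.B.pref.rw x y ∧
      idxW P.encode x y < P.m := by
  have h1 := idxW_map_val (blocks_worker_left x) (P.A.worker_nodup x) h
  exact ⟨h1, idxW_map_val (blocks_worker_right x) (P.B.worker_nodup x) ((hP.1 x y).1 h),
    h1 ▸ idxOf_lt (P.A.worker_nodup x) h⟩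

theorem idx_firm (hP : P.OneAgentPerturbed) (h : P.A.Edge x y) :
    idxW P.encode (P.n + y) x = P.A.pref.rf y x ∧
      idxW P.encode (P.n + P.m + P.n + y) x = P.B.pref.rf y x ∧
      idxW P.encode (P.n + y) x < P.n := by
  have h' := (P.A.mem_worker_iff x y).1 h
  have h1 := idxW_map_val (blocks_firm_left y) (P.A.firm_nodup y) h'
  exact ⟨h1, idxW_map_val (blocks_firm_right y) (P.B.firm_nodup y) ((hP.firm_mem_iff x).1 h'),
    h1 ▸ idxOf_lt (P.A.firm_nodup y) h'⟩

variable (hP : P.OneAgentPerturbed)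

/-- The hybrid of the two instances for the target edge `(a, b)`. -/
noncomputable def hybrid (a b : ℕ) : Pref (Fin P.n) (Fin P.m) where
  E := P.A.Edge
  rw x y := rwW P.encode a b x y
  rf y x := rfW P.encode a b y x
  rw_inj {x y y'} hy hy' h := by
    have h1 := hP.idx_worker hy
    have h2 := hP.idx_worker hy'
    have h3 : idxW P.encode x y = idxW P.encode x y' ∨ (y : ℕ) = y' := by
      unfold rwW at h
      split_ifs at h
      · exact hybW_inj (Nat.le_add_left _ _) h1.2.2 h2.2.2 h
      · exact Or.inl h
    rcases h3 with h3 | h3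
    · rw [h1.1, h2.1] at h3
      exact P.A.pref.rw_inj hy hy' h3
    · exact Fin.ext h3
  rf_inj {x x' y} hx hx' h := by
    have h1 := hP.idx_firm hx
    have h2 := hP.idx_firm hx'
    have h3 : idxW P.encode (P.n + y) x = idxW P.encode (P.n + y) x' ∨ (x : ℕ) = x' := by
      unfold rfW at h
      split_ifs at h
      · exact hybW_inj (Nat.le_add_right _ _) h1.2.2 h2.2.2 h
      · exact Or.inl h
    rcases h3 with h3 | h3
    · rw [h1.1, h2.1] at h3
      exact P.A.pref.rf_inj hx hx' h3
    · exact Fin.ext h3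

theorem hybrid_bounded (a b : ℕ) : (hP.hybrid a b).Bounded (boundW P.encode) := by
  intro x y h
  have h1 := hP.idx_worker h
  have h2 := hP.idx_firm h
  have hb : boundW P.encode = P.n + P.m + (P.n + P.m) + 2 := rfl
  constructor
  · change rwW _ _ _ _ _ < _
    unfold rwW
    split_ifs
    · exact hybW_lt (Nat.le_add_left _ _) h1.2.2
    · omega
  · change rfW _ _ _ _ _ < _
    unfold rfW
    split_ifs
    · exact hybW_lt (Nat.le_add_right _ _) h2.2.2
    · change idxW P.encode (P.n + y) x < _
      omega

theorem hybrid_rw {a b : ℕ} (h : P.A.Edge x y) (hx : (x : ℕ) ≠ a) :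
    (hP.hybrid a b).rw x y = P.A.pref.rw x y :=
  (if_neg hx).trans (hP.idx_worker h).1

theorem hybrid_rf {a b : ℕ} (h : P.A.Edge x y) (hy : P.n ≤ a ∨ (y : ℕ) ≠ b) :
    (hP.hybrid a b).rf y x = P.A.pref.rf y x := by
  refine (if_neg ?_).trans (hP.idx_firm h).1
  rintro ⟨h1, h2⟩
  rcases hy with hy | hy
  · exact absurd h1 (not_lt.2 hy)
  · exact hy h2

theorem isHybrid_of_mem {M : Finset (Fin P.n × Fin P.m)} (hM : IsMatchingOf P.A.Edge M)
    {a : Fin P.n} {b : Fin P.m} (hab : (a, b) ∈ M)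
    (hw : ∀ x, x ≠ a → P.A.worker x = P.B.worker x)
    (hf : ∀ y, y ≠ b → P.A.firm y = P.B.firm y) :
    Pref.IsHybrid P.A.pref P.B.pref (hP.hybrid a b) M := by
  refine ⟨rfl, funext₂ fun x y => propext (hP.1 x y), fun {x y z} hxy hz => ?_,
    fun {x y z} hxy hz => ?_⟩
  · by_cases hx : x = a
    · subst hx
      obtain rfl := hM.firm_unique hxy hab
      have h1 := hP.idx_worker (hM.edge hxy)
      have h2 := hP.idx_worker hz
      rw [← h1.1, ← h1.2.1, ← h2.1, ← h2.2.1]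
      change rwW _ _ _ _ _ < rwW _ _ _ _ _ ↔ _
      unfold rwW
      rw [if_pos rfl, if_pos rfl]
      exact hybW_lt_iff (Nat.le_add_left _ _) h2.2.2
    · have hx' : (x : ℕ) ≠ a := fun h => hx (Fin.ext h)
      rw [hP.hybrid_rw (hM.edge hxy) hx', hP.hybrid_rw hz hx']
      change _ ↔ _ ∨ (P.B.worker x).idxOf z < (P.B.worker x).idxOf y
      rw [← hw x hx]
      exact (or_self_iff).symm
  · by_cases hy : y = b
    · subst hy
      obtain rfl := hM.worker_unique hxy hab
      have h1 := hP.idx_firm (hM.edge hxy)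
      have h2 := hP.idx_firm hz
      rw [← h1.1, ← h1.2.1, ← h2.1, ← h2.2.1]
      change rfW _ _ _ _ _ < rfW _ _ _ _ _ ↔ _
      unfold rfW
      rw [if_pos ⟨x.2, rfl⟩, if_pos ⟨x.2, rfl⟩]
      exact hybW_lt_iff (Nat.le_add_right _ _) h2.2.2
    · have hy' : P.n ≤ (a : ℕ) ∨ (y : ℕ) ≠ b := Or.inr fun h => hy (Fin.ext h)
      rw [hP.hybrid_rf (hM.edge hxy) hy', hP.hybrid_rf hz hy']
      change _ ↔ _ ∨ (P.B.firm y).idxOf z < (P.B.firm y).idxOf x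
      rw [← hf y hy]
      exact (or_self_iff).symm

theorem isHybrid_of_not_mem {M : Finset (Fin P.n × Fin P.m)} (hM : IsMatchingOf P.A.Edge M)
    {a b : ℕ} (ha : P.n ≤ a) (hw : ∀ x y, (x, y) ∈ M → P.A.worker x = P.B.worker x)
    (hf : ∀ x y, (x, y) ∈ M → P.A.firm y = P.B.firm y) :
    Pref.IsHybrid P.A.pref P.B.pref (hP.hybrid a b) M := by
  refine ⟨rfl, funext₂ fun x y => propext (hP.1 x y), fun {x y z} hxy hz => ?_,
    fun {x y z} hxy hz => ?_⟩
  · have hx : (x : ℕ) ≠ a := (x.2.trans_le ha).ne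
    rw [hP.hybrid_rw (hM.edge hxy) hx, hP.hybrid_rw hz hx]
    change _ ↔ _ ∨ (P.B.worker x).idxOf z < (P.B.worker x).idxOf y
    rw [← hw x y hxy]
    exact (or_self_iff).symm
  · rw [hP.hybrid_rf (hM.edge hxy) (Or.inl ha), hP.hybrid_rf hz (Or.inl ha)]
    change _ ↔ _ ∨ (P.B.firm y).idxOf z < (P.B.firm y).idxOf x
    rw [← hf x y hxy]
    exact (or_self_iff).symm

/-- The number of levels of the candidates of kind `v`. -/
def numLevels (v : ℕ) : ℕ := if v = 0 then 1 else 2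

theorem numLevels_le (v : ℕ) : numLevels v ≤ 2 := by unfold numLevels; split_ifs <;> omega

theorem one_le_numLevels (v : ℕ) : 1 ≤ numLevels v := by unfold numLevels; split_ifs <;> omega

/-- The market of the candidate `(v, a, b)`. -/
noncomputable def candidateMarket (v a b : ℕ) : Market (Fin P.n) (Fin P.m) :=
  (hP.hybrid a b).market (numLevels_le v) (hP.hybrid_bounded a b)
    fun x y j => okW P.encode v a b x y j

theorem conW_iff {v a b q : ℕ} :
    conW P.encode v a b x q y ↔ (hP.candidateMarket v a b).Pr x q y := by
  unfold candidateMarket conW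
  rw [Pref.market_Pr, edgeW_iff]
  refine and_congr_right fun _ => ?_
  change (q = (hP.hybrid a b).rw x y ∧ _ ∨ _ ∧ q = _ + (hP.hybrid a b).rw x y ∧ _) ↔ _
  unfold numLevels
  constructor
  · rintro (⟨h1, h2⟩ | ⟨h1, h2, h3⟩)
    · exact ⟨0, by split_ifs <;> omega, by omega, h2⟩
    · exact ⟨1, by rw [if_neg h1]; omega, by omega, h3⟩
  · rintro ⟨j, hj, h1, h2⟩
    split_ifs at hj with hv
    · obtain rfl : j = 0 := by omega
      exact Or.inl ⟨by omega, h2⟩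
    · obtain rfl | rfl : j = 0 ∨ j = 1 := by omega
      · exact Or.inl ⟨by omega, h2⟩
      · exact Or.inr ⟨hv, by omega, h2⟩

theorem topW_eq (v a b : ℕ) : topW P.encode v = (hP.candidateMarket v a b).K := by
  change topW P.encode v = numLevels v * boundW P.encode
  unfold topW numLevels
  split_ifs <;> ring

theorem readW_eq (T : ℕ → ℕ) (x : Fin P.n) : readW P.encode T x = T x := by
  have := P.lt_loopBound_worker
  unfold readW
  rw [if_pos (by have := x.2; omega)]

theorem rejW_iff {v a b : ℕ} {T : ℕ → ℕ} :
    rejW P.encode v a b T x ↔ (hP.candidateMarket v a b).Rejected (fun x => T x) x := by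
  have hn := P.lt_loopBound_worker
  have hm := P.lt_loopBound_firm
  unfold rejW Market.Rejected
  rw [hP.topW_eq v a b, readW_eq]
  refine and_congr_right fun _ => or_congr ?_ ?_
  · constructor
    · intro h y hy
      exact h ⟨y, y.2.trans hm, hP.conW_iff.2 hy⟩
    · rintro h ⟨y, -, hy⟩
      exact h ⟨y, hy.1.2.1⟩ (hP.conW_iff.1 hy)
  · constructor
    · rintro ⟨y, -, hy, x', -, hx', hlt⟩
      lift y to Fin P.m using hy.1.2.1
      lift x' to Fin P.n using hx'.1.1
      rw [readW_eq] at hx' hlt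
      exact ⟨y, hP.conW_iff.1 hy, x', hP.conW_iff.1 hx', hlt⟩
    · rintro ⟨y, hy, x', hx', hlt⟩
      refine ⟨y, y.2.trans hm, hP.conW_iff.2 hy, x', by have := x'.2; omega, ?_⟩
      rw [readW_eq]
      exact ⟨hP.conW_iff.2 hx', hlt⟩

theorem posW_eq (v a b : ℕ) (x : Fin P.n) : posW P.encode v a b x =
    (hP.candidateMarket v a b).run (loopBound P.encode.length) x := by
  unfold posW
  rw [readW_eq]
  generalize loopBound P.encode.length = t
  have : (fun x : Fin P.n => (stepW P.encode v a b)^[t] (fun _ => 0) x) =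
      (hP.candidateMarket v a b).run t := by
    induction t with
    | zero => rfl
    | succ t ih =>
      rw [Market.run_succ, ← ih]
      funext x
      rw [Function.iterate_succ_apply']
      generalize (stepW P.encode v a b)^[t] (fun _ => 0) = T
      simp only [stepW, Market.step, readW_eq]
      have h : rejW P.encode v a b T x ↔
          (hP.candidateMarket v a b).Rejected (fun x => T x) x := hP.rejW_iff
      by_cases hr : rejW P.encode v a b T x
      · rw [if_pos hr, if_pos (h.1 hr)]
      · rw [if_neg hr, if_neg (mt h.2 hr)]
  exact congrFun this x

/-- The matching of the candidate `(v, a, b)`. -/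
noncomputable def candidateMatching (v a b : ℕ) : Finset (Fin P.n × Fin P.m) :=
  (hP.hybrid a b).posMatching (numLevels v) (boundW P.encode)
    ((hP.candidateMarket v a b).run (loopBound P.encode.length))

theorem card_mul_lt (v : ℕ) : Fintype.card (Fin P.n) * (numLevels v * boundW P.encode) <
    loopBound P.encode.length := by
  rw [Fintype.card_fin]
  exact P.lt_loopBound_encode (numLevels_le v)

theorem stable_run (v a b : ℕ) : (hP.candidateMarket v a b).Stable
    ((hP.candidateMarket v a b).run (loopBound P.encode.length)) :=
  (hP.candidateMarket v a b).stable_run (card_mul_lt v)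

theorem pairW_iff {v a b : ℕ} :
    pairW P.encode v a b x y ↔ (x, y) ∈ hP.candidateMatching v a b := by
  rw [candidateMatching, Pref.mem_posMatching (hP.stable_run v a b), pairW, hP.posW_eq]
  exact hP.conW_iff

end InstancePair.OneAgentPerturbed

/-! ### Soundness and completeness of the candidates -/

namespace InstancePair.OneAgentPerturbed

open RobustAlg RAM

variable {P : InstancePair} (hP : P.OneAgentPerturbed)

/-- No truncation takes place for candidates without a target edge. -/
theorem candidateMarket_of_le (v b : ℕ) {a : ℕ} (ha : P.n ≤ a) : hP.candidateMarket v a b =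
    (hP.hybrid a b).market (numLevels_le v) (hP.hybrid_bounded a b) fun _ _ _ => True := by
  refine congrArg _ (funext fun x => funext fun y => funext fun j => eq_true fun h => ?_)
  exact absurd h (not_lt.2 ha)

theorem candidateMarket_fin (v : ℕ) (a : Fin P.n) (b : Fin P.m) : hP.candidateMarket v a b =
    (hP.hybrid a b).market (numLevels_le v) (hP.hybrid_bounded a b)
      ((hP.hybrid a b).trunc a b (levW v)) := by
  refine congrArg _ (funext fun x => funext fun y => funext fun j => propext ?_)
  unfold okW Pref.trunc
  rw [← Fin.val_inj]
  exact ⟨fun h => h a.2, fun h _ => h⟩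

theorem levW_lt {v : ℕ} : levW v < numLevels v := by
  unfold levW numLevels; split_ifs <;> omega

theorem levW_mul (v D : ℕ) : levW v * D = if v = 2 then D else 0 := by
  unfold levW; split_ifs <;> simp

theorem lstable_of_le (v b : ℕ) {a : ℕ} (ha : P.n ≤ a) :
    ∃ l, (hP.hybrid a b).LStable (numLevels v) (hP.candidateMatching v a b) l := by
  have h := hP.stable_run v a b
  rw [hP.candidateMarket_of_le v b ha] at h
  have := Pref.rstable_of_stable (one_le_numLevels v) h
  rw [← hP.candidateMarket_of_le v b ha] at this
  exact ⟨_, this⟩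

theorem lstable_of_posW {v : ℕ} {a : Fin P.n} {b : Fin P.m} (hE : P.A.Edge a b)
    (h : posW P.encode v a b a =
      (if v = 2 then boundW P.encode else 0) + rwW P.encode a b a b) :
    (a, b) ∈ hP.candidateMatching v a b ∧
      ∃ l, (hP.hybrid a b).LStable (numLevels v) (hP.candidateMatching v a b) l := by
  rw [← levW_mul, hP.posW_eq, hP.candidateMarket_fin] at h
  have := Pref.lstable_of_run_trunc (card_mul_lt v) hE levW_lt h
  rw [← hP.candidateMarket_fin] at this
  exact ⟨this.1, _, this.2⟩

theorem posW_of_lstable {v : ℕ} {a : Fin P.n} {b : Fin P.m} {N : Finset (Fin P.n × Fin P.m)}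
    {l : Fin P.n → ℕ} (h : (hP.hybrid a b).LStable (numLevels v) N l) (hab : (a, b) ∈ N)
    (hl : l a = levW v) : posW P.encode v a b a =
      (if v = 2 then boundW P.encode else 0) + rwW P.encode a b a b := by
  rw [← levW_mul, hP.posW_eq, hP.candidateMarket_fin]
  exact Pref.run_trunc_eq (card_mul_lt v) h hab hl

/-- The matching of a successful candidate is stable in a hybrid of the two instances. -/
theorem lstable_of_succW {v a b : ℕ} (h : succW P.encode v a b) :
    (∃ l, (hP.hybrid a b).LStable (numLevels v) (hP.candidateMatching v a b) l) ∧
      Pref.IsHybrid P.A.pref P.B.pref (hP.hybrid a b) (hP.candidateMatching v a b) := by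
  have hn := P.lt_loopBound_worker
  have hm := P.lt_loopBound_firm
  rcases h with ⟨-, hE, hw, hf, hpos⟩ | ⟨ha, hw, hf⟩
  · lift a to Fin P.n using hE.1
    lift b to Fin P.m using hE.2.1
    obtain ⟨hab, l, hl⟩ := hP.lstable_of_posW (edgeW_iff.1 hE) hpos
    refine ⟨⟨l, hl⟩, hP.isHybrid_of_mem hl.matching hab (fun x hx => ?_) fun y hy => ?_⟩
    · by_contra hne
      exact hw ⟨x, by have := x.2; omega, x.2, (hP.difW_worker_iff x).2 hne,
        fun h => hx (Fin.ext h)⟩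
    · by_contra hne
      exact hf ⟨y, y.2.trans hm, y.2, (hP.difW_firm_iff y).2 hne, fun h => hy (Fin.ext h)⟩
  · obtain ⟨l, hl⟩ := hP.lstable_of_le v b ha
    refine ⟨⟨l, hl⟩, hP.isHybrid_of_not_mem hl.matching ha (fun x y hxy => ?_)
      fun x y hxy => ?_⟩
    · by_contra hne
      exact hw ⟨x, by have := x.2; omega, x.2, (hP.difW_worker_iff x).2 hne, y, y.2.trans hm,
        hP.pairW_iff.2 hxy⟩
    · by_contra hne
      exact hf ⟨y, y.2.trans hm, y.2, (hP.difW_firm_iff y).2 hne, x,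
        by have := x.2; omega, hP.pairW_iff.2 hxy⟩

theorem isRobustPopular_of_succW {v a b : ℕ} (h : succW P.encode v a b) :
    MatP.IsRobustPopular P.A P.B (hP.candidateMatching v a b) := by
  obtain ⟨⟨l, hl⟩, hH⟩ := hP.lstable_of_succW h
  have := hH.isPop (hl.isPop (one_le_numLevels v) (numLevels_le v))
  exact ⟨MatP.isPopular_iff.2 this.1, MatP.isPopular_iff.2 this.2⟩

theorem isRobustDominant_of_succW {v a b : ℕ} (hv : 1 ≤ v) (h : succW P.encode v a b) :
    MatP.IsRobustDominant P.A P.B (hP.candidateMatching v a b) := by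
  obtain ⟨⟨l, hl⟩, hH⟩ := hP.lstable_of_succW h
  rw [numLevels, if_neg (by omega)] at hl
  have := hH.isDom hl.isDom
  exact ⟨MatP.isDominant_iff.2 this.1, MatP.isDominant_iff.2 this.2⟩

theorem succW_of_lstable {v : ℕ} {a : Fin P.n} {b : Fin P.m} {N : Finset (Fin P.n × Fin P.m)}
    {l : Fin P.n → ℕ} (h : (hP.hybrid a b).LStable (numLevels v) N l) (hab : (a, b) ∈ N)
    (hl : l a = levW v) (hw : ∀ x, x ≠ a → P.A.worker x = P.B.worker x)
    (hf : ∀ y, y ≠ b → P.A.firm y = P.B.firm y) : succW P.encode v a b := by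
  refine Or.inl ⟨a.2, edgeW_iff.2 (h.matching.edge hab), ?_, ?_, hP.posW_of_lstable h hab hl⟩
  · rintro ⟨x, -, hx, hd, hne⟩
    lift x to Fin P.n using hx
    exact (hP.difW_worker_iff x).1 hd (hw x fun h => hne (congrArg _ h))
  · rintro ⟨y, -, hy, hd, hne⟩
    lift y to Fin P.m using hy
    exact (hP.difW_firm_iff y).1 hd (hf y fun h => hne (congrArg _ h))

/-- Without a target the hybrid has the ranks of A. All differing agents are unmatched in `M`, and
the comparison `h` keeps them unmatched in the candidate matching. -/
theorem succW_of_unmatched (hP : P.OneAgentPerturbed) {v : ℕ} {M : Finset (Fin P.n × Fin P.m)}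
    (hM : ∀ x y, (x, y) ∈ M → P.A.worker x = P.B.worker x ∧ P.A.firm y = P.B.firm y)
    (h : ∀ N l, P.A.pref.LStable (numLevels v) N l → (∀ x, (∀ y, (x, y) ∉ M) → ∀ y, (x, y) ∉ N) ∧
      ∀ y, (∀ x, (x, y) ∉ M) → ∀ x, (x, y) ∉ N) : succW P.encode v P.n 0 := by
  -- The number `P.n` is the first that is not a worker; the firm entry 0 is a dummy.
  obtain ⟨l, hl⟩ := hP.lstable_of_le v 0 le_rfl
  have hN := h _ l (hl.congr rfl (fun x y hE => hP.hybrid_rw hE x.2.ne) fun x y hE =>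
    hP.hybrid_rf hE (Or.inl le_rfl))
  refine Or.inr ⟨le_rfl, ?_, ?_⟩
  · rintro ⟨x, -, hx, hd, y, -, hxy⟩
    lift x to Fin P.n using hx
    lift y to Fin P.m using hxy.1.2.1
    exact hN.1 x (fun y hy => (hP.difW_worker_iff x).1 hd (hM x y hy).1) y (hP.pairW_iff.1 hxy)
  · rintro ⟨y, -, hy, hd, x, -, hxy⟩
    lift y to Fin P.m using hy
    lift x to Fin P.n using hxy.1.1
    exact hN.2 y (fun x hx => (hP.difW_firm_iff y).1 hd (hM x y hx).2) x (hP.pairW_iff.1 hxy)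

/-- If a matched agent differs in the two instances, then no agent outside its edge does. -/
theorem cases_matching (hP : P.OneAgentPerturbed) (M : Finset (Fin P.n × Fin P.m)) :
    (∃ a b, (a, b) ∈ M ∧ (∀ x, x ≠ a → P.A.worker x = P.B.worker x) ∧
      ∀ y, y ≠ b → P.A.firm y = P.B.firm y) ∨
    ∀ x y, (x, y) ∈ M → P.A.worker x = P.B.worker x ∧ P.A.firm y = P.B.firm y := by
  by_contra! hno
  obtain ⟨h1, a, b, hab, h2⟩ := hno
  -- One end of `(a, b)` differs, and it is the only differing agent, so `(a, b)` satisfies the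
  -- first alternative.
  have key : ∀ z, P.A.DifferAt P.B z → z = Sum.inl a ∨ z = Sum.inr b := by
    intro z hz
    by_cases ha : P.A.worker a = P.B.worker a
    · exact Or.inr (hP.2 hz (h2 ha))
    · exact Or.inl (hP.2 hz ha)
  obtain ⟨y, hy, hne⟩ := h1 a b hab fun x hx => by
    by_contra hne
    simpa [hx] using key (.inl x) hne
  simpa [hy] using key (.inr y) hne

/-- `M` itself need not be found: the matching of the candidate shares with it only the target edge,
or the property of leaving the differing agents unmatched. -/
theorem exists_succW_of_isRobustPopular (hP : P.OneAgentPerturbed) {M : Finset (Fin P.n × Fin P.m)}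
    (h : MatP.IsRobustPopular P.A P.B M) :
    ∃ v < 3, ∃ a < loopBound P.encode.length, ∃ b < loopBound P.encode.length,
      succW P.encode v a b := by
  have hn := P.lt_loopBound_worker
  have hm := P.lt_loopBound_firm
  have hA := MatP.isPopular_iff.1 h.1
  have hB := MatP.isPopular_iff.1 h.2
  rcases hP.cases_matching M with ⟨a, b, hab, hw, hf⟩ | hM
  · have hH := (hP.isHybrid_of_mem hA.1 hab hw hf).isPop_of (D := P.A.DifferAt P.B) hP.2
      (fun x hx => funext fun y => congrArg (List.idxOf y) (not_not.1 hx))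
      (fun y hy => funext fun x => congrArg (List.idxOf x) (not_not.1 hy)) hA hB
    have ha : (a : ℕ) < loopBound P.encode.length := by have := a.2; omega
    have hb := b.2.trans hm
    rcases hH.exists_lstable hab with ⟨N, l, hl, hab'⟩ | ⟨N, l, hl, hab'⟩
    · exact ⟨0, by omega, a, ha, b, hb, hP.succW_of_lstable hl hab'
        (Nat.lt_one_iff.1 (hl.lt_L a)) hw hf⟩
    · have h2 := hl.lt_L a
      -- Kinds 1 and 2 have their targets at levels 0 and 1.
      refine ⟨l a + 1, by omega, a, ha, b, hb, hP.succW_of_lstable (v := l a + 1) hl hab' ?_ hw hf⟩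
      unfold levW
      split_ifs <;> omega
  · exact ⟨0, by omega, P.n, by omega, 0, by omega,
      hP.succW_of_unmatched hM fun N l hl => MatP.unmatched_of_isPop hA hl⟩

/-- A matching that is dominant in the hybrid is itself stable with two levels, so the target edge
can be used without passing to another matching. -/
theorem exists_succW_of_isRobustDominant (hP : P.OneAgentPerturbed) {M : Finset (Fin P.n × Fin P.m)}
    (h : MatP.IsRobustDominant P.A P.B M) :
    ∃ v < 3, 1 ≤ v ∧ ∃ a < loopBound P.encode.length, ∃ b < loopBound P.encode.length,
      succW P.encode v a b := by
  have hn := P.lt_loopBound_worker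
  have hm := P.lt_loopBound_firm
  have hA := MatP.isDominant_iff.1 h.1
  have hB := MatP.isDominant_iff.1 h.2
  rcases hP.cases_matching M with ⟨a, b, hab, hw, hf⟩ | hM
  · have hH := (hP.isHybrid_of_mem hA.1.1 hab hw hf).isDom_of (D := P.A.DifferAt P.B) hP.2
      (fun x hx => funext fun y => congrArg (List.idxOf y) (not_not.1 hx))
      (fun y hy => funext fun x => congrArg (List.idxOf x) (not_not.1 hy)) hA hB
    obtain ⟨l, hl⟩ := hH.exists_lstable
    have h2 := hl.lt_L a
    refine ⟨l a + 1, by omega, by omega, a, by have := a.2; omega, b, b.2.trans hm,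
      hP.succW_of_lstable (v := l a + 1) hl hab ?_ hw hf⟩
    unfold levW
    split_ifs <;> omega
  · exact ⟨1, by omega, le_rfl, P.n, by omega, 0, by omega,
      hP.succW_of_unmatched hM fun N l hl => MatP.unmatched_of_isDom hA hl⟩

end InstancePair.OneAgentPerturbed

/-! ### The output word -/

namespace RobustAlg

open RAM

theorem range_add_self_map (c : ℕ) (f : ℕ → ℕ) :
    (List.range (c + c)).map f = (List.range c).flatMap fun i => [f (i + i), f (i + i + 1)] := by
  induction c with
  | zero => rfl
  | succ c ih =>
    rw [show c + 1 + (c + 1) = c + c + 1 + 1 by ring, List.range_succ, List.range_succ,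
      List.range_succ, List.flatMap_append, ← ih]
    simp

theorem exists_of_lt_count {p : ℕ → Prop} [DecidablePred p] {i n : ℕ} (h : i < Nat.count p n) :
    ∃ x < n, p x ∧ Nat.count p x = i := by
  induction n with
  | zero => simp at h
  | succ n ih =>
    by_cases hi : i < Nat.count p n
    · obtain ⟨x, hx, h'⟩ := ih hi
      exact ⟨x, by omega, h'⟩
    · rw [Nat.count_succ] at h
      split_ifs at h with hp
      · exact ⟨n, by omega, hp, by omega⟩
      · omega

variable {w : List ℕ} {v₀ : ℕ}

theorem halfW_add_self {i : ℕ} (h : i ≤ loopBound w.length) : halfW w (i + i) = i := by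
  classical
  unfold halfW
  rw [← Finset.card_filter, ← Finset.card_range i]
  congr 1
  ext j
  simp only [Finset.mem_filter, Finset.mem_range, Finset.card_range]
  omega

theorem halfW_add_self_add_one {i : ℕ} (h : i ≤ loopBound w.length) :
    halfW w (i + i + 1) = i := by
  classical
  unfold halfW
  rw [← Finset.card_filter, ← Finset.card_range i]
  congr 1
  ext j
  simp only [Finset.mem_filter, Finset.mem_range, Finset.card_range]
  omega

open Classical in
theorem countW_eq {x : ℕ} (hx : x ≤ loopBound w.length) :
    countW w v₀ x = Nat.count (matchedW w v₀) x := by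
  rw [Nat.count_eq_card_filter_range, Finset.card_filter, countW, ← Finset.sum_filter,
    ← Finset.sum_filter]
  refine Finset.sum_congr ?_ fun _ _ => rfl
  ext j
  simp only [Finset.mem_filter, Finset.mem_range]
  constructor
  · rintro ⟨-, h⟩; exact h
  · rintro ⟨h1, h2⟩; exact ⟨by omega, h1, h2⟩

/-- The found candidate is successful. -/
theorem found_spec (h : foundW w v₀) :
    v₀ ≤ vW w v₀ ∧ succW w (vW w v₀) (aW w v₀) (bW w v₀) := by
  obtain ⟨-, ⟨h1, -, h2⟩, -⟩ := least_spec h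
  obtain ⟨-, h3, -⟩ := least_spec h2
  obtain ⟨-, h4, -⟩ := least_spec h3
  exact ⟨h1, h4⟩

theorem partnerW_spec {x : ℕ} (h : matchedW w v₀ x) : outPairW w v₀ x (partnerW w v₀ x) :=
  (least_spec h).2.1

open Classical in
theorem nthW_spec {n i : ℕ} (hn : n ≤ loopBound w.length)
    (hi : i < Nat.count (matchedW w v₀) n) :
    matchedW w v₀ (nthW w v₀ i) ∧ Nat.count (matchedW w v₀) (nthW w v₀ i) = i := by
  obtain ⟨x, hx, h1, h2⟩ := exists_of_lt_count hi
  obtain ⟨h3, ⟨h4, h5⟩, -⟩ := least_spec (n := loopBound w.length)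
    (p := fun x => matchedW w v₀ x ∧ countW w v₀ x = i)
    ⟨x, by omega, h1, by rw [countW_eq (by omega), h2]⟩
  exact ⟨h4, (countW_eq h3.le).symm.trans h5⟩

end RobustAlg

namespace InstancePair.OneAgentPerturbed

open RobustAlg RAM

variable {P : InstancePair} {v₀ : ℕ}

theorem outLenW_le (P : InstancePair) (v₀ : ℕ) :
    outLenW P.encode v₀ ≤ loopBound P.encode.length := by
  classical
  have hn := P.lt_loopBound_worker
  unfold outLenW
  split_ifs
  · change countW P.encode v₀ P.n + countW P.encode v₀ P.n + 1 ≤ _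
    rw [countW_eq (by omega)]
    have := Nat.count_le (p := matchedW P.encode v₀) (n := P.n)
    omega
  · omega

/-- The output word lists the pairs of the matching of the found candidate. -/
theorem isAnswer (hP : P.OneAgentPerturbed) {Good : Finset (Fin P.n × Fin P.m) → Prop}
    (hsound : ∀ v a b, v₀ ≤ v → succW P.encode v a b → Good (hP.candidateMatching v a b))
    (hcomplete : (∃ M, Good M) → foundW P.encode v₀) :
    P.IsAnswer Good ((List.range (outLenW P.encode v₀)).map (outW P.encode v₀)) := by
  classical
  have hn := P.lt_loopBound_worker
  by_cases hfound : foundW P.encode v₀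
  swap
  · refine Or.inl ⟨fun h => hfound (hcomplete h), ?_⟩
    simp [outLenW, outW, hfound]
  obtain ⟨hv, hs⟩ := found_spec hfound
  refine Or.inr ?_
  set M := hP.candidateMatching (vW P.encode v₀) (aW P.encode v₀) (bW P.encode v₀) with hM
  have hpair : ∀ x y, outPairW P.encode v₀ x y ↔
      ∃ e ∈ M, (e.1 : ℕ) = x ∧ (e.2 : ℕ) = y := by
    intro x y
    constructor
    · intro h
      exact ⟨(⟨x, h.1.1⟩, ⟨y, h.1.2.1⟩), hP.pairW_iff.1 h, rfl, rfl⟩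
    · rintro ⟨e, he, rfl, rfl⟩
      exact hP.pairW_iff.2 he
  have hmatch : IsMatchingOf P.A.Edge M := by
    obtain ⟨⟨l, hl⟩, -⟩ := hP.lstable_of_succW hs
    exact hl.matching
  set c := Nat.count (matchedW P.encode v₀) P.n with hc
  have hcn : c ≤ P.n := Nat.count_le _
  have hg : ∀ i : Fin c, ∃ e ∈ M, (e.1 : ℕ) = nthW P.encode v₀ i ∧
      (e.2 : ℕ) = partnerW P.encode v₀ (nthW P.encode v₀ i) := fun i =>
    (hpair _ _).1 (partnerW_spec (nthW_spec (by omega) i.2).1)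
  choose g hgM hg1 hg2 using hg
  refine ⟨(List.finRange c).map g, (List.nodup_finRange c).map fun i j hij => ?_, ?_, ?_⟩
  · have h1 := (nthW_spec (w := P.encode) (v₀ := v₀) (by omega) i.2).2
    have h2 := (nthW_spec (w := P.encode) (v₀ := v₀) (by omega) j.2).2
    rw [← hg1, hij, hg1, h2] at h1
    exact Fin.ext h1.symm
  · have : ((List.finRange c).map g).toFinset = M := by
      ext e
      simp only [List.mem_toFinset, List.mem_map, List.mem_finRange, true_and]
      constructor
      · rintro ⟨i, rfl⟩
        exact hgM i
      · intro he
        have hm : matchedW P.encode v₀ e.1 :=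
          ⟨e.2, e.2.2.trans P.lt_loopBound_firm, (hpair _ _).2 ⟨e, he, rfl, rfl⟩⟩
        have hlt : Nat.count (matchedW P.encode v₀) e.1 < c := Nat.count_strict_mono hm e.1.2
        refine ⟨⟨_, hlt⟩, ?_⟩
        have h1 := nthW_spec (w := P.encode) (v₀ := v₀) (by omega) hlt
        have h2 := Nat.count_injective h1.1 hm h1.2
        have hgj := hgM ⟨_, hlt⟩
        -- The index of a pair in the output is the number of matched workers before its worker;
        -- since these counts determine matched workers, the listed pair with this index has the
        -- worker of `e`, hence is `e`.
        have h3 : (g ⟨_, hlt⟩).1 = e.1 := Fin.ext ((hg1 ⟨_, hlt⟩).trans h2)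
        generalize g ⟨_, hlt⟩ = e' at hgj h3 ⊢
        exact Prod.ext h3 (hmatch.firm_unique (w := e.1) (h3 ▸ hgj) he)
    rw [this]
    exact hsound _ _ _ hv hs
  · have hlen : outLenW P.encode v₀ = c + c + 1 := by
      rw [outLenW, if_pos hfound]
      change countW P.encode v₀ P.n + countW P.encode v₀ P.n + 1 = _
      rw [countW_eq (by omega)]
    rw [hlen, List.range_succ_eq_map, List.map_cons, List.map_map, range_add_self_map,
      ← List.map_coe_finRange_eq_range, List.flatMap_map, List.flatMap_map]
    congr 1
    · simp [outW, hfound]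
    · refine List.flatMap_congr fun i _ => ?_
      have h1 := halfW_add_self (w := P.encode) (i := i) (by omega)
      have h2 := halfW_add_self_add_one (w := P.encode) (i := i) (by omega)
      simp only [Function.comp, outW, Nat.succ_ne_zero, if_false, Nat.succ_eq_add_one,
        Nat.add_sub_cancel, h1, h2, if_true, hg1, hg2]
      rw [if_neg (by omega)]

theorem isAnswer_robustPopular (hP : P.OneAgentPerturbed) :
    P.IsAnswer (MatP.IsRobustPopular P.A P.B)
      ((List.range (outLenW P.encode 0)).map (outW P.encode 0)) := by
  refine hP.isAnswer (fun v a b _ h => hP.isRobustPopular_of_succW h) ?_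
  rintro ⟨M, hM⟩
  obtain ⟨v, hv, a, ha, b, hb, h⟩ := hP.exists_succW_of_isRobustPopular hM
  exact ⟨v, hv.trans_le (by unfold loopBound; omega), Nat.zero_le _, hv, a, ha, b, hb, h⟩

theorem isAnswer_robustDominant (hP : P.OneAgentPerturbed) :
    P.IsAnswer (MatP.IsRobustDominant P.A P.B)
      ((List.range (outLenW P.encode 1)).map (outW P.encode 1)) := by
  refine hP.isAnswer (fun v a b hv h => hP.isRobustDominant_of_succW hv h) ?_
  rintro ⟨M, hM⟩
  obtain ⟨v, hv, hv1, a, ha, b, hb, h⟩ := hP.exists_succW_of_isRobustDominant hM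
  exact ⟨v, hv.trans_le (by unfold loopBound; omega), hv1, hv, a, ha, b, hb, h⟩

end InstancePair.OneAgentPerturbed

/-- The parameter is the smallest admissible kind: 0 includes the one-level candidates, whose
matchings are popular; 1 leaves the two-level candidates, whose matchings are dominant. -/
theorem mainTheorem1 :
    RAM.PolyTimeSolvable InstancePair.encode InstancePair.OneAgentPerturbed
        (fun P out => P.IsAnswer (MatP.IsRobustPopular P.A P.B) out) ∧
      RAM.PolyTimeSolvable InstancePair.encode InstancePair.OneAgentPerturbed
        (fun P out => P.IsAnswer (MatP.IsRobustDominant P.A P.B) out) :=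
  ⟨RAM.polyTimeSolvable (RobustAlg.c_outLenW (.const 0)) (RobustAlg.c_outW (.const 0) .last)
      (fun P _ => InstancePair.OneAgentPerturbed.outLenW_le P 0)
      fun _ hP => hP.isAnswer_robustPopular,
    RAM.polyTimeSolvable (RobustAlg.c_outLenW (.const 1)) (RobustAlg.c_outW (.const 1) .last)
      (fun P _ => InstancePair.OneAgentPerturbed.outLenW_le P 1)
      fun _ hP => hP.isAnswer_robustDominant⟩
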